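/- Let $n\ge 2$, let $v_1,\dots,v_{n+1}\in\mathbb{R}^n$ be the vertices of a regular simplex with $|v_\ell|=1$ for every $1\le \ell\le n+1$, and let $X$ be a random vector uniformly distributed in the regular simplex \[ \Delta_n=\sqrt{n(n+2)}\,\operatorname{conv}\{v_1,\dots,v_{n+1}\}\subset\mathbb{R}^n . \] Let $\theta_1,\dots,\theta_k\in\mathbb{R}^n$ be orthonormal, let $W=(W_1,\dots,W_k)$ with $W_i=\langle X,\theta_i\rangle$, and let $Z$ be a standard Gaussian random vector in $\mathbb{R}^k$. Then \[ d_1(W,Z)\le 20\sqrt{k\sum_{i=1}^k\sqrt{\sum_{\ell=1}^{n+1}\langle\theta_i,v_\ell\rangle^4}} \] and \[ d_{TV}(W,Z)\le C\,k^{5/6}\left(\sum_{i=1}^k\sqrt{\sum_{\ell=1}^{n+1}\langle\theta_i,v_\ell\rangle^4}\right)^{1/3}, \] where $C>0$ is a universal constant (independent of $n$, $k$, the $v_\ell$ and the $\theta_i$). Here $d_1(X,Y)=\sup\{|\mathbb{E}f(X)-\mathbb{E}f(Y)| : f:\mathbb{R}^k\to\mathbb{R},\ |f(x)-f(y)|\le|x-y|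 \text{ for all } x,y\}$ is the $L_1$-Wasserstein distance, and $d_{TV}(X,Y)=2\sup\{|\mathbb{P}[X\in A]-\mathbb{P}[Y\in A]| : A\subset\mathbb{R}^k \text{ measurable}\}$ is the total variation distance. -/

import Mathlib

open MeasureTheory ProbabilityTheory
open scoped Pointwise ENNReal

noncomputable section

/-- The total variation distance between the distributions of two random vectors, normalized as
`2 * sup_A |P[X ∈ A] - P'[Y ∈ A]|`, the supremum being over all measurable sets `A`. -/
def tvDist {Ω Ω' E : Type*} [MeasurableSpace Ω] [MeasurableSpace Ω'] [MeasurableSpace E]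
    (P : Measure Ω) (X : Ω → E) (P' : Measure Ω') (Y : Ω' → E) : ℝ≥0∞ :=
  2 * ⨆ (A : Set E) (_ : MeasurableSet A),
    ENNReal.ofReal |P.real (X ⁻¹' A) - P'.real (Y ⁻¹' A)|

/-- The `L₁`-Wasserstein distance between the distributions of two random vectors (with finite
first moments): the supremum of `|𝔼 f(X) - 𝔼 f(Y)|` over all `1`-Lipschitz functions `f`. -/
def wassersteinDist {Ω Ω' E : Type*} [MeasurableSpace Ω] [MeasurableSpace Ω']
    [PseudoEMetricSpace E]
    (P : Measure Ω) (X : Ω → E) (P' : Measure Ω') (Y : Ω' → E) : ℝ≥0∞ :=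
  ⨆ (f : E → ℝ) (_ : LipschitzWith 1 f),
    ENNReal.ofReal |(∫ ω, f (X ω) ∂P) - ∫ ω, f (Y ω) ∂P'|

/-- The regular simplex `√(n(n+2)) conv {v₁, …, vₙ₊₁}` spanned by the rescaled vertices of `S`. -/
def scaledSimplex {n : ℕ} (S : Affine.Simplex ℝ (EuclideanSpace ℝ (Fin n)) n) :
    Set (EuclideanSpace ℝ (Fin n)) :=
  Real.sqrt (n * (n + 2)) • convexHull ℝ (Set.range S.points)

/-- The random vector `W` in `ℝᵏ` with coordinates `Wᵢ = ⟨X, θᵢ⟩`. -/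
def marginal {Ω : Type*} {n k : ℕ} (θ : Fin k → EuclideanSpace ℝ (Fin n))
    (X : Ω → EuclideanSpace ℝ (Fin n)) (ω : Ω) : EuclideanSpace ℝ (Fin k) :=
  WithLp.toLp 2 fun i => inner ℝ (X ω) (θ i)

/-- The quantity `∑ᵢ √(∑_ℓ ⟨θᵢ, v_ℓ⟩⁴)`. -/
def fourthMomentSum {n k : ℕ} (θ : Fin k → EuclideanSpace ℝ (Fin n))
    (v : Fin (n + 1) → EuclideanSpace ℝ (Fin n)) : ℝ :=
  ∑ i : Fin k, Real.sqrt (∑ l : Fin (n + 1), (inner ℝ (θ i) (v l)) ^ 4)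

end

/-!
The proof is Stein's method for the uniform measure `μ` on the simplex, with an explicit Stein
kernel.

Let `N = n + 1`, let `pₗ` be the vertices of the simplex, `λₗ` the barycentric coordinates, and
`wₗ = W pₗ`, where `W` is the linear map with coordinates `⟪θᵢ, ·⟫`. The vector field
`λₗ(x) (pₗ - x)` is tangent to the facets of the simplex and has divergence `1 - N λₗ`, so that
`∫ λₗ Dg(pₗ - x) dμ = ∫ (N λₗ - 1) g dμ` for every `C¹` function `g`
(`AffineBasis.setIntegral_coord_mul_fderiv`; the proof integrates over the homotheties centred at
`pₗ` instead of using the divergence theorem). Combining these fields with the coefficients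
`(wₗ)ⱼ / N` gives fields `uⱼ` with `∫ Dg(uⱼ) dμ = ∫ Wⱼ g dμ` (`simplexFrame`), whose images under
`W` are the columns of the Stein kernel `T = (1/N) (∑ₗ λₗ wₗ ⊗ wₗ - W ⊗ W)`.

*Wasserstein distance.* Rotating from an independent Gaussian vector `Z` to `W` along
`sin t • W + cos t • Z` and integrating by parts in both variables bounds the distance by
`(π/2) S`, where `S = ∫ ‖T - 1‖_HS dμ` is the Stein discrepancy
(`SteinFrame.abs_integral_sub_le`).

*Total variation.* Where `T` is close to the identity it can be inverted, so a derivative of a test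
function along `W` can be moved onto a bounded density. Hence the law of `W` is stable under
translations, up to the error `6 S` from the region where `T` is far from the identity
(`SteinFrame.abs_integral_translate_sub_le`). Smoothing with a Gaussian vector of size `t` then
costs little, and turns test functions bounded by `1` into `(1/t)`-Lipschitz ones, to which the
Wasserstein bound applies (`SteinFrame.abs_measureReal_sub_le`).

*The simplex.* The covariance matrix of the barycentric coordinates is at most `1 / (N (N + 1))`
(`simplexUniform_norm_sq_sum_le`), which gives
`S ≤ (1/N) (√(∑ₗ ‖wₗ‖⁴ / (N (N + 1))) + 2 k)` (`IsotropicMap.discrepancy_le`), because the `wₗ` form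
a tight frame. With `F = ∑ᵢ √(∑ₗ ⟪θᵢ, vₗ⟫⁴)` the first term is at most `√k F`. Since `F ≥ k / √N`
(`Affine.Simplex.Regular.card_sq_div_le`), the second is absorbed when `F ≤ 1`, whence `S ≤ 3 √k F`.
For larger `F`, as well as for `k^(5/2) F > 1` in the case of total variation, trivial bounds
suffice. In the remaining range the choice `t = k^(-3/4) F^(1/2)` balances the error
terms.
-/

set_option linter.unusedSectionVars false

noncomputable section

/-! ### Integration by parts on a simplex -/

section Simplex

variable {ι E : Type*} [Fintype ι] [NormedAddCommGroup E] [NormedSpace ℝ E]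
  [FiniteDimensional ℝ E] [MeasurableSpace E] [BorelSpace E]

theorem AffineBasis.isCompact_convexHull (b : AffineBasis ι ℝ E) :
    IsCompact (convexHull ℝ (Set.range b)) :=
  (Set.finite_range b).isCompact_convexHull ℝ

theorem AffineBasis.mem_convexHull_iff (b : AffineBasis ι ℝ E) (x : E) :
    x ∈ convexHull ℝ (Set.range b) ↔ ∀ i, 0 ≤ b.coord i x := by
  rw [b.convexHull_eq_nonneg_coord]; rfl

theorem AffineBasis.coord_add_smul_sub (b : AffineBasis ι ℝ E) (i l : ι) (s : ℝ) (x : E) :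
    b.coord i (b l + s • (x - b l)) = (1 - s) * b.coord i (b l) + s * b.coord i x := by
  have : b l + s • (x - b l) = AffineMap.lineMap (b l) x s := by
    rw [AffineMap.lineMap_apply]; simp [add_comm]
  rw [this, AffineMap.apply_lineMap, AffineMap.lineMap_apply]
  simp; ring

theorem AffineBasis.coord_linear_sub (b : AffineBasis ι ℝ E) (i : ι) (x y : E) :
    (b.coord i).linear (x - y) = b.coord i x - b.coord i y := by
  simpa using (b.coord i).linearMap_vsub x y

theorem AffineBasis.hasFDerivAt_coord (b : AffineBasis ι ℝ E) (i : ι) (x : E) :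
    HasFDerivAt (b.coord i) (LinearMap.toContinuousLinearMap (b.coord i).linear) x := by
  have h : (b.coord i : E → ℝ) = fun y =>
      LinearMap.toContinuousLinearMap (b.coord i).linear y + b.coord i 0 := by
    funext y
    have := b.coord_linear_sub i y 0
    simp at this ⊢
    linarith
  rw [h]
  exact (ContinuousLinearMap.hasFDerivAt _).add_const _

theorem AffineBasis.contDiff_coord (b : AffineBasis ι ℝ E) (i : ι) {m : WithTop ℕ∞} :
    ContDiff ℝ m (b.coord i) := by
  have h : (b.coord i : E → ℝ) = fun y =>
      LinearMap.toContinuousLinearMap (b.coord i).linear y + b.coord i 0 := by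
    funext y
    have := b.coord_linear_sub i y 0
    simp at this ⊢
    linarith
  rw [h]
  fun_prop

theorem AffineBasis.coord_le_one (b : AffineBasis ι ℝ E) (i : ι) {x : E}
    (hx : x ∈ convexHull ℝ (Set.range b)) : b.coord i x ≤ 1 := by
  rw [b.mem_convexHull_iff] at hx
  rw [← b.sum_coord_apply_eq_one x]
  exact Finset.single_le_sum (f := fun i => b.coord i x) (fun j _ => hx j) (Finset.mem_univ i)

variable (ν : Measure E) [ν.IsAddHaarMeasure]

/-- The homothety of ratio `s` centred at a vertex maps the simplex onto the part of it where the
barycentric coordinate of that vertex is at least `1 - s`. -/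
theorem AffineBasis.integral_homothety (b : AffineBasis ι ℝ E) (l : ι) {s : ℝ} (hs : 0 < s)
    (hs1 : s ≤ 1) (G : E → ℝ) :
    s ^ Module.finrank ℝ E * ∫ x in convexHull ℝ (Set.range b), G (b l + s • (x - b l)) ∂ν
      = ∫ x in convexHull ℝ (Set.range b), {y | 1 - s ≤ b.coord l y}.indicator G x ∂ν := by
  classical
  set K := convexHull ℝ (Set.range b) with hK
  have hKm : MeasurableSet K := b.isCompact_convexHull.measurableSet
  set F : E → ℝ := K.indicator ({y | 1 - s ≤ b.coord l y}.indicator G) with hF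
  have h1 : ∀ x, F (b l + s • (x - b l))
      = K.indicator (fun x => G (b l + s • (x - b l))) x := by
    intro x
    have hmem : (b l + s • (x - b l) ∈ K ∧ 1 - s ≤ b.coord l (b l + s • (x - b l))) ↔ x ∈ K := by
      simp only [hK, b.mem_convexHull_iff, b.coord_add_smul_sub]
      constructor
      · rintro ⟨h, h'⟩ i
        by_cases hil : i = l
        · subst hil
          rw [b.coord_apply_eq] at h'
          nlinarith
        · have := h i
          rw [b.coord_apply_ne hil] at this
          nlinarith
      · intro h
        refine ⟨fun i => ?_, ?_⟩
        · have : 0 ≤ b.coord i (b l) := by rw [b.coord_apply]; split_ifs <;> norm_num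
          have := h i
          have h3 : 0 ≤ 1 - s := by linarith
          positivity
        · rw [b.coord_apply_eq]
          have := h l
          nlinarith [mul_nonneg hs.le this]
    simp only [hF, Set.indicator_apply, Set.mem_ofPred_eq]
    by_cases hx : x ∈ K
    · rw [if_pos (hmem.2 hx).1, if_pos (hmem.2 hx).2, if_pos hx]
    · rw [if_neg hx]
      by_cases h2 : b l + s • (x - b l) ∈ K
      · rw [if_pos h2, if_neg fun h3 => hx (hmem.1 ⟨h2, h3⟩)]
      · rw [if_neg h2]
  rw [← integral_indicator hKm, ← integral_indicator hKm]
  simp_rw [← h1]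
  rw [integral_sub_right_eq_self (fun y => F (b l + s • y)) (b l),
    Measure.integral_comp_smul ν (fun y => F (b l + y)) s, integral_add_left_eq_self F (b l),
    abs_of_nonneg (by positivity), smul_eq_mul, ← mul_assoc, mul_inv_cancel₀ (by positivity),
    one_mul]

theorem integral_swap_of_continuous {K : Set E} (hK : IsCompact K) {h : ℝ → E → ℝ}
    (hc : Continuous (Function.uncurry h)) :
    ∫ s in (0:ℝ)..1, ∫ x in K, h s x ∂ν = ∫ x in K, (∫ s in (0:ℝ)..1, h s x) ∂ν := by
  simp_rw [intervalIntegral.integral_of_le zero_le_one]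
  apply integral_integral_swap
  rw [Measure.prod_restrict]
  exact (hc.continuousOn.integrableOn_compact (isCompact_Icc.prod hK)).mono_set
    (Set.prod_mono Set.Ioc_subset_Icc_self le_rfl)

/-- Layer-cake formula for the weight `b.coord l`, whose superlevel sets in the simplex are
homothetic copies of the simplex. -/
theorem AffineBasis.integral_coord_mul (b : AffineBasis ι ℝ E) (l : ι) {G : E → ℝ}
    (hG : Continuous G) :
    ∫ x in convexHull ℝ (Set.range b), b.coord l x * G x ∂ν
      = ∫ s in (0:ℝ)..1, s ^ Module.finrank ℝ E *
          ∫ x in convexHull ℝ (Set.range b), G (b l + s • (x - b l)) ∂ν := by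
  set K := convexHull ℝ (Set.range b) with hK
  have hKm : MeasurableSet K := b.isCompact_convexHull.measurableSet
  have hKfin : ν K < ∞ := b.isCompact_convexHull.measure_lt_top
  have : IsFiniteMeasure (ν.restrict K) := ⟨by simpa using hKfin⟩
  rw [intervalIntegral.integral_of_le zero_le_one,
    setIntegral_congr_fun measurableSet_Ioc fun s hs => b.integral_homothety ν l hs.1 hs.2 G]
  have hint : Integrable (Function.uncurry fun (s : ℝ) (x : E) =>
      {y | 1 - s ≤ b.coord l y}.indicator G x)
      ((volume.restrict (Set.Ioc (0:ℝ) 1)).prod (ν.restrict K)) := by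
    have h1 : Integrable (fun q : ℝ × E => G q.2)
        ((volume.restrict (Set.Ioc (0:ℝ) 1)).prod (ν.restrict K)) :=
      (hG.continuousOn.integrableOn_compact b.isCompact_convexHull).integrable.comp_snd _
    have h2 : MeasurableSet {q : ℝ × E | 1 - q.1 ≤ b.coord l q.2} :=
      measurableSet_le (by fun_prop)
        ((continuous_barycentric_coord b l).measurable.comp measurable_snd)
    exact h1.indicator h2
  rw [integral_integral_swap hint]
  refine setIntegral_congr_fun hKm fun x hx => ?_
  have h0 : 0 ≤ b.coord l x := (b.mem_convexHull_iff x).1 hx l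
  have h1 : b.coord l x ≤ 1 := b.coord_le_one l hx
  have h2 : ∀ s : ℝ, {y | 1 - s ≤ b.coord l y}.indicator G x
      = (Set.Ici (1 - b.coord l x)).indicator (fun _ => G x) s := by
    intro s
    simp only [Set.indicator_apply, Set.mem_ofPred_eq, Set.mem_Ici]
    congr 1
    exact propext ⟨fun h => by linarith, fun h => by linarith⟩
  simp_rw [h2]
  rw [setIntegral_indicator measurableSet_Ici, setIntegral_const, smul_eq_mul]
  congr 1
  have hv : volume (Set.Ioc (0:ℝ) 1 ∩ Set.Ici (1 - b.coord l x))
      = ENNReal.ofReal (b.coord l x) := by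
    refine le_antisymm ?_ ?_
    · calc _ ≤ volume (Set.Icc (1 - b.coord l x) 1) :=
            measure_mono fun s hs =>
              Set.mem_Icc.2 ⟨Set.mem_Ici.1 hs.2, hs.1.2⟩
        _ = _ := by rw [Real.volume_Icc]; congr 1; ring
    · calc _ = volume (Set.Ioc (1 - b.coord l x) 1) := by
            rw [Real.volume_Ioc]; congr 1; ring
        _ ≤ _ := measure_mono fun s hs => by
          obtain ⟨h3, h4⟩ := hs
          exact ⟨⟨by linarith, h4⟩, h3.le⟩
  rw [Measure.real, hv, ENNReal.toReal_ofReal h0]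

/-- The vector field `x ↦ λ_l(x) (b l - x)` is tangent to every facet of the simplex and has
divergence `1 - (dim + 1) λ_l`. -/
theorem AffineBasis.setIntegral_coord_mul_fderiv (b : AffineBasis ι ℝ E) (l : ι) {g : E → ℝ}
    (hg : ContDiff ℝ 1 g) :
    ∫ x in convexHull ℝ (Set.range b), b.coord l x * fderiv ℝ g x (b l - x) ∂ν
      = ∫ x in convexHull ℝ (Set.range b),
          ((Module.finrank ℝ E + 1 : ℝ) * b.coord l x - 1) * g x ∂ν := by
  set K := convexHull ℝ (Set.range b) with hK
  have hKm : MeasurableSet K := b.isCompact_convexHull.measurableSet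
  have hKc := b.isCompact_convexHull
  set n := Module.finrank ℝ E
  have hg' : Continuous (fderiv ℝ g) := hg.continuous_fderiv one_ne_zero
  have hgc := hg.continuous
  have hlc := continuous_barycentric_coord b l
  have hintg : Integrable g (ν.restrict K) := hgc.continuousOn.integrableOn_compact hKc
  have hintlg : Integrable (fun x => b.coord l x * g x) (ν.restrict K) :=
    (hlc.mul hgc).continuousOn.integrableOn_compact hKc
  have e1 : ∀ s : ℝ, s ^ n * ∫ x in K, fderiv ℝ g (b l + s • (x - b l))
        (b l - (b l + s • (x - b l))) ∂ν
      = ∫ x in K, -(s ^ (n + 1) * fderiv ℝ g (b l + s • (x - b l)) (x - b l)) ∂ν := by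
    intro s
    rw [← integral_const_mul]
    congr 1; funext x
    rw [show b l - (b l + s • (x - b l)) = -(s • (x - b l)) by abel, map_neg, map_smul]
    simp; ring
  have e2 : ∀ x, ∫ s in (0:ℝ)..1, -(s ^ (n + 1) * fderiv ℝ g (b l + s • (x - b l)) (x - b l))
      = (n + 1 : ℝ) * (∫ s in (0:ℝ)..1, s ^ n * g (b l + s • (x - b l))) - g x := by
    intro x
    have hd1 : ∀ s ∈ Set.uIcc (0:ℝ) 1, HasDerivAt (fun s : ℝ => s ^ (n + 1))
        ((n + 1 : ℝ) * s ^ n) s := by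
      intro s _
      simpa using hasDerivAt_pow (n + 1) s
    have hd2 : ∀ s ∈ Set.uIcc (0:ℝ) 1, HasDerivAt (fun s : ℝ => g (b l + s • (x - b l)))
        (fderiv ℝ g (b l + s • (x - b l)) (x - b l)) s := by
      intro s _
      have h1 := ((hasDerivAt_id s).smul_const (x - b l)).const_add (b l)
      have h2 := (hg.differentiable one_ne_zero (b l + s • (x - b l))).hasFDerivAt
      simpa [Function.comp_def] using h2.comp_hasDerivAt s h1
    have h := intervalIntegral.integral_mul_deriv_eq_deriv_mul hd1 hd2
      (Continuous.intervalIntegrable (by fun_prop) _ _)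
      (Continuous.intervalIntegrable (by fun_prop) _ _)
    rw [intervalIntegral.integral_neg, h]
    simp only [mul_assoc, intervalIntegral.integral_const_mul]
    simp
  rw [b.integral_coord_mul ν l (G := fun x => fderiv ℝ g x (b l - x)) (by fun_prop)]
  change ∫ s in (0:ℝ)..1, s ^ n * ∫ x in K, fderiv ℝ g (b l + s • (x - b l))
        (b l - (b l + s • (x - b l))) ∂ν = _
  simp_rw [e1]
  rw [integral_swap_of_continuous ν hKc (by unfold Function.uncurry; fun_prop)]
  simp_rw [e2]
  have e3 : ∫ x in K, (∫ s in (0:ℝ)..1, s ^ n * g (b l + s • (x - b l))) ∂ν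
      = ∫ x in K, b.coord l x * g x ∂ν := by
    rw [b.integral_coord_mul ν l hgc,
      ← integral_swap_of_continuous ν hKc (by unfold Function.uncurry; fun_prop)]
    simp_rw [integral_const_mul]
    rfl
  have hint3 : Integrable (fun x => ∫ s in (0:ℝ)..1, s ^ n * g (b l + s • (x - b l)))
      (ν.restrict K) := by
    refine ContinuousOn.integrableOn_compact hKc (Continuous.continuousOn ?_)
    exact intervalIntegral.continuous_parametric_intervalIntegral_of_continuous'
      (by unfold Function.uncurry; fun_prop) _ _
  rw [integral_sub (hint3.const_mul _) hintg, integral_const_mul, e3, ← integral_const_mul,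
    ← integral_sub (hintlg.const_mul _) hintg]
  congr 1; funext x; ring

end Simplex

/-! ### Moments of the barycentric coordinates -/

section Moments

variable {ι E : Type*} [Fintype ι] [NormedAddCommGroup E] [NormedSpace ℝ E]
  [FiniteDimensional ℝ E] [MeasurableSpace E] [BorelSpace E]
  (b : AffineBasis ι ℝ E) (ν : Measure E) [ν.IsAddHaarMeasure]

/-- The uniform probability measure on the simplex spanned by an affine basis. -/
def simplexUniform : Measure E := ProbabilityTheory.cond ν (convexHull ℝ (Set.range b))

instance isProbabilityMeasure_simplexUniform : IsProbabilityMeasure (simplexUniform b ν) := by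
  apply cond_isProbabilityMeasure_of_finite
  · have h : (interior (convexHull ℝ (Set.range b))).Nonempty :=
      ⟨_, b.centroid_mem_interior_convexHull⟩
    exact (Measure.measure_pos_of_nonempty_interior ν h).ne'
  · exact b.isCompact_convexHull.measure_lt_top.ne

theorem integrable_simplexUniform {H : Type*} [NormedAddCommGroup H] {g : E → H}
    (hg : Continuous g) : Integrable g (simplexUniform b ν) := by
  have h : Integrable g (ν.restrict (convexHull ℝ (Set.range b))) :=
    hg.continuousOn.integrableOn_compact b.isCompact_convexHull
  have h0 : IsProbabilityMeasure (simplexUniform b ν) := inferInstance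
  unfold simplexUniform ProbabilityTheory.cond
  apply h.smul_measure
  intro h1
  rw [ENNReal.inv_eq_top] at h1
  have := h0.measure_univ
  simp [simplexUniform, ProbabilityTheory.cond, h1] at this

theorem ae_mem_simplexUniform : ∀ᵐ x ∂(simplexUniform b ν), x ∈ convexHull ℝ (Set.range b) :=
  ae_cond_mem b.isCompact_convexHull.measurableSet

theorem simplexUniform_coord_mul_fderiv (l : ι) {g : E → ℝ} (hg : ContDiff ℝ 1 g) :
    ∫ x, b.coord l x * fderiv ℝ g x (b l - x) ∂(simplexUniform b ν)
      = ∫ x, ((Module.finrank ℝ E + 1 : ℝ) * b.coord l x - 1) * g x ∂(simplexUniform b ν) := by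
  unfold simplexUniform ProbabilityTheory.cond
  rw [integral_smul_measure, integral_smul_measure, b.setIntegral_coord_mul_fderiv ν l hg]

theorem simplexUniform_coord (l : ι) :
    ∫ x, b.coord l x ∂(simplexUniform b ν) = 1 / (Module.finrank ℝ E + 1 : ℝ) := by
  have h := simplexUniform_coord_mul_fderiv b ν l (g := fun _ => (1:ℝ)) contDiff_const
  have hi := integrable_simplexUniform b ν (continuous_barycentric_coord b l)
  simp only [fderiv_fun_const, mul_one] at h
  rw [integral_sub (hi.const_mul _) (integrable_const _), integral_const_mul] at h
  simp at h
  field_simp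
  linarith

theorem simplexUniform_coord_mul_coord [DecidableEq ι] (l m : ι) :
    ∫ x, b.coord l x * b.coord m x ∂(simplexUniform b ν)
      = (1 + if l = m then 1 else 0) /
        ((Module.finrank ℝ E + 1 : ℝ) * (Module.finrank ℝ E + 2 : ℝ)) := by
  have h := simplexUniform_coord_mul_fderiv b ν l (b.contDiff_coord m)
  have hl := continuous_barycentric_coord b l
  have hm := continuous_barycentric_coord b m
  have hi := integrable_simplexUniform b ν hl
  have hj := integrable_simplexUniform b ν hm
  have hij : Integrable (fun x => b.coord l x * b.coord m x) (simplexUniform b ν) :=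
    integrable_simplexUniform b ν (hl.mul hm)
  have e1 : ∀ x, b.coord l x * fderiv ℝ (b.coord m) x (b l - x)
      = (if l = m then 1 else 0) * b.coord l x - b.coord l x * b.coord m x := by
    intro x
    rw [(b.hasFDerivAt_coord m x).fderiv, LinearMap.coe_toContinuousLinearMap',
      b.coord_linear_sub, b.coord_apply]
    simp only [eq_comm (a := m)]
    ring
  have e2 : ∀ x, ((Module.finrank ℝ E + 1 : ℝ) * b.coord l x - 1) * b.coord m x
      = (Module.finrank ℝ E + 1 : ℝ) * (b.coord l x * b.coord m x) - b.coord m x := by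
    intro x; ring
  simp_rw [e1, e2] at h
  rw [integral_sub (hi.const_mul _) hij, integral_sub (hij.const_mul _) hj, integral_const_mul,
    integral_const_mul, simplexUniform_coord, simplexUniform_coord] at h
  field_simp at h ⊢
  linarith

/-- With `N = dim E + 1`, the covariance matrix of the barycentric coordinates is `(N - J) / (N² (N + 1))`
for the all-ones matrix `J`, and so at most `1 / (N (N + 1))`. -/
theorem simplexUniform_norm_sq_sum_le {H : Type*} [NormedAddCommGroup H] [InnerProductSpace ℝ H]
    (v : ι → H) :
    ∫ x, ‖∑ l, (b.coord l x - 1 / (Module.finrank ℝ E + 1 : ℝ)) • v l‖ ^ 2 ∂(simplexUniform b ν)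
      ≤ (∑ l, ‖v l‖ ^ 2) / ((Module.finrank ℝ E + 1 : ℝ) * (Module.finrank ℝ E + 2 : ℝ)) := by
  classical
  set N : ℝ := Module.finrank ℝ E + 1 with hN
  have hN2 : (Module.finrank ℝ E + 2 : ℝ) = N + 1 := by rw [hN]; ring
  have hN0 : 0 < N := by positivity
  rw [hN2]
  have hc := fun l => continuous_barycentric_coord b l
  have e1 : ∀ x, ‖∑ l, (b.coord l x - 1 / N) • v l‖ ^ 2
      = ∑ l, ∑ m, ((b.coord l x - 1 / N) * (b.coord m x - 1 / N)) * inner ℝ (v l) (v m) := by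
    intro x
    rw [← real_inner_self_eq_norm_sq, sum_inner]
    refine Finset.sum_congr rfl fun l _ => ?_
    rw [inner_sum]
    refine Finset.sum_congr rfl fun m _ => ?_
    rw [real_inner_smul_left, real_inner_smul_right]; ring
  have e2 : ∀ l m, ∫ x, (b.coord l x - 1 / N) * (b.coord m x - 1 / N) ∂(simplexUniform b ν)
      = (if l = m then 1 else 0) / (N * (N + 1)) - 1 / (N ^ 2 * (N + 1)) := by
    intro l m
    have hl := integrable_simplexUniform b ν (hc l)
    have hm := integrable_simplexUniform b ν (hc m)
    have hlm : Integrable (fun x => b.coord l x * b.coord m x) (simplexUniform b ν) :=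
      integrable_simplexUniform b ν ((hc l).mul (hc m))
    have h1 : Integrable (fun x => b.coord l x * b.coord m x - 1 / N * b.coord l x)
        (simplexUniform b ν) := hlm.sub (hl.const_mul _)
    have h2 : Integrable (fun x => b.coord l x * b.coord m x - 1 / N * b.coord l x
        - 1 / N * b.coord m x) (simplexUniform b ν) := h1.sub (hm.const_mul _)
    have e3 : ∀ x, (b.coord l x - 1 / N) * (b.coord m x - 1 / N)
        = b.coord l x * b.coord m x - 1 / N * b.coord l x - 1 / N * b.coord m x + 1 / N ^ 2 := by
      intro x; ring_nf
    simp_rw [e3]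
    rw [integral_add h2 (integrable_const _), integral_sub h1 (hm.const_mul _),
      integral_sub hlm (hl.const_mul _), integral_const_mul, integral_const_mul,
      simplexUniform_coord, simplexUniform_coord, simplexUniform_coord_mul_coord]
    rw [hN2, ← hN]
    simp
    field_simp
    ring
  simp_rw [e1]
  have hint : ∀ l m, Integrable (fun x => (b.coord l x - 1 / N) * (b.coord m x - 1 / N)
      * inner ℝ (v l) (v m)) (simplexUniform b ν) := fun l m =>
    integrable_simplexUniform b ν (by have := hc l; have := hc m; fun_prop)
  rw [integral_finsetSum _ fun l _ => integrable_finsetSum _ fun m _ => hint l m]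
  simp_rw [fun l => integral_finsetSum Finset.univ (μ := simplexUniform b ν)
    (fun m _ => hint l m), integral_mul_const, e2]
  have e4 : ∑ l, ∑ m, ((if l = m then (1:ℝ) else 0) / (N * (N + 1)) - 1 / (N ^ 2 * (N + 1)))
      * inner ℝ (v l) (v m)
      = (∑ l, ‖v l‖ ^ 2) / (N * (N + 1)) - 1 / (N ^ 2 * (N + 1)) * ‖∑ l, v l‖ ^ 2 := by
    rw [← real_inner_self_eq_norm_sq, sum_inner, Finset.mul_sum, Finset.sum_div,
      ← Finset.sum_sub_distrib]
    refine Finset.sum_congr rfl fun l _ => ?_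
    rw [inner_sum, Finset.mul_sum]
    simp_rw [sub_mul]
    rw [Finset.sum_sub_distrib]
    simp [ite_div, ite_mul]
    field_simp
  rw [e4]
  have : 0 ≤ 1 / (N ^ 2 * (N + 1)) * ‖∑ l, v l‖ ^ 2 := by positivity
  linarith

end Moments

/-! ### The standard Gaussian measure -/

section Gaussian

/-- Stein's lemma in dimension one. -/
theorem gaussianReal_integral_mul_eq_deriv {g g' : ℝ → ℝ} (hg : ∀ x, HasDerivAt g (g' x) x)
    (hg' : Continuous g') {A B : ℝ} (hA : ∀ x, |g x| ≤ A) (hB : ∀ x, |g' x| ≤ B) :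
    ∫ x, x * g x ∂(gaussianReal 0 1) = ∫ x, g' x ∂(gaussianReal 0 1) := by
  set p := gaussianPDFReal 0 1 with hp
  have hpf : p = fun x => (√(2 * Real.pi))⁻¹ * Real.exp (-(1 / 2) * x ^ 2) := by
    funext x
    simp only [hp, gaussianPDFReal]
    norm_num
    left
    ring
  have hpd : ∀ x, HasDerivAt p (-x * p x) x := by
    intro x
    rw [hpf]
    have h1 : HasDerivAt (fun x : ℝ => -(1 / 2) * x ^ 2) (-x) x := by
      have := (hasDerivAt_pow 2 x).const_mul (-(1 / 2 : ℝ))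
      convert! this using 1
      simp
    have h2 := (h1.exp).const_mul (√(2 * Real.pi))⁻¹
    convert! h2 using 1
    ring
  have hpi : Integrable p := integrable_gaussianPDFReal 0 1
  have hxpi : Integrable fun x => -x * p x := by
    rw [hpf]
    have := (integrable_mul_exp_neg_mul_sq (b := 1 / 2) (by norm_num)).const_mul
      (-(√(2 * Real.pi))⁻¹)
    refine this.congr (ae_of_all _ fun x => ?_)
    ring
  have hgc : Continuous g := continuous_iff_continuousAt.2 fun x => (hg x).continuousAt
  have i1 : Integrable (g * fun x => -x * p x) :=
    hxpi.bdd_mul hgc.aestronglyMeasurable (ae_of_all _ hA)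
  have i2 : Integrable (g' * p) := hpi.bdd_mul hg'.aestronglyMeasurable (ae_of_all _ hB)
  have i3 : Integrable (g * p) := hpi.bdd_mul hgc.aestronglyMeasurable (ae_of_all _ hA)
  have h := integral_mul_deriv_eq_deriv_mul_of_integrable (fun x _ => hg x) (fun x _ => hpd x)
    i1 i2 i3
  rw [integral_gaussianReal_eq_integral_smul one_ne_zero,
    integral_gaussianReal_eq_integral_smul one_ne_zero]
  simp only [smul_eq_mul]
  calc ∫ x, p x * (x * g x) = - ∫ x, g x * (-x * p x) := by
        rw [← integral_neg]; congr 1; funext x; ring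
    _ = ∫ x, g' x * p x := by rw [h]; ring
    _ = _ := by congr 1; funext x; ring

variable {k : ℕ}

theorem integrable_of_norm_le_stdGaussian {g : EuclideanSpace ℝ (Fin k) → ℝ} (hg : Continuous g)
    {A B : ℝ} (hA : ∀ x, |g x| ≤ A + B * ‖x‖) :
    Integrable g (stdGaussian (EuclideanSpace ℝ (Fin k))) := by
  have h1 : Integrable (fun x : EuclideanSpace ℝ (Fin k) => A + B * ‖x‖)
      (stdGaussian (EuclideanSpace ℝ (Fin k))) :=
    (integrable_const _).add ((IsGaussian.integrable_id.norm).const_mul _)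
  exact h1.mono' hg.aestronglyMeasurable (ae_of_all _ hA)

theorem stdGaussian_integral_coord_mul {g : EuclideanSpace ℝ (Fin k) → ℝ} (hg : ContDiff ℝ 1 g)
    {A B : ℝ} (hA : ∀ x, |g x| ≤ A) (hB : ∀ x, ‖fderiv ℝ g x‖ ≤ B) (i : Fin k) :
    ∫ x, x i * g x ∂(stdGaussian (EuclideanSpace ℝ (Fin k)))
      = ∫ x, fderiv ℝ g x (EuclideanSpace.single i 1)
          ∂(stdGaussian (EuclideanSpace ℝ (Fin k))) := by
  obtain _ | m := k
  · exact i.elim0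
  have hgc := hg.continuous
  have hg' : Continuous (fderiv ℝ g) := hg.continuous_fderiv one_ne_zero
  have hi1 : Integrable (fun x => x i * g x)
      (stdGaussian (EuclideanSpace ℝ (Fin (m + 1)))) := by
    refine integrable_of_norm_le_stdGaussian (by fun_prop) (A := 0) (B := A) fun x => ?_
    rw [abs_mul, zero_add, mul_comm]
    exact mul_le_mul (hA x) (by simpa using PiLp.norm_apply_le x i) (abs_nonneg _)
      ((abs_nonneg _).trans (hA x))
  have hi2 : Integrable (fun x => fderiv ℝ g x (EuclideanSpace.single i 1))
      (stdGaussian (EuclideanSpace ℝ (Fin (m + 1)))) := by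
    refine integrable_of_norm_le_stdGaussian (by fun_prop) (A := B) (B := 0) fun x => ?_
    have := (fderiv ℝ g x).le_opNorm (EuclideanSpace.single i 1)
    simp only [PiLp.norm_single, norm_one, mul_one, Real.norm_eq_abs] at this
    linarith [hB x]
  rw [← map_pi_eq_stdGaussian] at hi1 hi2 ⊢
  have hm : AEMeasurable (WithLp.toLp 2 : (Fin (m + 1) → ℝ) → EuclideanSpace ℝ (Fin (m + 1)))
      (Measure.pi fun _ => gaussianReal 0 1) := by fun_prop
  have mp := (measurePreserving_piFinSuccAbove (fun _ : Fin (m + 1) => gaussianReal 0 1) i).symm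
  rw [integral_map hm hi1.aestronglyMeasurable, integral_map hm hi2.aestronglyMeasurable]
  rw [← mp.integral_comp', ← mp.integral_comp']
  have j1 := (hi1.comp_aemeasurable hm)
  have j2 := (hi2.comp_aemeasurable hm)
  rw [← mp.integrable_comp_emb (MeasurableEquiv.measurableEmbedding _)] at j1 j2
  refine (integral_prod_symm _ j1).trans (Eq.trans ?_ (integral_prod_symm _ j2).symm)
  congr 1
  funext y
  simp only [Function.comp_apply, MeasurableEquiv.piFinSuccAbove_symm_apply, Fin.insertNthEquiv,
    Equiv.coe_fn_mk]
  obtain ⟨w, hins⟩ : ∃ w : EuclideanSpace ℝ (Fin (m + 1)), ∀ t : ℝ,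
      (WithLp.toLp 2 (i.insertNth t y) : EuclideanSpace ℝ (Fin (m + 1)))
        = w + t • EuclideanSpace.single i (1:ℝ) := by
    refine ⟨WithLp.toLp 2 (i.insertNth 0 y), fun t => ?_⟩
    ext j
    rcases Fin.eq_self_or_eq_succAbove i j with rfl | ⟨j, rfl⟩ <;> simp
  simp only [hins]
  have := gaussianReal_integral_mul_eq_deriv
    (g := fun t => g (w + t • EuclideanSpace.single i (1:ℝ)))
    (g' := fun t => fderiv ℝ g (w + t • EuclideanSpace.single i (1:ℝ)) (EuclideanSpace.single i 1))
    (fun t => by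
      have h1 := ((hasDerivAt_id t).smul_const (EuclideanSpace.single i (1:ℝ))).const_add w
      have h2 := (hg.differentiable one_ne_zero (w + t • EuclideanSpace.single i 1)).hasFDerivAt
      simpa [Function.comp_def] using h2.comp_hasDerivAt t h1) (by fun_prop) (A := A) (B := B)
    (fun t => hA _) (fun t => by
      have := (fderiv ℝ g (w + t • EuclideanSpace.single i 1)).le_opNorm
        (EuclideanSpace.single i 1)
      simp only [PiLp.norm_single, norm_one, mul_one, Real.norm_eq_abs] at this
      linarith [hB (w + t • EuclideanSpace.single i 1)])
  rw [← this]
  congr 1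
  funext t
  simp

theorem EuclideanSpace.sum_smul_single (z : EuclideanSpace ℝ (Fin k)) :
    ∑ i, z i • EuclideanSpace.single i (1:ℝ) = z := by
  ext j
  simp [Finset.sum_apply, Pi.single_apply]

/-- Stein's lemma for the standard Gaussian measure. -/
theorem stdGaussian_integral_inner_mul {g : EuclideanSpace ℝ (Fin k) → ℝ} (hg : ContDiff ℝ 1 g)
    {A B : ℝ} (hA : ∀ x, |g x| ≤ A) (hB : ∀ x, ‖fderiv ℝ g x‖ ≤ B)
    (z : EuclideanSpace ℝ (Fin k)) :
    ∫ x, inner ℝ x z * g x ∂(stdGaussian (EuclideanSpace ℝ (Fin k)))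
      = ∫ x, fderiv ℝ g x z ∂(stdGaussian (EuclideanSpace ℝ (Fin k))) := by
  have hgc := hg.continuous
  have hg' : Continuous (fderiv ℝ g) := hg.continuous_fderiv one_ne_zero
  have e1 : ∀ x, inner ℝ x z * g x = ∑ i, z i * (x i * g x) := by
    intro x
    rw [PiLp.inner_apply, Finset.sum_mul]
    refine Finset.sum_congr rfl fun i _ => ?_
    simp; ring
  have e2 : ∀ x, fderiv ℝ g x z = ∑ i, z i * fderiv ℝ g x (EuclideanSpace.single i 1) := by
    intro x
    conv_lhs => rw [← EuclideanSpace.sum_smul_single z]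
    simp
  simp_rw [e1, e2]
  rw [integral_finsetSum, integral_finsetSum]
  · refine Finset.sum_congr rfl fun i _ => ?_
    rw [integral_const_mul, integral_const_mul, stdGaussian_integral_coord_mul hg hA hB]
  · intro i _
    refine (integrable_of_norm_le_stdGaussian (by fun_prop) (A := B) (B := 0)
      fun x => ?_).const_mul _
    have := (fderiv ℝ g x).le_opNorm (EuclideanSpace.single i 1)
    simp only [PiLp.norm_single, norm_one, mul_one, Real.norm_eq_abs] at this
    linarith [hB x]
  · intro i _
    refine (integrable_of_norm_le_stdGaussian (by fun_prop) (A := 0) (B := A)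
      fun x => ?_).const_mul _
    rw [abs_mul, zero_add, mul_comm]
    exact mul_le_mul (hA x) (by simpa using PiLp.norm_apply_le x i) (abs_nonneg _)
      ((abs_nonneg _).trans (hA x))

theorem stdGaussian_integral_inner_sq (z : EuclideanSpace ℝ (Fin k)) :
    ∫ x, (inner ℝ z x) ^ 2 ∂(stdGaussian (EuclideanSpace ℝ (Fin k))) = ‖z‖ ^ 2 := by
  have h := variance_dual_stdGaussian (innerSL ℝ z)
  rw [innerSL_apply_norm] at h
  rw [← h, variance_of_integral_eq_zero (by fun_prop) (integral_strongDual_stdGaussian _)]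
  rfl

end Gaussian

/-! ### Hilbert–Schmidt norms -/

section HilbertSchmidt

variable {k : ℕ}

/-- The linear map sending an endomorphism `A` of `ℝᵏ` to the family of its columns `A eⱼ`. The
Euclidean norm of `hsColumns k A` is the Hilbert–Schmidt norm of `A`. -/
def hsColumns (k : ℕ) : (EuclideanSpace ℝ (Fin k) →L[ℝ] EuclideanSpace ℝ (Fin k)) →L[ℝ]
    PiLp 2 (fun _ : Fin k => EuclideanSpace ℝ (Fin k)) :=
  ((PiLp.continuousLinearEquiv 2 ℝ fun _ : Fin k => EuclideanSpace ℝ (Fin k)).symm :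
    (Fin k → EuclideanSpace ℝ (Fin k)) →L[ℝ] _) ∘L
    ContinuousLinearMap.pi fun j =>
      ContinuousLinearMap.apply ℝ (EuclideanSpace ℝ (Fin k)) (EuclideanSpace.single j (1:ℝ))

theorem norm_hsColumns_sq (A : EuclideanSpace ℝ (Fin k) →L[ℝ] EuclideanSpace ℝ (Fin k)) :
    ‖hsColumns k A‖ ^ 2 = ∑ j, ‖A (EuclideanSpace.single j 1)‖ ^ 2 := by
  rw [PiLp.norm_sq_eq_of_L2]
  rfl

theorem EuclideanSpace.sum_inner_single_sq (z : EuclideanSpace ℝ (Fin k)) :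
    ∑ j, (inner ℝ (EuclideanSpace.single j (1:ℝ)) z) ^ 2 = ‖z‖ ^ 2 := by
  rw [EuclideanSpace.real_norm_sq_eq]
  simp [EuclideanSpace.inner_single_left]

theorem norm_hsColumns_adjoint
    (A : EuclideanSpace ℝ (Fin k) →L[ℝ] EuclideanSpace ℝ (Fin k)) :
    ‖hsColumns k (ContinuousLinearMap.adjoint A)‖ = ‖hsColumns k A‖ := by
  have h : ‖hsColumns k (ContinuousLinearMap.adjoint A)‖ ^ 2 = ‖hsColumns k A‖ ^ 2 := by
    rw [norm_hsColumns_sq, norm_hsColumns_sq]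
    simp_rw [← EuclideanSpace.sum_inner_single_sq (ContinuousLinearMap.adjoint A _),
      ← EuclideanSpace.sum_inner_single_sq (A _), ContinuousLinearMap.adjoint_inner_right]
    rw [Finset.sum_comm]
    simp_rw [real_inner_comm]
  exact (pow_left_inj₀ (norm_nonneg _) (norm_nonneg _) two_ne_zero).1 h

theorem norm_apply_le_hsColumns
    (A : EuclideanSpace ℝ (Fin k) →L[ℝ] EuclideanSpace ℝ (Fin k))
    (y : EuclideanSpace ℝ (Fin k)) : ‖A y‖ ≤ ‖hsColumns k A‖ * ‖y‖ := by
  rw [← norm_hsColumns_adjoint]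
  refine le_of_sq_le_sq ?_ (by positivity)
  rw [mul_pow, norm_hsColumns_sq, ← EuclideanSpace.sum_inner_single_sq (A y), Finset.sum_mul]
  refine Finset.sum_le_sum fun j _ => ?_
  rw [← ContinuousLinearMap.adjoint_inner_left, ← mul_pow, ← sq_abs]
  exact pow_le_pow_left₀ (abs_nonneg _) (abs_real_inner_le_norm _ _) 2

theorem norm_hsColumns_smulRight (u v : EuclideanSpace ℝ (Fin k)) :
    ‖hsColumns k ((innerSL ℝ u).smulRight v)‖ = ‖u‖ * ‖v‖ := by
  have h : ‖hsColumns k ((innerSL ℝ u).smulRight v)‖ ^ 2 = (‖u‖ * ‖v‖) ^ 2 := by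
    rw [norm_hsColumns_sq, mul_pow, ← EuclideanSpace.sum_inner_single_sq u, Finset.sum_mul]
    refine Finset.sum_congr rfl fun j _ => ?_
    rw [ContinuousLinearMap.smulRight_apply, norm_smul, mul_pow, innerSL_apply_apply,
      real_inner_comm, Real.norm_eq_abs, sq_abs]
  exact (pow_left_inj₀ (norm_nonneg _) (by positivity) two_ne_zero).1 h

theorem norm_hsColumns_one :
    ‖hsColumns k (1 : EuclideanSpace ℝ (Fin k) →L[ℝ] EuclideanSpace ℝ (Fin k))‖ = √k := by
  rw [← Real.sqrt_sq (norm_nonneg _), norm_hsColumns_sq]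
  simp

theorem integral_le_sqrt_integral_sq {α : Type*} [MeasurableSpace α] {μ : Measure α}
    [IsProbabilityMeasure μ] {g : α → ℝ} (hg : MemLp g 2 μ) :
    ∫ x, g x ∂μ ≤ √(∫ x, g x ^ 2 ∂μ) := by
  have h := variance_nonneg g μ
  rw [variance_eq_sub hg] at h
  refine Real.le_sqrt_of_sq_le ?_
  have : (∫ x, (g ^ 2) x ∂μ) = ∫ x, g x ^ 2 ∂μ := rfl
  linarith

/-- By the Cauchy-Schwarz inequality, since `∫ ‖A z‖²` is the squared Hilbert–Schmidt norm. -/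
theorem stdGaussian_integral_norm_apply_le
    (A : EuclideanSpace ℝ (Fin k) →L[ℝ] EuclideanSpace ℝ (Fin k)) :
    ∫ z, ‖A z‖ ∂(stdGaussian (EuclideanSpace ℝ (Fin k))) ≤ ‖hsColumns k A‖ := by
  have hid : MemLp (fun z : EuclideanSpace ℝ (Fin k) => z) 2 (stdGaussian _) :=
    IsGaussian.memLp_two_id
  have hL : ∀ y : EuclideanSpace ℝ (Fin k), Integrable (fun z => (inner ℝ y z) ^ 2)
      (stdGaussian (EuclideanSpace ℝ (Fin k))) := fun y =>
    ((innerSL ℝ y).comp_memLp' hid).integrable_sq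
  have hsq : ∫ z, ‖A z‖ ^ 2 ∂(stdGaussian (EuclideanSpace ℝ (Fin k))) = ‖hsColumns k A‖ ^ 2 := by
    simp_rw [← EuclideanSpace.sum_inner_single_sq (A _), ← ContinuousLinearMap.adjoint_inner_left]
    rw [integral_finsetSum _ fun j _ => hL _]
    simp_rw [stdGaussian_integral_inner_sq]
    rw [← norm_hsColumns_sq, norm_hsColumns_adjoint]
  have h := integral_le_sqrt_integral_sq (A.comp_memLp' hid).norm
  refine h.trans ?_
  rw [Real.sqrt_le_left (norm_nonneg _)]
  exact hsq.le

theorem stdGaussian_integral_norm_le :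
    ∫ z, ‖z‖ ∂(stdGaussian (EuclideanSpace ℝ (Fin k))) ≤ √k := by
  have := stdGaussian_integral_norm_apply_le (k := k) 1
  rw [norm_hsColumns_one] at this
  simpa using this

end HilbertSchmidt

/-! ### Stein kernels and the Wasserstein distance -/

section Stein

variable {E : Type*} [NormedAddCommGroup E] [NormedSpace ℝ E] [MeasurableSpace E] [BorelSpace E]
  {k : ℕ}

/-- A linear map `W : E → ℝᵏ` together with vector fields `u₁, …, u_k` on `E` such that, under `μ`,
the adjoint of the derivation along `uⱼ` maps the constant function `1` to the coordinate `Wⱼ`. -/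
structure SteinFrame (μ : Measure E) (k : ℕ) where
  /-- the linear map whose law under `μ` is compared with the Gaussian law -/
  W : E →L[ℝ] EuclideanSpace ℝ (Fin k)
  /-- the vector fields -/
  u : Fin k → E → E
  contDiff_u : ∀ j, ContDiff ℝ 1 (u j)
  integral_fderiv : ∀ (j : Fin k) {g : E → ℝ}, ContDiff ℝ 1 g →
    ∫ x, fderiv ℝ g x (u j x) ∂μ = ∫ x, W x j * g x ∂μ

namespace SteinFrame

variable {μ : Measure E} (D : SteinFrame μ k)

/-- The Stein kernel: the endomorphism of `ℝᵏ` with columns `W (uⱼ x)`. -/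
def kernel (x : E) : EuclideanSpace ℝ (Fin k) →L[ℝ] EuclideanSpace ℝ (Fin k) :=
  ∑ j, (EuclideanSpace.proj j : EuclideanSpace ℝ (Fin k) →L[ℝ] ℝ).smulRight (D.W (D.u j x))

theorem kernel_apply (x : E) (v : EuclideanSpace ℝ (Fin k)) :
    D.kernel x v = ∑ j, v j • D.W (D.u j x) := by
  simp [kernel, sum_apply]

theorem kernel_single (x : E) (j : Fin k) :
    D.kernel x (EuclideanSpace.single j 1) = D.W (D.u j x) := by
  simp [kernel_apply]

theorem contDiff_kernel : ContDiff ℝ 1 D.kernel := by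
  unfold kernel
  refine ContDiff.sum fun j _ => ?_
  exact contDiff_const.smulRight (D.W.contDiff.comp (D.contDiff_u j))

/-- The Stein discrepancy, the mean Hilbert–Schmidt distance of the Stein kernel to the identity. -/
def discrepancy : ℝ := ∫ x, ‖hsColumns k (D.kernel x - 1)‖ ∂μ

theorem discrepancy_nonneg : 0 ≤ D.discrepancy := integral_nonneg fun _ => norm_nonneg _

section Interpolation

variable {f : EuclideanSpace ℝ (Fin k) → ℝ}

theorem _root_.EuclideanSpace.clm_apply_eq_sum (L : EuclideanSpace ℝ (Fin k) →L[ℝ] ℝ)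
    (v : EuclideanSpace ℝ (Fin k)) :
    L v = ∑ j, v j * L (EuclideanSpace.single j 1) := by
  conv_lhs => rw [← EuclideanSpace.sum_smul_single v]
  simp

theorem hasFDerivAt_fderiv_apply (hf : ContDiff ℝ 2 f) (e : EuclideanSpace ℝ (Fin k))
    (y : EuclideanSpace ℝ (Fin k)) :
    HasFDerivAt (fun y => fderiv ℝ f y e)
      ((ContinuousLinearMap.apply ℝ ℝ e).comp (fderiv ℝ (fderiv ℝ f) y)) y := by
  have h1 : ContDiff ℝ 1 (fderiv ℝ f) := hf.fderiv_right (by norm_num)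
  exact (ContinuousLinearMap.apply ℝ ℝ e).hasFDerivAt.comp y
    (h1.differentiable one_ne_zero y).hasFDerivAt

theorem contDiff_fderiv_apply (hf : ContDiff ℝ 2 f) (e : EuclideanSpace ℝ (Fin k)) :
    ContDiff ℝ 1 (fun y => fderiv ℝ f y e) :=
  (hf.fderiv_right (m := 1) (by norm_num)).clm_apply contDiff_const

/-- Stein identity for `W`, tested against the gradient of a smooth function. -/
theorem integral_fderiv_W (hμ : ∀ h : E → ℝ, Continuous h → Integrable h μ)
    (hf : ContDiff ℝ 2 f) (s : ℝ) (y : EuclideanSpace ℝ (Fin k)) :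
    ∫ x, fderiv ℝ f (s • D.W x + y) (D.W x) ∂μ
      = s * ∫ x, ∑ j, fderiv ℝ (fderiv ℝ f) (s • D.W x + y) (D.W (D.u j x))
          (EuclideanSpace.single j 1) ∂μ := by
  have hf1 : ContDiff ℝ 1 (fderiv ℝ f) := hf.fderiv_right (by norm_num)
  have hc1 : Continuous (fderiv ℝ f) := hf1.continuous
  have hc2 : Continuous (fderiv ℝ (fderiv ℝ f)) := hf1.continuous_fderiv one_ne_zero
  have hu := fun j => (D.contDiff_u j).continuous
  simp_rw [EuclideanSpace.clm_apply_eq_sum (fderiv ℝ f _) (D.W _)]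
  rw [integral_finsetSum _ fun j _ => hμ _ (by fun_prop),
    integral_finsetSum _ fun j _ => hμ _ (by have := hu j; fun_prop), Finset.mul_sum]
  refine Finset.sum_congr rfl fun j _ => ?_
  set e : EuclideanSpace ℝ (Fin k) := EuclideanSpace.single j 1
  have hg : ContDiff ℝ 1 (fun x => fderiv ℝ f (s • D.W x + y) e) :=
    (contDiff_fderiv_apply hf e).comp (by fun_prop)
  rw [← D.integral_fderiv j hg, ← integral_const_mul]
  congr 1
  funext x
  have h1 : HasFDerivAt (fun x => s • D.W x + y) (s • D.W) x :=
    (D.W.hasFDerivAt.const_smul s).add_const y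
  have h2 := (hasFDerivAt_fderiv_apply hf e (s • D.W x + y)).comp x h1
  have h3 : fderiv ℝ (fun x => fderiv ℝ f (s • D.W x + y) e) x = _ := h2.fderiv
  rw [h3]
  simp

/-- Stein's lemma for the Gaussian measure, tested against a linear image of a gradient. -/
theorem _root_.stdGaussian_integral_fderiv_apply (hf : ContDiff ℝ 2 f)
    {B₁ B₂ : ℝ} (h₁ : ∀ y, ‖fderiv ℝ f y‖ ≤ B₁) (h₂ : ∀ y, ‖fderiv ℝ (fderiv ℝ f) y‖ ≤ B₂)
    (c : ℝ) (w : EuclideanSpace ℝ (Fin k))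
    (A : EuclideanSpace ℝ (Fin k) →L[ℝ] EuclideanSpace ℝ (Fin k)) :
    ∫ z, fderiv ℝ f (w + c • z) (A z) ∂(stdGaussian (EuclideanSpace ℝ (Fin k)))
      = c * ∫ z, ∑ j, fderiv ℝ (fderiv ℝ f) (w + c • z) (A (EuclideanSpace.single j 1))
          (EuclideanSpace.single j 1) ∂(stdGaussian (EuclideanSpace ℝ (Fin k))) := by
  have hf1 : ContDiff ℝ 1 (fderiv ℝ f) := hf.fderiv_right (by norm_num)
  have hc1 : Continuous (fderiv ℝ f) := hf1.continuous
  have hc2 : Continuous (fderiv ℝ (fderiv ℝ f)) := hf1.continuous_fderiv one_ne_zero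
  have hB1 : ∀ y v, |fderiv ℝ f y v| ≤ B₁ * ‖v‖ := fun y v =>
    ((fderiv ℝ f y).le_opNorm v).trans (mul_le_mul_of_nonneg_right (h₁ y) (norm_nonneg _))
  have hB2 : ∀ y v v', |fderiv ℝ (fderiv ℝ f) y v v'| ≤ B₂ * ‖v‖ * ‖v'‖ := fun y v v' =>
    ((fderiv ℝ (fderiv ℝ f) y).le_opNorm₂ v v').trans (by gcongr; exact h₂ y)
  have e1 : ∀ z, fderiv ℝ f (w + c • z) (A z)
      = ∑ j, z j * fderiv ℝ f (w + c • z) (A (EuclideanSpace.single j 1)) := by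
    intro z
    exact EuclideanSpace.clm_apply_eq_sum ((fderiv ℝ f (w + c • z)).comp A) z
  simp_rw [e1]
  rw [integral_finsetSum, integral_finsetSum, Finset.mul_sum]
  · refine Finset.sum_congr rfl fun j _ => ?_
    set e : EuclideanSpace ℝ (Fin k) := EuclideanSpace.single j 1
    have hg : ContDiff ℝ 1 (fun z => fderiv ℝ f (w + c • z) (A e)) :=
      (contDiff_fderiv_apply hf (A e)).comp (by fun_prop)
    have hd : ∀ z, fderiv ℝ (fun z => fderiv ℝ f (w + c • z) (A e)) z
        = c • ((ContinuousLinearMap.apply ℝ ℝ (A e)).comp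
            (fderiv ℝ (fderiv ℝ f) (w + c • z))) := by
      intro z
      have h1 : HasFDerivAt (fun z => w + c • z)
          (c • ContinuousLinearMap.id ℝ (EuclideanSpace ℝ (Fin k))) z :=
        ((hasFDerivAt_id z).const_smul c).const_add w
      have h2 := (hasFDerivAt_fderiv_apply hf (A e) (w + c • z)).comp z h1
      have h3 : fderiv ℝ (fun z => fderiv ℝ f (w + c • z) (A e)) z = _ := h2.fderiv
      rw [h3]
      ext v
      simp
    rw [stdGaussian_integral_coord_mul hg (A := B₁ * ‖A e‖) (B := |c| * (‖A e‖ * B₂))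
      (fun z => hB1 _ _), ← integral_const_mul]
    · congr 1
      funext z
      rw [hd]
      have hsymm := (hf.contDiffAt (x := w + c • z)).isSymmSndFDerivAt (by simp)
      simp only [smul_apply, ContinuousLinearMap.comp_apply,
        ContinuousLinearMap.apply_apply, smul_eq_mul]
      rw [hsymm.eq]
    · intro z
      rw [hd, norm_smul, Real.norm_eq_abs]
      refine mul_le_mul_of_nonneg_left ?_ (abs_nonneg _)
      refine ContinuousLinearMap.opNorm_le_bound _ (by
        have := le_trans (norm_nonneg (fderiv ℝ (fderiv ℝ f) 0)) (h₂ 0); positivity) fun v => ?_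
      have := hB2 (w + c • z) v (A e)
      simp only [ContinuousLinearMap.comp_apply, ContinuousLinearMap.apply_apply,
        Real.norm_eq_abs]
      linarith
  · intro j _
    refine integrable_of_norm_le_stdGaussian (by fun_prop)
      (A := B₂ * ‖A (EuclideanSpace.single j 1)‖
      * ‖(EuclideanSpace.single j 1 : EuclideanSpace ℝ (Fin k))‖) (B := 0) fun z => ?_
    have := hB2 (w + c • z) (A (EuclideanSpace.single j 1)) (EuclideanSpace.single j 1)
    linarith
  · intro j _
    refine integrable_of_norm_le_stdGaussian (by fun_prop) (A := 0)
      (B := B₁ * ‖A (EuclideanSpace.single j 1)‖) fun z => ?_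
    rw [abs_mul, zero_add, mul_comm]
    refine mul_le_mul (hB1 _ _) (by simpa using PiLp.norm_apply_le z j) (abs_nonneg _) ?_
    have := le_trans (norm_nonneg (fderiv ℝ f 0)) (h₁ 0)
    positivity

local notation "γ" => stdGaussian (EuclideanSpace ℝ (Fin k))

theorem integrable_prod_of_abs_le (hμ : ∀ h : E → ℝ, Continuous h → Integrable h μ)
    [SFinite μ] {a : E → ℝ} (ha : Continuous a) {g : E × EuclideanSpace ℝ (Fin k) → ℝ}
    (hg : Continuous g) (hle : ∀ q, |g q| ≤ a q.1 * (1 + ‖q.2‖)) :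
    Integrable g (μ.prod γ) := by
  have h1 : Integrable (fun z : EuclideanSpace ℝ (Fin k) => 1 + ‖z‖) γ :=
    (integrable_const _).add IsGaussian.integrable_id.norm
  exact ((hμ a ha).mul_prod h1).mono' hg.aestronglyMeasurable (ae_of_all _ hle)

/-- Gaussian integration by parts turns the Stein identity for `W` into a statement about the
gradient only, with `W` replaced by the image of the Gaussian vector under the Stein kernel. -/
theorem integral_prod_fderiv_W [SFinite μ] (hμ : ∀ h : E → ℝ, Continuous h → Integrable h μ)
    (hf : ContDiff ℝ 2 f)
    {B₁ B₂ : ℝ} (h₁ : ∀ y, ‖fderiv ℝ f y‖ ≤ B₁) (h₂ : ∀ y, ‖fderiv ℝ (fderiv ℝ f) y‖ ≤ B₂)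
    (s c : ℝ) :
    c * ∫ q, fderiv ℝ f (s • D.W q.1 + c • q.2) (D.W q.1) ∂(μ.prod γ)
      = s * ∫ q, fderiv ℝ f (s • D.W q.1 + c • q.2) (D.kernel q.1 q.2) ∂(μ.prod γ) := by
  have hf1 : ContDiff ℝ 1 (fderiv ℝ f) := hf.fderiv_right (by norm_num)
  have hc1 : Continuous (fderiv ℝ f) := hf1.continuous
  have hc2 : Continuous (fderiv ℝ (fderiv ℝ f)) := hf1.continuous_fderiv one_ne_zero
  have hu := fun j => (D.contDiff_u j).continuous
  have hk : Continuous D.kernel := D.contDiff_kernel.continuous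
  have hB1 : ∀ y v, |fderiv ℝ f y v| ≤ B₁ * ‖v‖ := fun y v =>
    ((fderiv ℝ f y).le_opNorm v).trans (mul_le_mul_of_nonneg_right (h₁ y) (norm_nonneg _))
  have hB2 : ∀ y v v', |fderiv ℝ (fderiv ℝ f) y v v'| ≤ B₂ * ‖v‖ * ‖v'‖ := fun y v v' =>
    ((fderiv ℝ (fderiv ℝ f) y).le_opNorm₂ v v').trans (by gcongr; exact h₂ y)
  have hB10 : 0 ≤ B₁ := le_trans (norm_nonneg (fderiv ℝ f 0)) (h₁ 0)
  have hB20 : 0 ≤ B₂ := le_trans (norm_nonneg (fderiv ℝ (fderiv ℝ f) 0)) (h₂ 0)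
  have i1 : Integrable (fun q : E × EuclideanSpace ℝ (Fin k) =>
      fderiv ℝ f (s • D.W q.1 + c • q.2) (D.W q.1)) (μ.prod γ) := by
    refine integrable_prod_of_abs_le hμ (a := fun x => B₁ * ‖D.W x‖) (by fun_prop) (by fun_prop)
      fun q => (hB1 _ _).trans ?_
    exact le_mul_of_one_le_right (by positivity) (by linarith [norm_nonneg q.2])
  have i2 : Integrable (fun q : E × EuclideanSpace ℝ (Fin k) =>
      fderiv ℝ f (s • D.W q.1 + c • q.2) (D.kernel q.1 q.2)) (μ.prod γ) := by
    refine integrable_prod_of_abs_le hμ (a := fun x => B₁ * ‖D.kernel x‖) (by fun_prop)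
      (by fun_prop) fun q => (hB1 _ _).trans ?_
    have h3 := (D.kernel q.1).le_opNorm q.2
    have h4 : ‖D.kernel q.1‖ * ‖q.2‖ ≤ ‖D.kernel q.1‖ * (1 + ‖q.2‖) := by gcongr; linarith
    rw [mul_assoc]
    exact mul_le_mul_of_nonneg_left (h3.trans h4) hB10
  have i3 : Integrable (fun q : E × EuclideanSpace ℝ (Fin k) =>
      ∑ j, fderiv ℝ (fderiv ℝ f) (s • D.W q.1 + c • q.2) (D.W (D.u j q.1))
          (EuclideanSpace.single j 1)) (μ.prod γ) := by
    refine integrable_finsetSum _ fun j _ => ?_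
    refine integrable_prod_of_abs_le hμ (a := fun x => B₂ * ‖D.W (D.u j x)‖
      * ‖(EuclideanSpace.single j 1 : EuclideanSpace ℝ (Fin k))‖)
      (by have := hu j; fun_prop) (by have := hu j; fun_prop) fun q => (hB2 _ _ _).trans ?_
    exact le_mul_of_one_le_right (by positivity) (by linarith [norm_nonneg q.2])
  rw [integral_prod_symm _ i1, integral_prod _ i2]
  simp_rw [fun z => D.integral_fderiv_W hμ hf s (c • z),
    fun x => stdGaussian_integral_fderiv_apply hf h₁ h₂ c (s • D.W x) (D.kernel x),
    kernel_single, integral_const_mul]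
  rw [← integral_prod_symm _ i3, ← integral_prod _ i3]
  ring

/-- Along the Gaussian rotation from the law of `Z` to the law of `W`, the expectation of a smooth
test function moves with speed at most the Stein discrepancy. -/
theorem abs_integral_sub_le_of_contDiff [IsProbabilityMeasure μ]
    (hμ : ∀ h : E → ℝ, Continuous h → Integrable h μ)
    (hf : ContDiff ℝ 2 f) {B₀ B₂ : ℝ} (h₀ : ∀ y, |f y| ≤ B₀)
    (h₁ : ∀ y, ‖fderiv ℝ f y‖ ≤ 1) (h₂ : ∀ y, ‖fderiv ℝ (fderiv ℝ f) y‖ ≤ B₂) :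
    |∫ x, f (D.W x) ∂μ - ∫ z, f z ∂γ| ≤ Real.pi / 2 * D.discrepancy := by
  have hf1 : ContDiff ℝ 1 (fderiv ℝ f) := hf.fderiv_right (by norm_num)
  have hc0 : Continuous f := hf.continuous
  have hc1 : Continuous (fderiv ℝ f) := hf1.continuous
  have hk : Continuous D.kernel := D.contDiff_kernel.continuous
  have hB1 : ∀ y v, |fderiv ℝ f y v| ≤ ‖v‖ := fun y v =>
    ((fderiv ℝ f y).le_opNorm v).trans
      ((mul_le_mul_of_nonneg_right (h₁ y) (norm_nonneg _)).trans (one_mul _).le)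
  set Y : ℝ → E × EuclideanSpace ℝ (Fin k) → EuclideanSpace ℝ (Fin k) :=
    fun t q => Real.sin t • D.W q.1 + Real.cos t • q.2 with hY
  set h : ℝ → ℝ := fun t => ∫ q, f (Y t q) ∂(μ.prod γ) with hh
  have ibd : Integrable (fun q : E × EuclideanSpace ℝ (Fin k) => ‖D.W q.1‖ + ‖q.2‖)
      (μ.prod γ) := by
    refine integrable_prod_of_abs_le hμ (a := fun x => 1 + ‖D.W x‖) (by fun_prop)
      (by fun_prop) fun q => ?_
    rw [abs_of_nonneg (by positivity)]
    nlinarith [norm_nonneg (D.W q.1), norm_nonneg q.2]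
  have hYd : ∀ q t, HasDerivAt (fun t => f (Y t q))
      (fderiv ℝ f (Y t q) (Real.cos t • D.W q.1 + (-Real.sin t) • q.2)) t := by
    intro q t
    have h1 : HasDerivAt (fun t => Y t q) (Real.cos t • D.W q.1 + (-Real.sin t) • q.2) t :=
      ((Real.hasDerivAt_sin t).smul_const _).add ((Real.hasDerivAt_cos t).smul_const _)
    exact (hf.differentiable two_ne_zero (Y t q)).hasFDerivAt.comp_hasDerivAt t h1
  have hder : ∀ t, HasDerivAt h
      (∫ q, fderiv ℝ f (Y t q) (Real.cos t • D.W q.1 + (-Real.sin t) • q.2) ∂(μ.prod γ)) t := by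
    intro t
    refine (hasDerivAt_integral_of_dominated_loc_of_deriv_le (Metric.ball_mem_nhds t one_pos)
      (F := fun t q => f (Y t q)) (F' := fun t q =>
        fderiv ℝ f (Y t q) (Real.cos t • D.W q.1 + (-Real.sin t) • q.2)) (μ := μ.prod γ)
      (x₀ := t) (bound := fun q => ‖D.W q.1‖ + ‖q.2‖) ?_ ?_ ?_ ?_ ibd ?_).2
    · exact Filter.Eventually.of_forall fun s =>
        Continuous.aestronglyMeasurable (by simp only [hY]; fun_prop)
    · refine Integrable.of_bound (C := B₀)
        (Continuous.aestronglyMeasurable (by simp only [hY]; fun_prop)) (ae_of_all _ fun q => h₀ _)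
    · exact Continuous.aestronglyMeasurable (by simp only [hY]; fun_prop)
    · refine ae_of_all _ fun q s _ => (hB1 _ _).trans ((norm_add_le _ _).trans ?_)
      rw [norm_smul, norm_smul, norm_neg, Real.norm_eq_abs, Real.norm_eq_abs]
      exact add_le_add (mul_le_of_le_one_left (norm_nonneg _) (Real.abs_cos_le_one s))
        (mul_le_of_le_one_left (norm_nonneg _) (Real.abs_sin_le_one s))
    · exact ae_of_all _ fun q s _ => hYd q s
  have hbound : ∀ t, ‖∫ q, fderiv ℝ f (Y t q)
      (Real.cos t • D.W q.1 + (-Real.sin t) • q.2) ∂(μ.prod γ)‖ ≤ D.discrepancy := by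
    intro t
    have i1 : Integrable (fun q : E × EuclideanSpace ℝ (Fin k) =>
        fderiv ℝ f (Y t q) (D.W q.1)) (μ.prod γ) := by
      refine ibd.mono' (Continuous.aestronglyMeasurable (by simp only [hY]; fun_prop))
        (ae_of_all _ fun q => (hB1 _ _).trans (by linarith [norm_nonneg q.2]))
    have i2 : Integrable (fun q : E × EuclideanSpace ℝ (Fin k) =>
        fderiv ℝ f (Y t q) q.2) (μ.prod γ) := by
      refine ibd.mono' (Continuous.aestronglyMeasurable (by simp only [hY]; fun_prop))
        (ae_of_all _ fun q => (hB1 _ _).trans (by linarith [norm_nonneg (D.W q.1)]))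
    have hker : ∀ A : E → EuclideanSpace ℝ (Fin k) →L[ℝ] EuclideanSpace ℝ (Fin k),
        Continuous A → Integrable (fun q : E × EuclideanSpace ℝ (Fin k) => ‖A q.1 q.2‖)
          (μ.prod γ) := by
      intro A hA
      refine integrable_prod_of_abs_le hμ (a := fun x => ‖A x‖) (by fun_prop)
        (by fun_prop) fun q => ?_
      rw [abs_norm]
      refine ((A q.1).le_opNorm q.2).trans ?_
      gcongr
      linarith
    have i3 : Integrable (fun q : E × EuclideanSpace ℝ (Fin k) =>
        fderiv ℝ f (Y t q) (D.kernel q.1 q.2)) (μ.prod γ) :=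
      (hker _ hk).mono' (Continuous.aestronglyMeasurable (by simp only [hY]; fun_prop))
        (ae_of_all _ fun q => hB1 _ _)
    have hk1 : Continuous fun x => D.kernel x - 1 := hk.sub continuous_const
    have e1 : ∫ q, fderiv ℝ f (Y t q)
        (Real.cos t • D.W q.1 + (-Real.sin t) • q.2) ∂(μ.prod γ)
        = Real.sin t * ∫ q, fderiv ℝ f (Y t q) ((D.kernel q.1 - 1) q.2) ∂(μ.prod γ) := by
      have e2 : ∀ q, fderiv ℝ f (Y t q) (Real.cos t • D.W q.1 + (-Real.sin t) • q.2)
          = Real.cos t * fderiv ℝ f (Y t q) (D.W q.1)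
            - Real.sin t * fderiv ℝ f (Y t q) q.2 := by
        intro q; simp; ring
      have e3 : ∀ q, fderiv ℝ f (Y t q) ((D.kernel q.1 - 1) q.2)
          = fderiv ℝ f (Y t q) (D.kernel q.1 q.2) - fderiv ℝ f (Y t q) q.2 := by
        intro q; simp
      simp_rw [e2, e3]
      rw [integral_sub (i1.const_mul _) (i2.const_mul _), integral_sub i3 i2,
        integral_const_mul, integral_const_mul,
        D.integral_prod_fderiv_W hμ hf h₁ h₂ (Real.sin t) (Real.cos t)]
      ring
    rw [e1, norm_mul, Real.norm_eq_abs]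
    refine (mul_le_of_le_one_left (norm_nonneg _) (Real.abs_sin_le_one t)).trans ?_
    refine (norm_integral_le_integral_norm _).trans ?_
    refine (integral_mono_of_nonneg (ae_of_all _ fun q => norm_nonneg _) (hker _ hk1)
      (ae_of_all _ fun q => hB1 _ _)).trans ?_
    rw [integral_prod _ (hker _ hk1)]
    refine integral_mono (hker _ hk1).integral_prod_left (hμ _ (by fun_prop)) fun x => ?_
    exact stdGaussian_integral_norm_apply_le (D.kernel x - 1)
  have hmv := Convex.norm_image_sub_le_of_norm_hasDerivWithin_le (s := Set.univ) (f := h)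
    (x := 0) (y := Real.pi / 2) (fun t _ => (hder t).hasDerivWithinAt) (fun t _ => hbound t)
    convex_univ (Set.mem_univ _) (Set.mem_univ _)
  have hend : h (Real.pi / 2) = ∫ x, f (D.W x) ∂μ := by
    simp only [hh, hY, Real.sin_pi_div_two, Real.cos_pi_div_two, one_smul, zero_smul, add_zero]
    rw [integral_fun_fst (μ := μ) (ν := γ) (fun x => f (D.W x))]
    simp
  have hstart : h 0 = ∫ z, f z ∂γ := by
    simp only [hh, hY, Real.sin_zero, Real.cos_zero, one_smul, zero_smul, zero_add]
    rw [integral_fun_snd (μ := μ) (ν := γ) f]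
    simp
  rw [hend, hstart, sub_zero, Real.norm_eq_abs, Real.norm_eq_abs,
    abs_of_pos Real.pi_div_two_pos] at hmv
  linarith

end Interpolation

end SteinFrame

end Stein

section Lipschitz

open Filter Topology

variable {k : ℕ}

local notation "γ" => stdGaussian (EuclideanSpace ℝ (Fin k))

theorem exists_contDiff_lipschitz_approx {f : EuclideanSpace ℝ (Fin k) → ℝ}
    (hf : LipschitzWith 1 f) (hc : HasCompactSupport f) {ε : ℝ} (hε : 0 < ε) :
    ∃ g : EuclideanSpace ℝ (Fin k) → ℝ, ContDiff ℝ 2 g ∧ HasCompactSupport g ∧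
      LipschitzWith 1 g ∧ ∀ x, |g x - f x| ≤ ε := by
  let φ : ContDiffBump (0 : EuclideanSpace ℝ (Fin k)) :=
    ⟨ε / 2, ε, by positivity, by linarith⟩
  set p := φ.normed volume with hp
  have hpc : HasCompactSupport p := φ.hasCompactSupport_normed
  have hps : ContDiff ℝ 2 p := φ.contDiff_normed
  have hfc := hf.continuous
  have hpcont := hps.continuous
  refine ⟨convolution p f (ContinuousLinearMap.lsmul ℝ ℝ) volume, ?_, ?_, ?_, ?_⟩
  · exact hpc.contDiff_convolution_left _ hps hfc.locallyIntegrable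
  · exact hpc.convolution _ hc
  · refine LipschitzWith.of_dist_le_mul fun x y => ?_
    have hi : ∀ x, Integrable (fun t => p t * f (x - t)) := fun x =>
      Continuous.integrable_of_hasCompactSupport (by fun_prop) hpc.mul_right
    rw [Real.dist_eq, convolution_def, convolution_def]
    simp only [ContinuousLinearMap.lsmul_apply, smul_eq_mul]
    rw [← integral_sub (hi x) (hi y), ← Real.norm_eq_abs]
    refine (norm_integral_le_of_norm_le (g := fun t => p t * dist x y)
      (φ.integrable_normed.mul_const _) (ae_of_all _ fun t => ?_)).trans ?_
    · rw [← mul_sub, norm_mul, Real.norm_eq_abs, abs_of_nonneg (φ.nonneg_normed t)]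
      refine mul_le_mul_of_nonneg_left ?_ (φ.nonneg_normed t)
      have := hf.dist_le_mul (x - t) (y - t)
      rwa [dist_sub_right, NNReal.coe_one, one_mul, Real.dist_eq] at this
    · rw [integral_mul_const, φ.integral_normed]
      simp
  · intro x
    rw [← Real.dist_eq]
    refine φ.dist_normed_convolution_le hfc.aestronglyMeasurable fun y hy => ?_
    have := hf.dist_le_mul y x
    rw [NNReal.coe_one, one_mul] at this
    exact this.trans (Metric.mem_ball.1 hy).le

theorem exists_bound_fderiv {V W : Type*} [NormedAddCommGroup V] [NormedSpace ℝ V]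
    [NormedAddCommGroup W] [NormedSpace ℝ W] {g : V → W} (hg : Continuous (fderiv ℝ g))
    (hc : HasCompactSupport g) : ∃ B, ∀ y, ‖fderiv ℝ g y‖ ≤ B :=
  (hc.fderiv ℝ).exists_bound_of_continuous hg

theorem exists_bound_fderiv_fderiv {V : Type*} [NormedAddCommGroup V] [NormedSpace ℝ V]
    {g : V → ℝ} (hg : ContDiff ℝ 2 g) (hc : HasCompactSupport g) :
    ∃ B, ∀ y, ‖fderiv ℝ (fderiv ℝ g) y‖ ≤ B :=
  have hg1 : ContDiff ℝ 1 (fderiv ℝ g) := hg.fderiv_right (by norm_num)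
  exists_bound_fderiv (hg1.continuous_fderiv one_ne_zero) (hc.fderiv ℝ)

variable {E : Type*} [NormedAddCommGroup E] [NormedSpace ℝ E] [MeasurableSpace E] [BorelSpace E]
  {μ : Measure E} (D : SteinFrame μ k)

theorem SteinFrame.abs_integral_sub_le_of_compactSupport [IsProbabilityMeasure μ]
    (hμ : ∀ h : E → ℝ, Continuous h → Integrable h μ)
    {f : EuclideanSpace ℝ (Fin k) → ℝ} (hf : LipschitzWith 1 f) (hc : HasCompactSupport f) :
    |∫ x, f (D.W x) ∂μ - ∫ z, f z ∂γ| ≤ Real.pi / 2 * D.discrepancy := by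
  have hfc := hf.continuous
  refine le_of_forall_pos_le_add fun ε hε => ?_
  obtain ⟨g, hg, hgc, hgl, hgf⟩ := exists_contDiff_lipschitz_approx hf hc (half_pos hε)
  obtain ⟨B₀, hB₀⟩ := hgc.exists_bound_of_continuous hg.continuous
  obtain ⟨B₂, hB₂⟩ := exists_bound_fderiv_fderiv hg hgc
  obtain ⟨B, hB⟩ := hc.exists_bound_of_continuous hfc
  have h := D.abs_integral_sub_le_of_contDiff hμ hg hB₀
    (fun y => by simpa using norm_fderiv_le_of_lipschitz ℝ hgl (x₀ := y)) hB₂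
  have hi1 : Integrable (fun x => f (D.W x)) μ := hμ _ (by fun_prop)
  have hi2 : Integrable (fun x => g (D.W x)) μ := hμ _ (hg.continuous.comp D.W.continuous)
  have hi3 : Integrable f γ := Integrable.of_bound hfc.aestronglyMeasurable B (ae_of_all _ hB)
  have hi4 : Integrable g γ :=
    Integrable.of_bound hg.continuous.aestronglyMeasurable B₀ (ae_of_all _ hB₀)
  have d1 : |∫ x, g (D.W x) ∂μ - ∫ x, f (D.W x) ∂μ| ≤ ε / 2 := by
    rw [← integral_sub hi2 hi1]
    simpa using norm_integral_le_of_norm_le_const (μ := μ) (C := ε / 2)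
      (f := fun x => g (D.W x) - f (D.W x)) (ae_of_all _ fun x => hgf (D.W x))
  have d2 : |∫ x, g x ∂γ - ∫ x, f x ∂γ| ≤ ε / 2 := by
    rw [← integral_sub hi4 hi3]
    simpa using norm_integral_le_of_norm_le_const (μ := γ) (C := ε / 2)
      (f := fun x => g x - f x) (ae_of_all _ fun x => hgf x)
  rw [abs_le] at h d1 d2 ⊢
  constructor <;> linarith [h.1, h.2, d1.1, d1.2, d2.1, d2.2]

/-- Truncation of a Lipschitz function `f` to a compactly supported one, with the same Lipschitz
constant. -/
def lipTrunc (f : EuclideanSpace ℝ (Fin k) → ℝ) (R : ℝ) (x : EuclideanSpace ℝ (Fin k)) : ℝ :=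
  max (-max (R - ‖x‖) 0) (min (f x - f 0) (max (R - ‖x‖) 0))

theorem lipschitzWith_lipTrunc {f : EuclideanSpace ℝ (Fin k) → ℝ} (hf : LipschitzWith 1 f)
    (R : ℝ) : LipschitzWith 1 (lipTrunc f R) := by
  have h1 : LipschitzWith 1 fun x : EuclideanSpace ℝ (Fin k) => max (R - ‖x‖) 0 := by
    have : LipschitzWith 1 fun x : EuclideanSpace ℝ (Fin k) => R - ‖x‖ := by
      simpa using (LipschitzWith.const R).sub lipschitzWith_one_norm
    exact this.max_const 0
  have h2 : LipschitzWith 1 fun x => f x - f 0 := by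
    simpa using hf.sub (LipschitzWith.const (f 0))
  unfold lipTrunc
  simpa using h1.neg.max (h2.min h1)

theorem hasCompactSupport_lipTrunc (f : EuclideanSpace ℝ (Fin k) → ℝ) (R : ℝ) :
    HasCompactSupport (lipTrunc f R) := by
  refine HasCompactSupport.intro (isCompact_closedBall (0 : EuclideanSpace ℝ (Fin k)) R)
    fun x hx => ?_
  rw [mem_closedBall_zero_iff, not_le] at hx
  unfold lipTrunc
  rw [max_eq_right (by linarith : R - ‖x‖ ≤ 0), neg_zero]
  exact max_eq_left (min_le_right _ _)

theorem abs_lipTrunc_le {f : EuclideanSpace ℝ (Fin k) → ℝ} (hf : LipschitzWith 1 f) {R : ℝ}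
    (x : EuclideanSpace ℝ (Fin k)) : |lipTrunc f R x| ≤ ‖x‖ := by
  have h := hf.dist_le_mul x 0
  rw [NNReal.coe_one, one_mul, dist_zero_right, Real.dist_eq, abs_le] at h
  have h0 : 0 ≤ max (R - ‖x‖) 0 := le_max_right _ _
  unfold lipTrunc
  rw [abs_le]
  refine ⟨le_max_of_le_right (le_min h.1 (by linarith [norm_nonneg x])), ?_⟩
  exact max_le (by linarith [norm_nonneg x]) ((min_le_left _ _).trans h.2)

theorem tendsto_lipTrunc {f : EuclideanSpace ℝ (Fin k) → ℝ} (hf : LipschitzWith 1 f)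
    (x : EuclideanSpace ℝ (Fin k)) :
    Tendsto (fun R : ℕ => lipTrunc f R x) atTop (𝓝 (f x - f 0)) := by
  refine tendsto_const_nhds.congr' ?_
  filter_upwards [eventually_ge_atTop (Nat.ceil (2 * ‖x‖))] with R hR
  have hR' : 2 * ‖x‖ ≤ R := (Nat.le_ceil _).trans (by exact_mod_cast hR)
  have h := hf.dist_le_mul x 0
  rw [NNReal.coe_one, one_mul, dist_zero_right, Real.dist_eq, abs_le] at h
  unfold lipTrunc
  rw [max_eq_left (by linarith [norm_nonneg x] : (0:ℝ) ≤ R - ‖x‖),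
    min_eq_left (by linarith [h.2]), max_eq_right (by linarith [h.1])]

theorem tendsto_integral_lipTrunc {f : EuclideanSpace ℝ (Fin k) → ℝ} (hf : LipschitzWith 1 f)
    {α : Type*} [MeasurableSpace α] {P : Measure α} {Y : α → EuclideanSpace ℝ (Fin k)}
    (hY : AEStronglyMeasurable Y P) (hi : Integrable (fun a => ‖Y a‖) P) :
    Tendsto (fun R : ℕ => ∫ a, lipTrunc f R (Y a) ∂P) atTop (𝓝 (∫ a, (f (Y a) - f 0) ∂P)) :=
  tendsto_integral_of_dominated_convergence (fun a => ‖Y a‖)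
    (fun R => (lipschitzWith_lipTrunc hf R).continuous.comp_aestronglyMeasurable hY) hi
    (fun _ => ae_of_all _ fun a => abs_lipTrunc_le hf (Y a))
    (ae_of_all _ fun a => tendsto_lipTrunc hf (Y a))

theorem integrable_stdGaussian_of_lipschitz {f : EuclideanSpace ℝ (Fin k) → ℝ} {K : NNReal}
    (hf : LipschitzWith K f) : Integrable f γ :=
  integrable_of_norm_le_stdGaussian hf.continuous (A := |f 0|) (B := K) fun x => by
    have h := hf.dist_le_mul x 0
    rw [dist_zero_right, Real.dist_eq] at h
    have := abs_sub_abs_le_abs_sub (f x) (f 0)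
    linarith

/-- The Wasserstein distance to the Gaussian law is at most `π / 2` times the discrepancy. -/
theorem SteinFrame.abs_integral_sub_le [IsProbabilityMeasure μ]
    (hμ : ∀ h : E → ℝ, Continuous h → Integrable h μ)
    {f : EuclideanSpace ℝ (Fin k) → ℝ} (hf : LipschitzWith 1 f) :
    |∫ x, f (D.W x) ∂μ - ∫ z, f z ∂γ| ≤ Real.pi / 2 * D.discrepancy := by
  have hfc := hf.continuous
  have h1 := tendsto_integral_lipTrunc hf (P := μ) (Y := fun x => D.W x)
    D.W.continuous.measurable.aemeasurable.aestronglyMeasurable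
    (hμ _ (by fun_prop))
  have h2 := tendsto_integral_lipTrunc hf (P := γ) (Y := fun x => x)
    aestronglyMeasurable_id IsGaussian.integrable_id.norm
  have h3 := le_of_tendsto (h1.sub h2).abs (Eventually.of_forall fun R : ℕ =>
    D.abs_integral_sub_le_of_compactSupport hμ (lipschitzWith_lipTrunc hf R)
      (hasCompactSupport_lipTrunc f R))
  rw [integral_sub (hμ _ (by fun_prop)) (integrable_const _),
    integral_sub (integrable_stdGaussian_of_lipschitz hf) (integrable_const _)] at h3
  simpa using h3

end Lipschitz

/-! ### Inverting the Stein kernel -/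

section Cutoff

/-- A `C¹` cutoff: `1` at `0` and vanishing for `q ≥ 1/4`. -/
def cutoff (q : ℝ) : ℝ := max 0 (1 - 4 * q) ^ 2

theorem hasDerivAt_max_zero_sq (y : ℝ) :
    HasDerivAt (fun y : ℝ => max 0 y ^ 2) (2 * max 0 y) y := by
  rcases lt_trichotomy y 0 with hy | rfl | hy
  · rw [max_eq_left hy.le, mul_zero]
    refine (hasDerivAt_const y (0:ℝ)).congr_of_eventuallyEq ?_
    filter_upwards [gt_mem_nhds hy] with t ht
    rw [max_eq_left (le_of_lt ht)]; simp
  · rw [hasDerivAt_iff_isLittleO_nhds_zero]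
    simp only [max_self, mul_zero, smul_zero, sub_zero, zero_add]
    have h1 : (fun h : ℝ => max 0 h ^ 2 - 0 ^ 2) =O[nhds 0] fun h : ℝ => h ^ 2 := by
      refine Asymptotics.IsBigO.of_bound 1 (Filter.Eventually.of_forall fun h => ?_)
      rw [one_mul, zero_pow two_ne_zero, sub_zero, norm_pow, norm_pow]
      gcongr
      rcases le_total 0 h with h0 | h0
      · rw [max_eq_right h0]
      · rw [max_eq_left h0]; simp
    exact h1.trans_isLittleO (Asymptotics.isLittleO_pow_id one_lt_two)
  · rw [max_eq_right hy.le]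
    have h := hasDerivAt_pow 2 y
    simp only [Nat.cast_ofNat, Nat.add_one_sub_one, pow_one] at h
    refine h.congr_of_eventuallyEq ?_
    filter_upwards [lt_mem_nhds hy] with t ht
    rw [max_eq_right (le_of_lt ht)]

theorem hasDerivAt_cutoff (q : ℝ) : HasDerivAt cutoff (-8 * max 0 (1 - 4 * q)) q := by
  have h1 : HasDerivAt (fun q : ℝ => 1 - 4 * q) (-4) q := by
    simpa using ((hasDerivAt_id q).const_mul 4).const_sub 1
  have h2 := (hasDerivAt_max_zero_sq (1 - 4 * q)).comp q h1
  convert! h2 using 1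
  ring

theorem contDiff_cutoff : ContDiff ℝ 1 cutoff := by
  rw [contDiff_one_iff_deriv]
  refine ⟨fun q => (hasDerivAt_cutoff q).differentiableAt, ?_⟩
  have : deriv cutoff = fun q => -8 * max 0 (1 - 4 * q) :=
    funext fun q => (hasDerivAt_cutoff q).deriv
  rw [this]
  fun_prop

theorem cutoff_nonneg (q : ℝ) : 0 ≤ cutoff q := sq_nonneg _

theorem cutoff_eq_zero {q : ℝ} (hq : 1 / 4 ≤ q) : cutoff q = 0 := by
  unfold cutoff
  rw [max_eq_left (by linarith)]; simp

theorem cutoff_le_one {q : ℝ} (hq : 0 ≤ q) : cutoff q ≤ 1 := by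
  unfold cutoff
  have h0 : 0 ≤ max 0 (1 - 4 * q) := le_max_left _ _
  have h1 : max 0 (1 - 4 * q) ≤ 1 := max_le zero_le_one (by linarith)
  nlinarith

theorem one_sub_cutoff_sq_le {a : ℝ} (ha : 0 ≤ a) : 1 - cutoff (a ^ 2) ≤ 3 * a := by
  rcases le_total a (1 / 2) with h | h
  · unfold cutoff
    rw [max_eq_right (by nlinarith)]
    nlinarith [mul_nonneg ha (mul_nonneg (sq_nonneg (a - 2 / 5)) (by linarith : 0 ≤ a + 4 / 5))]
  · linarith [cutoff_nonneg (a ^ 2)]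

end Cutoff

section Smoothing

variable {E : Type*} [NormedAddCommGroup E] [NormedSpace ℝ E] [MeasurableSpace E] [BorelSpace E]
  {k : ℕ} {μ : Measure E} (D : SteinFrame μ k)

theorem norm_le_norm_hsColumns (A : EuclideanSpace ℝ (Fin k) →L[ℝ] EuclideanSpace ℝ (Fin k)) :
    ‖A‖ ≤ ‖hsColumns k A‖ :=
  A.opNorm_le_bound (norm_nonneg _) (norm_apply_le_hsColumns A)

namespace SteinFrame

/-- The squared Hilbert–Schmidt distance of the Stein kernel to the identity. -/
def defect (x : E) : ℝ := ‖hsColumns k (D.kernel x - 1)‖ ^ 2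

theorem defect_nonneg (x : E) : 0 ≤ D.defect x := sq_nonneg _

theorem contDiff_defect : ContDiff ℝ 1 D.defect :=
  ((hsColumns k).contDiff.comp (D.contDiff_kernel.sub contDiff_const)).norm_sq ℝ

theorem fderiv_defect_apply (x h : E) :
    fderiv ℝ D.defect x h
      = 2 * inner ℝ (hsColumns k (D.kernel x - 1)) (hsColumns k (fderiv ℝ D.kernel x h)) := by
  have h1 : HasFDerivAt (fun x => hsColumns k (D.kernel x - 1))
      ((hsColumns k).comp (fderiv ℝ D.kernel x)) x :=
    (hsColumns k).hasFDerivAt.comp x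
      ((D.contDiff_kernel.differentiable one_ne_zero x).hasFDerivAt.sub_const 1)
  have h2 : fderiv ℝ D.defect x = _ := h1.norm_sq.fderiv
  rw [h2]
  simp only [smul_apply, ContinuousLinearMap.comp_apply, innerSL_apply_apply,
    nsmul_eq_mul, Nat.cast_ofNat]

theorem isUnit_kernel {x : E} (hx : D.defect x < 1) : IsUnit (D.kernel x) := by
  have h1 : ‖hsColumns k (D.kernel x - 1)‖ < 1 := by
    have : D.defect x < 1 ^ 2 := by simpa using hx
    exact lt_of_pow_lt_pow_left₀ 2 zero_le_one this
  have h2 : ‖1 - D.kernel x‖ < 1 := by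
    rw [norm_sub_rev]
    exact (norm_le_norm_hsColumns _).trans_lt h1
  simpa using isUnit_one_sub_of_norm_lt_one h2

theorem norm_le_two_mul_norm_kernel {x : E} (hx : D.defect x ≤ 1 / 4)
    (y : EuclideanSpace ℝ (Fin k)) : ‖y‖ ≤ 2 * ‖D.kernel x y‖ := by
  have h1 : ‖hsColumns k (D.kernel x - 1)‖ ≤ 1 / 2 := by
    have : D.defect x ≤ (1 / 2) ^ 2 := by norm_num at hx ⊢; exact hx
    exact le_of_sq_le_sq this (by norm_num)
  have h2 := norm_apply_le_hsColumns (D.kernel x - 1) y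
  have h3 : ‖y‖ ≤ ‖D.kernel x y‖ + ‖(D.kernel x - 1) y‖ := by
    have : y = D.kernel x y - (D.kernel x - 1) y := by simp
    conv_lhs => rw [this]
    exact norm_sub_le _ _
  have h4 : ‖hsColumns k (D.kernel x - 1)‖ * ‖y‖ ≤ 1 / 2 * ‖y‖ := by gcongr
  linarith

/-- The localized solution `c` of `kernel x (c x) = ψ x • z`, with `ψ` the cutoff of the defect. -/
def weight (z : EuclideanSpace ℝ (Fin k)) (x : E) : EuclideanSpace ℝ (Fin k) :=
  cutoff (D.defect x) • (Ring.inverse (D.kernel x)) z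

variable (z : EuclideanSpace ℝ (Fin k))

theorem kernel_weight (x : E) : D.kernel x (D.weight z x) = cutoff (D.defect x) • z := by
  unfold weight
  rcases lt_or_ge (D.defect x) 1 with h | h
  · rw [map_smul, ← mul_apply_eq_comp, Ring.mul_inverse_cancel _ (D.isUnit_kernel h)]
    simp
  · rw [cutoff_eq_zero (by linarith)]
    simp

theorem weight_eq_zero {x : E} (hx : 1 / 4 ≤ D.defect x) : D.weight z x = 0 := by
  unfold weight
  rw [cutoff_eq_zero hx, zero_smul]

theorem norm_weight_le (x : E) : ‖D.weight z x‖ ≤ 2 * ‖z‖ := by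
  rcases le_total (D.defect x) (1 / 4) with h | h
  · refine (D.norm_le_two_mul_norm_kernel h _).trans ?_
    rw [D.kernel_weight, norm_smul, Real.norm_eq_abs, abs_of_nonneg (cutoff_nonneg _)]
    gcongr
    exact mul_le_of_le_one_left (norm_nonneg _) (cutoff_le_one (D.defect_nonneg x))
  · rw [D.weight_eq_zero z h, norm_zero]
    positivity

theorem contDiff_weight : ContDiff ℝ 1 (D.weight z) := by
  rw [contDiff_iff_contDiffAt]
  intro x
  rcases lt_or_ge (D.defect x) 1 with h | h
  · have h1 : ContDiffAt ℝ 1 (fun x => Ring.inverse (D.kernel x)) x := by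
      obtain ⟨u, hu⟩ := D.isUnit_kernel h
      have h2 := contDiffAt_ringInverse ℝ u (n := 1)
      rw [hu] at h2
      exact h2.comp x D.contDiff_kernel.contDiffAt
    exact (contDiff_cutoff.comp D.contDiff_defect).contDiffAt.smul
      (h1.clm_apply contDiffAt_const)
  · have h1 : D.weight z =ᶠ[nhds x] fun _ => 0 := by
      have : ∀ᶠ y in nhds x, 1 / 4 < D.defect y :=
        D.contDiff_defect.continuous.continuousAt.eventually_const_lt (by linarith)
      filter_upwards [this] with y hy
      exact D.weight_eq_zero z hy.le
    exact contDiffAt_const.congr_of_eventuallyEq h1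

/-- Obtained by differentiating `kernel_weight`; this avoids the derivative of the inverse. -/
theorem norm_fderiv_weight_le (x h : E) :
    ‖fderiv ℝ (D.weight z) x h‖ ≤ 20 * ‖z‖ * ‖hsColumns k (fderiv ℝ D.kernel x h)‖ := by
  set H := ‖hsColumns k (fderiv ℝ D.kernel x h)‖ with hH
  rcases le_or_gt (D.defect x) (1 / 4) with hx | hx
  · have hT := (D.contDiff_kernel.differentiable one_ne_zero x).hasFDerivAt
    have hc := ((D.contDiff_weight z).differentiable one_ne_zero x).hasFDerivAt
    have hq := (D.contDiff_defect.differentiable one_ne_zero x).hasFDerivAt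
    have h1 := (hT.clm_apply hc).fderiv
    have h2 := (((hasDerivAt_cutoff (D.defect x)).comp_hasFDerivAt x hq).smul_const z).fderiv
    have h3 : (fun y => D.kernel y (D.weight z y)) = fun y => (cutoff ∘ D.defect) y • z :=
      funext fun y => D.kernel_weight z y
    rw [h3, h2] at h1
    have h4 := congrArg (fun L => L h) h1
    simp only [ContinuousLinearMap.smulRight_apply, smul_apply,
      add_apply, ContinuousLinearMap.comp_apply,
      ContinuousLinearMap.flip_apply, smul_eq_mul] at h4
    have h5 : D.kernel x (fderiv ℝ (D.weight z) x h)
        = (-8 * max 0 (1 - 4 * D.defect x) * fderiv ℝ D.defect x h) • z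
          - fderiv ℝ D.kernel x h (D.weight z x) := by
      rw [h4]; abel
    have h6 : ‖fderiv ℝ D.kernel x h (D.weight z x)‖ ≤ H * (2 * ‖z‖) :=
      (norm_apply_le_hsColumns _ _).trans
        (mul_le_mul_of_nonneg_left (D.norm_weight_le z x) (norm_nonneg _))
    have h7 : ‖hsColumns k (D.kernel x - 1)‖ ≤ 1 / 2 := by
      have : D.defect x ≤ (1 / 2) ^ 2 := by norm_num at hx ⊢; exact hx
      exact le_of_sq_le_sq this (by norm_num)
    have h8 : |fderiv ℝ D.defect x h| ≤ H := by
      rw [D.fderiv_defect_apply, abs_mul, abs_two]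
      have := abs_real_inner_le_norm (hsColumns k (D.kernel x - 1))
        (hsColumns k (fderiv ℝ D.kernel x h))
      have h9 : ‖hsColumns k (D.kernel x - 1)‖ * H ≤ 1 / 2 * H := by gcongr
      linarith
    have h10 : |-8 * max 0 (1 - 4 * D.defect x) * fderiv ℝ D.defect x h| ≤ 8 * H := by
      rw [abs_mul, abs_mul]
      have h0 : 0 ≤ max 0 (1 - 4 * D.defect x) := le_max_left _ _
      have h1 : max 0 (1 - 4 * D.defect x) ≤ 1 :=
        max_le zero_le_one (by linarith [D.defect_nonneg x])
      rw [abs_of_nonneg h0, abs_neg, abs_of_pos (by norm_num : (0:ℝ) < 8)]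
      calc _ ≤ 8 * 1 * H := by gcongr
        _ = _ := by ring
    refine (D.norm_le_two_mul_norm_kernel hx _).trans ?_
    rw [h5]
    have h11 := norm_sub_le
      ((-8 * max 0 (1 - 4 * D.defect x) * fderiv ℝ D.defect x h) • z)
      (fderiv ℝ D.kernel x h (D.weight z x))
    rw [norm_smul, Real.norm_eq_abs] at h11
    have h12 := mul_le_mul_of_nonneg_right h10 (norm_nonneg z)
    linarith
  · have h1 : D.weight z =ᶠ[nhds x] fun _ => 0 := by
      have : ∀ᶠ y in nhds x, 1 / 4 < D.defect y :=
        D.contDiff_defect.continuous.continuousAt.eventually_const_lt hx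
      filter_upwards [this] with y hy
      exact D.weight_eq_zero z hy.le
    rw [h1.fderiv_eq]
    simp only [fderiv_fun_const, Pi.zero_apply, zero_apply, norm_zero]
    positivity

/-- A bound for the total variation of the law of `W`, localized by the cutoff, under unit
translations. -/
def shiftConst : ℝ :=
  ∫ x, (2 * ‖D.W x‖ + 20 * ∑ j, ‖hsColumns k (fderiv ℝ D.kernel x (D.u j x))‖) ∂μ

/-- Integration by parts along the vector field `∑ⱼ cⱼ uⱼ`. -/
theorem integral_fderiv_kernel_apply (hμ : ∀ h : E → ℝ, Continuous h → Integrable h μ)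
    {f : EuclideanSpace ℝ (Fin k) → ℝ} (hf : ContDiff ℝ 1 f)
    {c : E → EuclideanSpace ℝ (Fin k)} (hc : ContDiff ℝ 1 c) (y : EuclideanSpace ℝ (Fin k)) :
    ∫ x, fderiv ℝ f (D.W x + y) (D.kernel x (c x)) ∂μ
      = ∫ x, f (D.W x + y) * (inner ℝ (D.W x) (c x) - ∑ j, fderiv ℝ c x (D.u j x) j) ∂μ := by
  have hu := fun j => (D.contDiff_u j).continuous
  have hcc := hc.continuous
  have hc' : Continuous (fderiv ℝ c) := hc.continuous_fderiv one_ne_zero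
  have hf' : Continuous (fderiv ℝ f) := hf.continuous_fderiv one_ne_zero
  have hfc := hf.continuous
  have e0 : ∀ x, fderiv ℝ f (D.W x + y) (D.kernel x (c x))
      = ∑ j, c x j * fderiv ℝ f (D.W x + y) (D.W (D.u j x)) := by
    intro x
    rw [D.kernel_apply, map_sum]
    simp
  have e1 : ∀ x, f (D.W x + y) * (inner ℝ (D.W x) (c x) - ∑ j, fderiv ℝ c x (D.u j x) j)
      = ∑ j, (D.W x j * (c x j * f (D.W x + y)) - f (D.W x + y) * fderiv ℝ c x (D.u j x) j) := by
    intro x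
    rw [PiLp.inner_apply, ← Finset.sum_sub_distrib, Finset.mul_sum]
    refine Finset.sum_congr rfl fun j _ => ?_
    simp
    ring
  have hi1 : ∀ j, Integrable (fun x => c x j * fderiv ℝ f (D.W x + y) (D.W (D.u j x))) μ :=
    fun j => hμ _ (by have := hu j; fun_prop)
  have hi2 : ∀ j, Integrable (fun x => D.W x j * (c x j * f (D.W x + y))) μ :=
    fun j => hμ _ (by fun_prop)
  have hi3 : ∀ j, Integrable (fun x => f (D.W x + y) * fderiv ℝ c x (D.u j x) j) μ :=
    fun j => hμ _ (by have := hu j; fun_prop)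
  have hi4 : ∀ j, Integrable (fun x => D.W x j * (c x j * f (D.W x + y))
      - f (D.W x + y) * fderiv ℝ c x (D.u j x) j) μ := fun j => (hi2 j).sub (hi3 j)
  simp_rw [e0, e1]
  rw [integral_finsetSum _ fun j _ => hi1 j, integral_finsetSum _ fun j _ => hi4 j]
  refine Finset.sum_congr rfl fun j _ => ?_
  have hG : ContDiff ℝ 1 (fun x => c x j * f (D.W x + y)) :=
    ((EuclideanSpace.proj (𝕜 := ℝ) j : EuclideanSpace ℝ (Fin k) →L[ℝ] ℝ).contDiff.comp hc).mul
      (hf.comp (by fun_prop))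
  have hd : ∀ x h, fderiv ℝ (fun x => c x j * f (D.W x + y)) x h
      = c x j * fderiv ℝ f (D.W x + y) (D.W h) + f (D.W x + y) * fderiv ℝ c x h j := by
    intro x h
    have h1 : HasFDerivAt (fun x => D.W x + y) D.W x := D.W.hasFDerivAt.add_const y
    have h2 := (hf.differentiable one_ne_zero (D.W x + y)).hasFDerivAt.comp x h1
    have h3 := (EuclideanSpace.proj (𝕜 := ℝ) j : EuclideanSpace ℝ (Fin k) →L[ℝ] ℝ).hasFDerivAt.comp
      x (hc.differentiable one_ne_zero x).hasFDerivAt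
    have h4 : fderiv ℝ (fun x => c x j * f (D.W x + y)) x = _ := (h3.mul h2).fderiv
    rw [h4]
    rfl
  have h1 := D.integral_fderiv j hG
  simp_rw [hd] at h1
  rw [integral_add (hi1 j) (hi3 j)] at h1
  rw [integral_sub (hi2 j) (hi3 j), ← h1]
  ring

theorem continuous_shift_integrand :
    Continuous fun x => 2 * ‖D.W x‖
      + 20 * ∑ j, ‖hsColumns k (fderiv ℝ D.kernel x (D.u j x))‖ := by
  have hT' : Continuous (fderiv ℝ D.kernel) := D.contDiff_kernel.continuous_fderiv one_ne_zero
  refine ((D.W.continuous.norm).const_mul _).add (Continuous.const_mul ?_ _)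
  refine continuous_finsetSum _ fun j _ => ?_
  have h1 : Continuous fun x => fderiv ℝ D.kernel x (D.u j x) :=
    hT'.clm_apply (D.contDiff_u j).continuous
  exact ((hsColumns k).continuous.comp h1).norm

/-- Where the Stein kernel is close to the identity, derivatives of `f` along `W` integrate to at most
a multiple of the supremum of `f`. -/
theorem abs_integral_cutoff_mul_fderiv_le (hμ : ∀ h : E → ℝ, Continuous h → Integrable h μ)
    {f : EuclideanSpace ℝ (Fin k) → ℝ} (hf : ContDiff ℝ 1 f) (hf1 : ∀ y, |f y| ≤ 1)
    (y : EuclideanSpace ℝ (Fin k)) :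
    |∫ x, cutoff (D.defect x) * fderiv ℝ f (D.W x + y) z ∂μ| ≤ ‖z‖ * D.shiftConst := by
  have e1 : ∀ x, cutoff (D.defect x) * fderiv ℝ f (D.W x + y) z
      = fderiv ℝ f (D.W x + y) (D.kernel x (D.weight z x)) := by
    intro x
    rw [D.kernel_weight, map_smul, smul_eq_mul]
  simp_rw [e1]
  rw [D.integral_fderiv_kernel_apply hμ hf (D.contDiff_weight z), ← Real.norm_eq_abs, shiftConst,
    ← integral_const_mul]
  refine norm_integral_le_of_norm_le ((hμ _ D.continuous_shift_integrand).const_mul _)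
    (ae_of_all _ fun x => ?_)
  rw [norm_mul]
  refine (mul_le_of_le_one_left (norm_nonneg _) (hf1 _)).trans ?_
  refine (norm_sub_le _ _).trans ?_
  have h1 : ‖(inner ℝ (D.W x) (D.weight z x) : ℝ)‖ ≤ ‖D.W x‖ * (2 * ‖z‖) :=
    (abs_real_inner_le_norm _ _).trans
      (mul_le_mul_of_nonneg_left (D.norm_weight_le z x) (norm_nonneg _))
  have h3 : ‖∑ j, fderiv ℝ (D.weight z) x (D.u j x) j‖
      ≤ 20 * ‖z‖ * ∑ j, ‖hsColumns k (fderiv ℝ D.kernel x (D.u j x))‖ := by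
    refine (norm_sum_le _ _).trans ?_
    rw [Finset.mul_sum]
    refine Finset.sum_le_sum fun j _ => ?_
    exact (PiLp.norm_apply_le _ j).trans (D.norm_fderiv_weight_le z x _)
  linarith

end SteinFrame

end Smoothing

/-! ### Bounded test functions -/

section Bounded

variable {k : ℕ}

local notation "γ" => stdGaussian (EuclideanSpace ℝ (Fin k))

/-- A bound on the mean derivative of `f` in direction `z`, uniform over translations, bounds the mean
increment of `f` under the translation by `z`. -/
theorem abs_integral_mul_translate_sub_le {α : Type*} [MeasurableSpace α] {P : Measure α}
    {w : α → ℝ} (hw : Integrable w P) {Y : α → EuclideanSpace ℝ (Fin k)}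
    (hY : AEStronglyMeasurable Y P) {f : EuclideanSpace ℝ (Fin k) → ℝ} (hf : ContDiff ℝ 1 f)
    (hf1 : ∀ y, |f y| ≤ 1) {B : ℝ} (hB : ∀ y, ‖fderiv ℝ f y‖ ≤ B)
    {z : EuclideanSpace ℝ (Fin k)} {C : ℝ}
    (hC : ∀ y, |∫ a, w a * fderiv ℝ f (Y a + y) z ∂P| ≤ C) :
    |∫ a, w a * f (Y a + z) ∂P - ∫ a, w a * f (Y a) ∂P| ≤ C := by
  have hfc := hf.continuous
  have hf' : Continuous (fderiv ℝ f) := hf.continuous_fderiv one_ne_zero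
  have hm : ∀ s : ℝ, AEStronglyMeasurable (fun a => f (Y a + s • z)) P := fun s =>
    (hfc.comp (continuous_add_const (s • z))).comp_aestronglyMeasurable hY
  have hm' : ∀ s : ℝ, AEStronglyMeasurable (fun a => fderiv ℝ f (Y a + s • z) z) P := fun s => by
    have h1 : Continuous fun y => fderiv ℝ f (y + s • z) z := by fun_prop
    exact h1.comp_aestronglyMeasurable hY
  have hd : ∀ s : ℝ, HasDerivAt (fun s : ℝ => ∫ a, w a * f (Y a + s • z) ∂P)
      (∫ a, w a * fderiv ℝ f (Y a + s • z) z ∂P) s := by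
    intro s
    refine (hasDerivAt_integral_of_dominated_loc_of_deriv_le (Metric.ball_mem_nhds s one_pos)
      (F := fun (s : ℝ) a => w a * f (Y a + s • z))
      (F' := fun (s : ℝ) a => w a * fderiv ℝ f (Y a + s • z) z) (μ := P) (x₀ := s)
      (bound := fun a => ‖w a‖ * (B * ‖z‖)) ?_ ?_ ?_ ?_ (hw.norm.mul_const _) ?_).2
    · exact Filter.Eventually.of_forall fun s => hw.aestronglyMeasurable.mul (hm s)
    · exact hw.mul_bdd (c := 1) (hm s) (ae_of_all _ fun a => hf1 _)
    · exact hw.aestronglyMeasurable.mul (hm' s)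
    · refine ae_of_all _ fun a s _ => ?_
      rw [norm_mul]
      refine mul_le_mul_of_nonneg_left ?_ (norm_nonneg _)
      exact ((fderiv ℝ f _).le_opNorm z).trans (mul_le_mul_of_nonneg_right (hB _) (norm_nonneg _))
    · refine ae_of_all _ fun a s _ => HasDerivAt.const_mul _ ?_
      have h1 : HasDerivAt (fun s : ℝ => Y a + s • z) z s := by
        simpa using ((hasDerivAt_id s).smul_const z).const_add (Y a)
      exact (hf.differentiable one_ne_zero (Y a + s • z)).hasFDerivAt.comp_hasDerivAt s h1
  have h := Convex.norm_image_sub_le_of_norm_hasDerivWithin_le (s := Set.univ)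
    (x := 0) (y := (1:ℝ)) (fun t _ => (hd t).hasDerivWithinAt) (fun t _ => hC (t • z))
    convex_univ (Set.mem_univ _) (Set.mem_univ _)
  simpa using h

theorem stdGaussian_abs_integral_fderiv_le {f : EuclideanSpace ℝ (Fin k) → ℝ}
    (hf : ContDiff ℝ 1 f) (hf1 : ∀ y, |f y| ≤ 1) {B : ℝ} (hB : ∀ y, ‖fderiv ℝ f y‖ ≤ B)
    {t : ℝ} (ht : 0 < t) (y z : EuclideanSpace ℝ (Fin k)) :
    |∫ x, fderiv ℝ f (t • x + y) z ∂γ| ≤ ‖z‖ / t := by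
  set g : EuclideanSpace ℝ (Fin k) → ℝ := fun x => f (t • x + y) with hg
  have hgs : ContDiff ℝ 1 g := hf.comp (by fun_prop)
  have hgd : ∀ x, fderiv ℝ g x = t • fderiv ℝ f (t • x + y) := by
    intro x
    have h1 : HasFDerivAt (fun x => t • x + y)
        (t • ContinuousLinearMap.id ℝ (EuclideanSpace ℝ (Fin k))) x :=
      ((hasFDerivAt_id x).const_smul t).add_const y
    have h2 : fderiv ℝ g x = _ :=
      ((hf.differentiable one_ne_zero (t • x + y)).hasFDerivAt.comp x h1).fderiv
    rw [h2]
    ext v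
    simp
  have h := stdGaussian_integral_inner_mul hgs (A := 1) (B := t * B) (fun x => hf1 _)
    (fun x => by
      rw [hgd, norm_smul, Real.norm_eq_abs, abs_of_pos ht]
      exact mul_le_mul_of_nonneg_left (hB _) ht.le) z
  simp_rw [hgd, smul_apply, smul_eq_mul] at h
  rw [integral_const_mul] at h
  have h1 : |∫ x, inner ℝ x z * g x ∂γ| ≤ ‖z‖ := by
    have hid : MemLp (fun x : EuclideanSpace ℝ (Fin k) => x) 2 γ := IsGaussian.memLp_two_id
    have hL : MemLp (fun x => ‖(inner ℝ z x : ℝ)‖) 2 γ := ((innerSL ℝ z).comp_memLp' hid).norm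
    rw [← Real.norm_eq_abs]
    refine (norm_integral_le_of_norm_le (g := fun x => ‖(inner ℝ z x : ℝ)‖)
      (hL.integrable one_le_two) (ae_of_all _ fun x => ?_)).trans ?_
    · rw [norm_mul, real_inner_comm]
      exact mul_le_of_le_one_right (norm_nonneg _) (hf1 _)
    · refine (integral_le_sqrt_integral_sq hL).trans ?_
      simp_rw [Real.norm_eq_abs, sq_abs]
      rw [stdGaussian_integral_inner_sq, Real.sqrt_sq (norm_nonneg _)]
  rw [h, abs_mul, abs_of_pos ht] at h1
  rwa [le_div_iff₀' ht]

/-- Translating the Gaussian measure by `z` costs at most `‖z‖`. -/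
theorem stdGaussian_abs_integral_translate_sub_le {f : EuclideanSpace ℝ (Fin k) → ℝ}
    (hf : ContDiff ℝ 1 f) (hf1 : ∀ y, |f y| ≤ 1) {B : ℝ} (hB : ∀ y, ‖fderiv ℝ f y‖ ≤ B)
    (z : EuclideanSpace ℝ (Fin k)) : |∫ x, f (x + z) ∂γ - ∫ x, f x ∂γ| ≤ ‖z‖ := by
  have h := abs_integral_mul_translate_sub_le (P := γ) (w := fun _ => 1) (integrable_const _)
    (Y := fun x => x) aestronglyMeasurable_id hf hf1 hB (z := z) (C := ‖z‖) fun y => by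
      simpa using stdGaussian_abs_integral_fderiv_le hf hf1 hB one_pos y z
  simpa using h

/-- Gaussian smoothing at scale `t` turns a function bounded by `1` into a `1 / t`-Lipschitz one. -/
theorem lipschitzWith_smul_gaussian_smoothing {f : EuclideanSpace ℝ (Fin k) → ℝ}
    (hf : ContDiff ℝ 1 f) (hf1 : ∀ y, |f y| ≤ 1) {B : ℝ} (hB : ∀ y, ‖fderiv ℝ f y‖ ≤ B)
    {t : ℝ} (ht : 0 < t) : LipschitzWith 1 fun y => t * ∫ x, f (y + t • x) ∂γ := by
  refine LipschitzWith.of_dist_le_mul fun a b => ?_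
  have hm : AEStronglyMeasurable (fun x : EuclideanSpace ℝ (Fin k) => b + t • x) γ :=
    Continuous.aestronglyMeasurable (by fun_prop)
  have h := abs_integral_mul_translate_sub_le (P := γ) (w := fun _ => 1) (integrable_const _)
    (Y := fun x => b + t • x) hm hf hf1 hB
    (z := a - b) (C := ‖a - b‖ / t) fun y => by
      have := stdGaussian_abs_integral_fderiv_le hf hf1 hB ht (b + y) (a - b)
      simp_rw [show ∀ x : EuclideanSpace ℝ (Fin k), t • x + (b + y) = b + t • x + y from
        fun x => by abel] at this
      simpa using this
  simp_rw [one_mul, show ∀ x : EuclideanSpace ℝ (Fin k), b + t • x + (a - b) = a + t • x from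
        fun x => by abel] at h
  rw [Real.dist_eq, ← mul_sub, abs_mul, abs_of_pos ht, NNReal.coe_one, one_mul, dist_eq_norm]
  rwa [le_div_iff₀' ht] at h

variable {E : Type*} [NormedAddCommGroup E] [NormedSpace ℝ E] [MeasurableSpace E] [BorelSpace E]
  {μ : Measure E} (D : SteinFrame μ k)

namespace SteinFrame

theorem shiftConst_nonneg : 0 ≤ D.shiftConst :=
  integral_nonneg fun x => add_nonneg (by positivity)
    (mul_nonneg (by norm_num) (Finset.sum_nonneg fun _ _ => norm_nonneg _))

/-- The law of `W` is stable under translations, up to the discrepancy. -/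
theorem abs_integral_translate_sub_le [IsProbabilityMeasure μ]
    (hμ : ∀ h : E → ℝ, Continuous h → Integrable h μ)
    {f : EuclideanSpace ℝ (Fin k) → ℝ} (hf : ContDiff ℝ 1 f) (hf1 : ∀ y, |f y| ≤ 1)
    {B : ℝ} (hB : ∀ y, ‖fderiv ℝ f y‖ ≤ B) (z : EuclideanSpace ℝ (Fin k)) :
    |∫ x, f (D.W x + z) ∂μ - ∫ x, f (D.W x) ∂μ| ≤ ‖z‖ * D.shiftConst + 6 * D.discrepancy := by
  have hfc := hf.continuous
  have hψ : Continuous fun x => cutoff (D.defect x) :=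
    contDiff_cutoff.continuous.comp D.contDiff_defect.continuous
  have hψi : Integrable (fun x => cutoff (D.defect x)) μ := hμ _ hψ
  have h1 := abs_integral_mul_translate_sub_le hψi (Y := fun x => D.W x)
    D.W.continuous.measurable.aemeasurable.aestronglyMeasurable hf hf1 hB (z := z)
    (D.abs_integral_cutoff_mul_fderiv_le z hμ hf hf1)
  have hk : Continuous D.kernel := D.contDiff_kernel.continuous
  have hd : Continuous fun x => ‖hsColumns k (D.kernel x - 1)‖ :=
    ((hsColumns k).continuous.comp (hk.sub continuous_const)).norm
  have h2 : |∫ x, (1 - cutoff (D.defect x)) * (f (D.W x + z) - f (D.W x)) ∂μ|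
      ≤ 6 * D.discrepancy := by
    rw [← Real.norm_eq_abs, discrepancy, ← integral_const_mul]
    refine norm_integral_le_of_norm_le ((hμ _ hd).const_mul _) (ae_of_all _ fun x => ?_)
    have h3 : 0 ≤ 1 - cutoff (D.defect x) := by linarith [cutoff_le_one (D.defect_nonneg x)]
    have h4 : 1 - cutoff (D.defect x) ≤ 3 * ‖hsColumns k (D.kernel x - 1)‖ :=
      one_sub_cutoff_sq_le (norm_nonneg _)
    have h5 : |f (D.W x + z) - f (D.W x)| ≤ 2 := by
      refine (abs_sub _ _).trans ?_
      linarith [hf1 (D.W x + z), hf1 (D.W x)]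
    rw [norm_mul, Real.norm_eq_abs, Real.norm_eq_abs, abs_of_nonneg h3]
    calc _ ≤ (3 * ‖hsColumns k (D.kernel x - 1)‖) * 2 := by gcongr
      _ = _ := by ring
  have i1 : Integrable (fun x => f (D.W x + z)) μ := hμ _ (by fun_prop)
  have i2 : Integrable (fun x => f (D.W x)) μ := hμ _ (by fun_prop)
  have i3 : Integrable (fun x => cutoff (D.defect x) * f (D.W x + z)) μ :=
    hμ _ (hψ.mul (by fun_prop))
  have i4 : Integrable (fun x => cutoff (D.defect x) * f (D.W x)) μ :=
    hμ _ (hψ.mul (by fun_prop))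
  have e : ∫ x, f (D.W x + z) ∂μ - ∫ x, f (D.W x) ∂μ
      = (∫ x, cutoff (D.defect x) * f (D.W x + z) ∂μ - ∫ x, cutoff (D.defect x) * f (D.W x) ∂μ)
        + ∫ x, (1 - cutoff (D.defect x)) * (f (D.W x + z) - f (D.W x)) ∂μ := by
    have i5 : Integrable (fun x => (1 - cutoff (D.defect x)) * (f (D.W x + z) - f (D.W x))) μ :=
      hμ _ ((continuous_const.sub hψ).mul (by fun_prop))
    rw [← integral_sub i1 i2, ← integral_sub i3 i4]
    have i6 : Integrable (fun x => cutoff (D.defect x) * f (D.W x + z)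
      - cutoff (D.defect x) * f (D.W x)) μ := i3.sub i4
    rw [← integral_add i6 i5]
    congr 1
    funext x
    ring
  rw [e]
  exact (abs_add_le _ _).trans (add_le_add h1 h2)

/-- Comparison with the Gaussian law on smooth functions bounded by `1`: both laws are smoothed
by an independent Gaussian vector of size `t`, and the smoothed laws are compared with the
Wasserstein bound. -/
theorem abs_integral_sub_le_of_bounded [IsProbabilityMeasure μ]
    (hμ : ∀ h : E → ℝ, Continuous h → Integrable h μ)
    {f : EuclideanSpace ℝ (Fin k) → ℝ} (hf : ContDiff ℝ 1 f) (hf1 : ∀ y, |f y| ≤ 1)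
    {B : ℝ} (hB : ∀ y, ‖fderiv ℝ f y‖ ≤ B) {t : ℝ} (ht : 0 < t) :
    |∫ x, f (D.W x) ∂μ - ∫ z, f z ∂γ|
      ≤ t * √k * (D.shiftConst + 1) + 6 * D.discrepancy + Real.pi / 2 * D.discrepancy / t := by
  have hfc := hf.continuous
  have hnorm : Integrable (fun z : EuclideanSpace ℝ (Fin k) => ‖z‖) γ :=
    IsGaussian.integrable_id.norm
  have hi : Integrable (fun q : E × EuclideanSpace ℝ (Fin k) => f (D.W q.1 + t • q.2))
      (μ.prod γ) :=
    Integrable.of_bound (C := 1) (Continuous.aestronglyMeasurable (by fun_prop))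
      (ae_of_all _ fun q => hf1 _)
  have hi' : Integrable (fun q : EuclideanSpace ℝ (Fin k) × EuclideanSpace ℝ (Fin k) =>
      f (q.1 + t • q.2)) (Measure.prod γ γ) :=
    Integrable.of_bound (C := 1) (Continuous.aestronglyMeasurable (by fun_prop))
      (ae_of_all _ fun q => hf1 _)
  -- smoothing the law of `W`
  have s1 : |∫ x, ∫ z, f (D.W x + t • z) ∂γ ∂μ - ∫ x, f (D.W x) ∂μ|
      ≤ t * √k * D.shiftConst + 6 * D.discrepancy := by
    rw [integral_integral_swap hi]
    have e : ∫ z, ∫ x, f (D.W x + t • z) ∂μ ∂γ - ∫ x, f (D.W x) ∂μ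
        = ∫ z, (∫ x, f (D.W x + t • z) ∂μ - ∫ x, f (D.W x) ∂μ) ∂γ := by
      rw [integral_sub hi.integral_prod_right (integrable_const _)]
      simp
    rw [e, ← Real.norm_eq_abs]
    refine (norm_integral_le_of_norm_le
      (g := fun z => t * D.shiftConst * ‖z‖ + 6 * D.discrepancy)
      ((hnorm.const_mul _).add (integrable_const _)) (ae_of_all _ fun z => ?_)).trans ?_
    · refine (D.abs_integral_translate_sub_le hμ hf hf1 hB (t • z)).trans ?_
      rw [norm_smul, Real.norm_eq_abs, abs_of_pos ht]
      linarith
    · rw [integral_add (hnorm.const_mul _) (integrable_const _), integral_const_mul]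
      have := mul_le_mul_of_nonneg_left (stdGaussian_integral_norm_le (k := k))
        (mul_nonneg ht.le D.shiftConst_nonneg)
      simp only [integral_const, probReal_univ, one_smul]
      linarith
  -- smoothing the Gaussian law
  have s2 : |∫ x, ∫ z, f (x + t • z) ∂γ ∂γ - ∫ x, f x ∂γ| ≤ t * √k := by
    rw [integral_integral_swap hi']
    have e : ∫ z, ∫ x, f (x + t • z) ∂γ ∂γ - ∫ x, f x ∂γ
        = ∫ z, (∫ x, f (x + t • z) ∂γ - ∫ x, f x ∂γ) ∂γ := by
      rw [integral_sub hi'.integral_prod_right (integrable_const _)]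
      simp
    rw [e, ← Real.norm_eq_abs]
    refine (norm_integral_le_of_norm_le (g := fun z => t * ‖z‖)
      (hnorm.const_mul _) (ae_of_all _ fun z => ?_)).trans ?_
    · refine (stdGaussian_abs_integral_translate_sub_le hf hf1 hB (t • z)).trans ?_
      rw [norm_smul, Real.norm_eq_abs, abs_of_pos ht]
    · rw [integral_const_mul]
      exact mul_le_mul_of_nonneg_left stdGaussian_integral_norm_le ht.le
  -- comparing the smoothed laws
  have s3 : |∫ x, ∫ z, f (D.W x + t • z) ∂γ ∂μ - ∫ x, ∫ z, f (x + t • z) ∂γ ∂γ|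
      ≤ Real.pi / 2 * D.discrepancy / t := by
    have h := D.abs_integral_sub_le hμ (lipschitzWith_smul_gaussian_smoothing hf hf1 hB ht)
    rw [integral_const_mul, integral_const_mul, ← mul_sub, abs_mul, abs_of_pos ht] at h
    rwa [le_div_iff₀' ht]
  rw [abs_le] at s1 s2 s3 ⊢
  constructor <;> linarith [s1.1, s1.2, s2.1, s2.2, s3.1, s3.2]

end SteinFrame

end Bounded

/-! ### Reduction of total variation to smooth test functions -/

section TotalVariation

variable {k : ℕ}

theorem exists_contDiff_one_zero {K U : Set (EuclideanSpace ℝ (Fin k))} (hK : IsCompact K)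
    (hU : IsOpen U) (hKU : K ⊆ U) :
    ∃ f : EuclideanSpace ℝ (Fin k) → ℝ, ContDiff ℝ 1 f ∧ HasCompactSupport f ∧
      (∀ x, f x ∈ Set.Icc (0:ℝ) 1) ∧ (∀ x ∈ K, f x = 1) ∧ ∀ x ∉ U, f x = 0 := by
  obtain ⟨R, hR⟩ := hK.isBounded.subset_ball 0
  have hd : Disjoint (U ∩ Metric.ball 0 R)ᶜ K :=
    Set.disjoint_left.2 fun x hx hxK => hx ⟨hKU hxK, hR hxK⟩
  obtain ⟨f, hf0, hf1, hf⟩ := exists_contMDiffMap_zero_one_of_isClosed (n := 1)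
    (modelWithCornersSelf ℝ (EuclideanSpace ℝ (Fin k)))
    (hU.inter Metric.isOpen_ball).isClosed_compl hK.isClosed hd
  refine ⟨f, f.contMDiff.contDiff, ?_, hf, fun x hx => hf1 hx, fun x hx => hf0 fun h => hx h.1⟩
  refine HasCompactSupport.intro (isCompact_closedBall (0 : EuclideanSpace ℝ (Fin k)) R)
    fun x hx => hf0 fun h => hx (Metric.ball_subset_closedBall h.2)

/-- By regularity of the measures, the total variation distance may be tested on smooth functions of
compact support. -/
theorem abs_measureReal_sub_le_of_contDiff {ν₁ ν₂ : Measure (EuclideanSpace ℝ (Fin k))}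
    [IsProbabilityMeasure ν₁] [IsProbabilityMeasure ν₂] {b : ℝ}
    (h : ∀ f : EuclideanSpace ℝ (Fin k) → ℝ, ContDiff ℝ 1 f → HasCompactSupport f →
      (∀ y, |f y| ≤ 1) → |∫ y, f y ∂ν₁ - ∫ y, f y ∂ν₂| ≤ b)
    {A : Set (EuclideanSpace ℝ (Fin k))} (hA : MeasurableSet A) :
    |ν₁.real A - ν₂.real A| ≤ b := by
  refine le_of_forall_pos_le_add fun ε hε => ?_
  have hε' : ENNReal.ofReal (ε / 4) ≠ 0 := by simpa using hε
  obtain ⟨K, hKA, hK, hAK⟩ := hA.exists_isCompact_sdiff_lt (μ := ν₁ + ν₂)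
    (measure_ne_top _ _) hε'
  obtain ⟨U, hAU, hU, -, hUA⟩ := hA.exists_isOpen_sdiff_lt (μ := ν₁ + ν₂)
    (measure_ne_top _ _) hε'
  obtain ⟨f, hfs, hfc, hf01, hf1, hf0⟩ := exists_contDiff_one_zero hK hU (hKA.trans hAU)
  have key : ∀ ν : Measure (EuclideanSpace ℝ (Fin k)), IsProbabilityMeasure ν → ν ≤ ν₁ + ν₂ →
      |∫ y, f y ∂ν - ν.real A| ≤ ε / 2 := by
    intro ν _ hν
    have hfi : Integrable f ν := Integrable.of_bound (C := 1) hfs.continuous.aestronglyMeasurable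
      (ae_of_all _ fun y => by rw [Real.norm_eq_abs, abs_le]; constructor <;> linarith
        [(hf01 y).1, (hf01 y).2])
    have hm : MeasurableSet (U \ K) := hU.measurableSet.diff hK.measurableSet
    have h1 : (ν (U \ K)).toReal ≤ ε / 2 := by
      have h2 : ν (U \ K) ≤ ENNReal.ofReal (ε / 2) := by
        calc ν (U \ K) ≤ (ν₁ + ν₂) (U \ K) := hν _
          _ ≤ (ν₁ + ν₂) ((A \ K) ∪ (U \ A)) := measure_mono fun x hx => by
              by_cases hxA : x ∈ A
              · exact Or.inl ⟨hxA, hx.2⟩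
              · exact Or.inr ⟨hx.1, hxA⟩
          _ ≤ _ := measure_union_le _ _
          _ ≤ ENNReal.ofReal (ε / 4) + ENNReal.ofReal (ε / 4) := add_le_add hAK.le hUA.le
          _ = _ := by rw [← ENNReal.ofReal_add (by positivity) (by positivity)]; congr 1; ring
      exact ENNReal.toReal_le_of_le_ofReal (by positivity) h2
    have h3 : ∫ y, f y ∂ν - ν.real A = ∫ y, (f y - A.indicator (fun _ => (1:ℝ)) y) ∂ν := by
      rw [integral_sub hfi ((integrable_const _).indicator hA), integral_indicator hA]
      simp
    rw [h3, ← Real.norm_eq_abs]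
    refine (norm_integral_le_of_norm_le (g := (U \ K).indicator fun _ => (1:ℝ))
      ((integrable_const _).indicator hm) (ae_of_all _ fun y => ?_)).trans ?_
    · by_cases hyK : y ∈ K
      · rw [Set.indicator_of_mem (hKA hyK), hf1 y hyK]
        simpa using Set.indicator_nonneg (fun _ _ => zero_le_one) y
      · by_cases hyU : y ∈ U
        · rw [Set.indicator_of_mem (Set.mem_sdiff_of_mem hyU hyK), Real.norm_eq_abs, abs_le]
          have h4 : A.indicator (fun _ => (1:ℝ)) y ≤ 1 :=
            Set.indicator_le_self' (fun _ _ => zero_le_one) y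
          have h5 : 0 ≤ A.indicator (fun _ => (1:ℝ)) y :=
            Set.indicator_nonneg (fun _ _ => zero_le_one) y
          constructor <;> linarith [(hf01 y).1, (hf01 y).2]
        · rw [Set.indicator_of_notMem fun h => hyU (hAU h), hf0 y hyU]
          simpa using Set.indicator_nonneg (fun _ _ => zero_le_one) y
    · rw [integral_indicator hm]
      simpa [Measure.real] using h1
  have hfabs : ∀ y, |f y| ≤ 1 := fun y => by
    rw [abs_le]; constructor <;> linarith [(hf01 y).1, (hf01 y).2]
  have h1 := h f hfs hfc hfabs
  have h2 := key ν₁ inferInstance (Measure.le_add_right le_rfl)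
  have h3 := key ν₂ inferInstance (Measure.le_add_left le_rfl)
  rw [abs_le] at h1 h2 h3 ⊢
  constructor <;> linarith [h1.1, h1.2, h2.1, h2.2, h3.1, h3.2]

variable {E : Type*} [NormedAddCommGroup E] [NormedSpace ℝ E] [MeasurableSpace E] [BorelSpace E]
  {μ : Measure E} (D : SteinFrame μ k)

/-- Total variation bound, with a free smoothing scale `t`. -/
theorem SteinFrame.abs_measureReal_sub_le [IsProbabilityMeasure μ]
    (hμ : ∀ h : E → ℝ, Continuous h → Integrable h μ) {t : ℝ} (ht : 0 < t)
    {A : Set (EuclideanSpace ℝ (Fin k))} (hA : MeasurableSet A) :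
    |μ.real (D.W ⁻¹' A) - (stdGaussian (EuclideanSpace ℝ (Fin k))).real A|
      ≤ t * √k * (D.shiftConst + 1) + 6 * D.discrepancy + Real.pi / 2 * D.discrepancy / t := by
  have hW : Measurable D.W := D.W.continuous.measurable
  have : IsProbabilityMeasure (μ.map D.W) := Measure.isProbabilityMeasure_map hW.aemeasurable
  rw [← map_measureReal_apply hW hA]
  refine abs_measureReal_sub_le_of_contDiff (fun f hf hc hf1 => ?_) hA
  obtain ⟨B, hB⟩ := exists_bound_fderiv (hf.continuous_fderiv one_ne_zero) hc
  rw [integral_map hW.aemeasurable hf.continuous.aestronglyMeasurable]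
  exact D.abs_integral_sub_le_of_bounded hμ hf hf1 hB ht

end TotalVariation

/-! ### The Stein frame of a simplex -/

section SimplexFrame

variable {ι E : Type*} [Fintype ι] [NormedAddCommGroup E] [NormedSpace ℝ E]
  [FiniteDimensional ℝ E] [MeasurableSpace E] [BorelSpace E]
  (b : AffineBasis ι ℝ E) (ν : Measure E) [ν.IsAddHaarMeasure] {k : ℕ}
  (W : E →L[ℝ] EuclideanSpace ℝ (Fin k))

theorem AffineBasis.sum_coord_smul_map (x : E) : ∑ l, b.coord l x • W (b l) = W x := by
  have h := congrArg W (b.linear_combination_coord_eq_self x)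
  rw [map_sum] at h
  simpa only [map_smul] using h

/-- The Stein frame of the uniform measure on a simplex, for a linear map with mean zero. -/
def simplexFrame (hW : ∑ l, W (b l) = 0) : SteinFrame (simplexUniform b ν) k where
  W := W
  u j x := ∑ l, (W (b l) j / (Module.finrank ℝ E + 1 : ℝ)) • b.coord l x • (b l - x)
  contDiff_u j := ContDiff.sum fun l _ =>
    contDiff_const.smul ((b.contDiff_coord l).smul (contDiff_const.sub contDiff_id))
  integral_fderiv j g hg := by
    have hg' : Continuous (fderiv ℝ g) := hg.continuous_fderiv one_ne_zero
    have hgc := hg.continuous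
    have hc := fun l => continuous_barycentric_coord b l
    have hN : (0:ℝ) < Module.finrank ℝ E + 1 := by positivity
    have e1 : ∀ x, fderiv ℝ g x
        (∑ l, (W (b l) j / (Module.finrank ℝ E + 1 : ℝ)) • b.coord l x • (b l - x))
        = ∑ l, (W (b l) j / (Module.finrank ℝ E + 1 : ℝ))
          * (b.coord l x * fderiv ℝ g x (b l - x)) := by
      intro x
      rw [map_sum]
      simp only [map_smul, smul_eq_mul]
    have e2 : ∀ x, W x j * g x = ∑ l, (W (b l) j / (Module.finrank ℝ E + 1 : ℝ))
        * (((Module.finrank ℝ E + 1 : ℝ) * b.coord l x - 1) * g x) := by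
      intro x
      have h1 : ∑ l, W (b l) j = 0 := by
        have := congrArg (fun v : EuclideanSpace ℝ (Fin k) => v j) hW
        simpa using this
      have h2 : W x j = ∑ l, b.coord l x * W (b l) j := by
        rw [← b.sum_coord_smul_map W x]
        simp
      calc W x j * g x
          = (∑ l, b.coord l x * W (b l) j - (∑ l, W (b l) j) / (Module.finrank ℝ E + 1 : ℝ))
            * g x := by rw [h1, h2]; simp
        _ = _ := by
          rw [Finset.sum_div, ← Finset.sum_sub_distrib, Finset.sum_mul]
          refine Finset.sum_congr rfl fun l _ => ?_
          field_simp
    simp_rw [e1, e2]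
    rw [integral_finsetSum _ fun l _ => (integrable_simplexUniform b ν
        (by have := hc l; fun_prop)).const_mul _,
      integral_finsetSum _ fun l _ => (integrable_simplexUniform b ν
        (by have := hc l; fun_prop)).const_mul _]
    refine Finset.sum_congr rfl fun l _ => ?_
    rw [integral_const_mul, integral_const_mul, simplexUniform_coord_mul_fderiv b ν l hg]

variable (hW : ∑ l, W (b l) = 0)

/-- The rank-one operator `y ↦ ⟪u, y⟫ v`. -/
abbrev rankOneOp (u v : EuclideanSpace ℝ (Fin k)) :
    EuclideanSpace ℝ (Fin k) →L[ℝ] EuclideanSpace ℝ (Fin k) := (innerSL ℝ u).smulRight v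

theorem simplexFrame_map_u (j : Fin k) (x : E) :
    W ((simplexFrame b ν W hW).u j x) = (1 / (Module.finrank ℝ E + 1 : ℝ)) •
      (∑ l, (b.coord l x * W (b l) j) • W (b l) - W x j • W x) := by
  have h2 : W x j = ∑ l, b.coord l x * W (b l) j := by
    rw [← b.sum_coord_smul_map W x]
    simp
  rw [h2, Finset.sum_smul, ← Finset.sum_sub_distrib, Finset.smul_sum]
  simp only [simplexFrame, map_sum, map_smul, map_sub]
  refine Finset.sum_congr rfl fun l _ => ?_
  rw [smul_sub, smul_sub, smul_sub, smul_smul, smul_smul, smul_smul, smul_smul]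
  congr 2 <;> ring

/-- The Stein kernel is the covariance of the images of the vertices under the barycentric
weights. -/
theorem simplexFrame_kernel (x : E) :
    (simplexFrame b ν W hW).kernel x = (1 / (Module.finrank ℝ E + 1 : ℝ)) •
      (∑ l, b.coord l x • rankOneOp (W (b l)) (W (b l)) - rankOneOp (W x) (W x)) := by
  ext1 v
  rw [SteinFrame.kernel_apply]
  change ∑ j, v j • W ((simplexFrame b ν W hW).u j x) = _
  simp_rw [simplexFrame_map_u]
  simp only [smul_apply, sub_apply,
    sum_apply, ContinuousLinearMap.smulRight_apply, innerSL_apply_apply]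
  simp_rw [smul_comm (v _) (1 / (Module.finrank ℝ E + 1 : ℝ))]
  rw [← Finset.smul_sum]
  congr 1
  simp_rw [smul_sub, Finset.smul_sum]
  rw [Finset.sum_sub_distrib, Finset.sum_comm]
  congr 1
  · refine Finset.sum_congr rfl fun l _ => ?_
    rw [PiLp.inner_apply, smul_smul, Finset.mul_sum, Finset.sum_smul]
    refine Finset.sum_congr rfl fun j _ => ?_
    rw [smul_smul]
    congr 1
    simp; ring
  · rw [PiLp.inner_apply, Finset.sum_smul]
    refine Finset.sum_congr rfl fun j _ => ?_
    rw [smul_smul]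
    congr 1

theorem simplexFrame_coord_linear_u (j : Fin k) (x : E) (l : ι) :
    (b.coord l).linear ((simplexFrame b ν W hW).u j x)
      = b.coord l x / (Module.finrank ℝ E + 1 : ℝ) * (W (b l) j - W x j) := by
  classical
  have h2 : W x j = ∑ l, b.coord l x * W (b l) j := by
    rw [← b.sum_coord_smul_map W x]
    simp
  have h3 : ∀ m, (b.coord l).linear
      ((W (b m) j / (Module.finrank ℝ E + 1 : ℝ)) • b.coord m x • (b m - x))
      = (if l = m then W (b m) j / (Module.finrank ℝ E + 1 : ℝ) * b.coord m x else 0)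
        - b.coord l x / (Module.finrank ℝ E + 1 : ℝ) * (b.coord m x * W (b m) j) := by
    intro m
    rw [map_smul, map_smul, b.coord_linear_sub, b.coord_apply, smul_eq_mul, smul_eq_mul]
    split_ifs <;> ring
  simp only [simplexFrame, map_sum, h3]
  rw [Finset.sum_sub_distrib, ← Finset.mul_sum, ← h2]
  simp
  ring

theorem simplexFrame_fderiv_kernel (x h : E) :
    fderiv ℝ (simplexFrame b ν W hW).kernel x h = (1 / (Module.finrank ℝ E + 1 : ℝ)) •
      (∑ l, (b.coord l).linear h • rankOneOp (W (b l)) (W (b l))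
        - (rankOneOp (W x) (W h) + rankOneOp (W h) (W x))) := by
  ext1 v
  have h0 : HasFDerivAt (fun y => (simplexFrame b ν W hW).kernel y v)
      ((ContinuousLinearMap.apply ℝ (EuclideanSpace ℝ (Fin k)) v).comp
        (fderiv ℝ (simplexFrame b ν W hW).kernel x)) x :=
    (ContinuousLinearMap.apply ℝ (EuclideanSpace ℝ (Fin k)) v).hasFDerivAt.comp x
      ((simplexFrame b ν W hW).contDiff_kernel.differentiable one_ne_zero x).hasFDerivAt
  set L : E →L[ℝ] ℝ := (innerSL ℝ v).comp W with hL
  have e : (fun y => (simplexFrame b ν W hW).kernel y v)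
      = fun y => (1 / (Module.finrank ℝ E + 1 : ℝ)) •
        (∑ l, b.coord l y • (inner ℝ (W (b l)) v • W (b l)) - L y • W y) := by
    funext y
    rw [simplexFrame_kernel]
    simp [sum_apply, hL, real_inner_comm]
  have h1 := ((HasFDerivAt.fun_sum (u := Finset.univ) fun l _ =>
    (b.hasFDerivAt_coord l x).smul_const (inner ℝ (W (b l)) v • W (b l))).sub
      ((L.hasFDerivAt (x := x)).smul (W.hasFDerivAt (x := x)))).const_smul
      (1 / (Module.finrank ℝ E + 1 : ℝ))
  rw [e] at h0
  have h2 := congrArg (fun A => A h) (h0.unique h1)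
  refine Eq.trans ?_ (h2.trans ?_)
  · rfl
  · simp [sum_apply, hL, real_inner_comm]

end SimplexFrame

section SimplexEstimates

variable {ι E : Type*} [Fintype ι] [NormedAddCommGroup E] [NormedSpace ℝ E]
  [FiniteDimensional ℝ E] [MeasurableSpace E] [BorelSpace E]
  (b : AffineBasis ι ℝ E) (ν : Measure E) [ν.IsAddHaarMeasure] {k : ℕ}
  (W : E →L[ℝ] EuclideanSpace ℝ (Fin k))

theorem EuclideanSpace.sum_abs_le (v : EuclideanSpace ℝ (Fin k)) :
    ∑ j, |v j| ≤ √k * ‖v‖ := by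
  refine le_of_sq_le_sq ?_ (by positivity)
  rw [mul_pow, Real.sq_sqrt (Nat.cast_nonneg k), EuclideanSpace.real_norm_sq_eq]
  have := sq_sum_le_card_mul_sum_sq (s := Finset.univ) (f := fun j => |v j|)
  simpa using this

/-- The images of the vertices of the simplex under `W` form a tight frame of `ℝᵏ` centred at the
origin; the constant is the one for which `W` has identity covariance under the uniform measure. -/
structure IsotropicMap : Prop where
  sum_eq_zero : ∑ l, W (b l) = 0
  tight : ∀ v, ∑ l, inner ℝ (W (b l)) v • W (b l)
    = ((Module.finrank ℝ E + 1 : ℝ) * (Module.finrank ℝ E + 2 : ℝ)) • v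

variable {b W} (hW : IsotropicMap b W)

include hW

namespace IsotropicMap

theorem sum_norm_sq : ∑ l, ‖W (b l)‖ ^ 2
    = (Module.finrank ℝ E + 1 : ℝ) * (Module.finrank ℝ E + 2 : ℝ) * k := by
  simp_rw [← EuclideanSpace.sum_inner_single_sq (W (b _))]
  rw [Finset.sum_comm]
  have h : ∀ j : Fin k, ∑ l, (inner ℝ (EuclideanSpace.single j (1:ℝ)) (W (b l))) ^ 2
      = (Module.finrank ℝ E + 1 : ℝ) * (Module.finrank ℝ E + 2 : ℝ) := by
    intro j
    have h1 := congrArg (fun v => inner ℝ (EuclideanSpace.single j (1:ℝ)) v)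
      (hW.tight (EuclideanSpace.single j 1))
    simp only [inner_sum, inner_smul_right, real_inner_self_eq_norm_sq, PiLp.norm_single,
      norm_one, one_pow, mul_one] at h1
    rw [← h1]
    refine Finset.sum_congr rfl fun l _ => ?_
    rw [sq, real_inner_comm]
  simp_rw [h]
  simp
  ring

theorem map_eq_sum (x : E) :
    W x = ∑ l, (b.coord l x - 1 / (Module.finrank ℝ E + 1 : ℝ)) • W (b l) := by
  simp_rw [sub_smul]
  rw [Finset.sum_sub_distrib, ← Finset.smul_sum, hW.sum_eq_zero, smul_zero, sub_zero,
    b.sum_coord_smul_map]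

theorem integral_norm_sq_le : ∫ x, ‖W x‖ ^ 2 ∂(simplexUniform b ν) ≤ k := by
  have h := simplexUniform_norm_sq_sum_le b ν (fun l => W (b l))
  simp_rw [← hW.map_eq_sum] at h
  rw [hW.sum_norm_sq, mul_div_cancel_left₀ _ (by positivity)] at h
  exact h

theorem integral_norm_le : ∫ x, ‖W x‖ ∂(simplexUniform b ν) ≤ √k := by
  have hc : Continuous fun x => ‖W x‖ := by fun_prop
  have hm : MemLp (fun x => ‖W x‖) 2 (simplexUniform b ν) :=
    (memLp_two_iff_integrable_sq hc.aestronglyMeasurable).2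
      (integrable_simplexUniform b ν (by fun_prop))
  exact (integral_le_sqrt_integral_sq hm).trans (Real.sqrt_le_sqrt (hW.integral_norm_sq_le ν))

theorem kernel_sub_one (x : E) :
    (simplexFrame b ν W hW.sum_eq_zero).kernel x - 1 = (1 / (Module.finrank ℝ E + 1 : ℝ)) •
      (∑ l, (b.coord l x - 1 / (Module.finrank ℝ E + 1 : ℝ)) • rankOneOp (W (b l)) (W (b l))
        + (1 - rankOneOp (W x) (W x))) := by
  ext1 v
  have h := hW.tight v
  rw [simplexFrame_kernel]
  simp only [smul_apply, sub_apply,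
    add_apply, sum_apply,
    ContinuousLinearMap.smulRight_apply, innerSL_apply_apply, one_apply_eq_self,
    sub_smul]
  rw [Finset.sum_sub_distrib, ← Finset.smul_sum, h, smul_smul]
  have h3 : 1 / (Module.finrank ℝ E + 1 : ℝ)
      * ((Module.finrank ℝ E + 1 : ℝ) * (Module.finrank ℝ E + 2 : ℝ))
      = (Module.finrank ℝ E + 1 : ℝ) + 1 := by field_simp; ring
  rw [h3]
  generalize ∑ l, b.coord l x • inner ℝ (W (b l)) v • W (b l) = a
  generalize inner ℝ (W x) v • W x = c
  match_scalars <;> field_simp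
  ring

/-- The Stein discrepancy is controlled by the fourth moments of the images of the vertices. -/
theorem discrepancy_le : (simplexFrame b ν W hW.sum_eq_zero).discrepancy
    ≤ (1 / (Module.finrank ℝ E + 1 : ℝ)) * (√((∑ l, ‖W (b l)‖ ^ 4) /
      ((Module.finrank ℝ E + 1 : ℝ) * (Module.finrank ℝ E + 2 : ℝ))) + 2 * k) := by
  set N : ℝ := Module.finrank ℝ E + 1 with hN
  have hN0 : 0 < N := by positivity
  have hc := fun l => continuous_barycentric_coord b l
  set V : E → PiLp 2 (fun _ : Fin k => EuclideanSpace ℝ (Fin k)) := fun x =>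
    ∑ l, (b.coord l x - 1 / N) • hsColumns k (rankOneOp (W (b l)) (W (b l))) with hV
  have hVc : Continuous V := continuous_finsetSum _ fun l _ => by have := hc l; fun_prop
  have hpt : ∀ x, ‖hsColumns k ((simplexFrame b ν W hW.sum_eq_zero).kernel x - 1)‖
      ≤ 1 / N * (‖V x‖ + (√k + ‖W x‖ ^ 2)) := by
    intro x
    rw [hW.kernel_sub_one ν, map_smul, norm_smul, ← hN, Real.norm_eq_abs,
      abs_of_pos (by positivity), map_add, map_sum, map_sub]
    simp_rw [map_smul]
    refine mul_le_mul_of_nonneg_left ((norm_add_le _ _).trans (add_le_add le_rfl ?_))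
      (by positivity)
    refine (norm_sub_le _ _).trans ?_
    rw [norm_hsColumns_one, norm_hsColumns_smulRight, sq]
  have iV : Integrable (fun x => ‖V x‖) (simplexUniform b ν) :=
    integrable_simplexUniform b ν hVc.norm
  have iW : Integrable (fun x => ‖W x‖ ^ 2) (simplexUniform b ν) :=
    integrable_simplexUniform b ν (by fun_prop)
  have i2 : Integrable (fun x => √k + ‖W x‖ ^ 2) (simplexUniform b ν) :=
    (integrable_const _).add iW
  unfold SteinFrame.discrepancy
  refine (integral_mono_of_nonneg (ae_of_all _ fun x => norm_nonneg _)
    ((iV.add i2).const_mul (1 / N)) (ae_of_all _ hpt)).trans ?_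
  rw [integral_const_mul]
  refine mul_le_mul_of_nonneg_left ?_ (by positivity)
  rw [show (∫ x, ((fun x => ‖V x‖) + fun x => √k + ‖W x‖ ^ 2) x ∂(simplexUniform b ν))
    = ∫ x, (‖V x‖ + (√k + ‖W x‖ ^ 2)) ∂(simplexUniform b ν) from rfl,
    integral_add iV i2, integral_add (integrable_const _) iW]
  have hV2 : MemLp (fun x => ‖V x‖) 2 (simplexUniform b ν) :=
    (memLp_two_iff_integrable_sq hVc.norm.aestronglyMeasurable).2
      (integrable_simplexUniform b ν (by fun_prop))
  have h1 := integral_le_sqrt_integral_sq hV2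
  have h2 := simplexUniform_norm_sq_sum_le b ν
    (fun l => hsColumns k (rankOneOp (W (b l)) (W (b l))))
  simp_rw [norm_hsColumns_smulRight, ← sq, ← pow_mul] at h2
  have h3 : √(k:ℝ) ≤ k := by
    rw [Real.sqrt_le_left (by positivity)]
    exact_mod_cast Nat.le_self_pow two_ne_zero k
  have h4 := hW.integral_norm_sq_le ν
  have h5 := h1.trans (Real.sqrt_le_sqrt h2)
  simp only [integral_const, probReal_univ, one_smul]
  linarith

/-- Pointwise bound for the derivatives of the Stein kernel along the frame. -/
theorem sum_norm_fderiv_kernel_le (hr : ∀ l, ‖W (b l)‖ ≤ Module.finrank ℝ E + 1) {x : E}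
    (hx : x ∈ convexHull ℝ (Set.range b)) :
    ∑ j, ‖hsColumns k (fderiv ℝ (simplexFrame b ν W hW.sum_eq_zero).kernel x
        ((simplexFrame b ν W hW.sum_eq_zero).u j x))‖
      ≤ √k / (Module.finrank ℝ E + 1 : ℝ)
        * (4 * ∑ l, b.coord l x * ‖W (b l)‖ ^ 2 + 2 * ‖W x‖ ^ 2) := by
  set D := simplexFrame b ν W hW.sum_eq_zero with hD
  set N : ℝ := Module.finrank ℝ E + 1 with hN
  have hN0 : 0 < N := by positivity
  have hl : ∀ l, 0 ≤ b.coord l x := (b.mem_convexHull_iff x).1 hx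
  have hWx : ‖W x‖ ≤ N := by
    rw [← b.sum_coord_smul_map W x]
    refine (norm_sum_le _ _).trans ?_
    calc ∑ l, ‖b.coord l x • W (b l)‖ ≤ ∑ l, b.coord l x * N := by
          refine Finset.sum_le_sum fun l _ => ?_
          rw [norm_smul, Real.norm_eq_abs, abs_of_nonneg (hl l)]
          exact mul_le_mul_of_nonneg_left (hr l) (hl l)
      _ = N := by rw [← Finset.sum_mul, b.sum_coord_apply_eq_one, one_mul]
  set s := ∑ l, b.coord l x * ‖W (b l)‖ ^ 2 with hs
  have h1 : ∑ j, ‖W (D.u j x)‖ ≤ √k / N * (s + ‖W x‖ ^ 2) := by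
    have h2 : ∀ j, ‖W (D.u j x)‖
        ≤ 1 / N * (∑ l, b.coord l x * (|W (b l) j| * ‖W (b l)‖) + |W x j| * ‖W x‖) := by
      intro j
      rw [hD, simplexFrame_map_u, norm_smul, Real.norm_eq_abs, ← hN, abs_of_pos (by positivity)]
      refine mul_le_mul_of_nonneg_left ((norm_sub_le _ _).trans (add_le_add
        ((norm_sum_le _ _).trans (Finset.sum_le_sum fun l _ => ?_)) ?_)) (by positivity)
      · rw [norm_smul, norm_mul, Real.norm_eq_abs, Real.norm_eq_abs, abs_of_nonneg (hl l),
          mul_assoc]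
      · rw [norm_smul, Real.norm_eq_abs]
    refine (Finset.sum_le_sum fun j _ => h2 j).trans ?_
    rw [← Finset.mul_sum, Finset.sum_add_distrib, Finset.sum_comm, ← Finset.sum_mul]
    simp_rw [← Finset.mul_sum, ← Finset.sum_mul]
    have h3 : ∑ l, b.coord l x * ((∑ j, |W (b l) j|) * ‖W (b l)‖) ≤ √k * s := by
      rw [hs, Finset.mul_sum]
      refine Finset.sum_le_sum fun l _ => ?_
      have := mul_le_mul_of_nonneg_left (mul_le_mul_of_nonneg_right
        (EuclideanSpace.sum_abs_le (W (b l))) (norm_nonneg (W (b l)))) (hl l)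
      linarith
    have h4 := mul_le_mul_of_nonneg_right (EuclideanSpace.sum_abs_le (W x)) (norm_nonneg (W x))
    calc _ ≤ 1 / N * (√k * s + √k * ‖W x‖ * ‖W x‖) :=
          mul_le_mul_of_nonneg_left (add_le_add h3 h4) (by positivity)
      _ = _ := by ring
  have h5 : ∀ j, ‖hsColumns k (fderiv ℝ D.kernel x (D.u j x))‖
      ≤ 1 / N * (∑ l, b.coord l x / N * (|W (b l) j| + |W x j|) * ‖W (b l)‖ ^ 2)
        + 2 * ‖W (D.u j x)‖ := by
    intro j
    rw [hD, simplexFrame_fderiv_kernel, map_smul, norm_smul, Real.norm_eq_abs, ← hN,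
      abs_of_pos (by positivity), map_sub, map_sum, map_add]
    have h6 : ‖∑ l, hsColumns k ((b.coord l).linear
        ((simplexFrame b ν W hW.sum_eq_zero).u j x) • rankOneOp (W (b l)) (W (b l)))‖
        ≤ ∑ l, b.coord l x / N * (|W (b l) j| + |W x j|) * ‖W (b l)‖ ^ 2 := by
      refine (norm_sum_le _ _).trans (Finset.sum_le_sum fun l _ => ?_)
      rw [map_smul, norm_smul, norm_hsColumns_smulRight, simplexFrame_coord_linear_u, ← hN, ← sq,
        norm_mul, Real.norm_eq_abs, Real.norm_eq_abs,
        abs_of_nonneg (div_nonneg (hl l) hN0.le)]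
      refine mul_le_mul_of_nonneg_right (mul_le_mul_of_nonneg_left (abs_sub _ _)
        (div_nonneg (hl l) hN0.le)) (by positivity)
    have h7 := norm_add_le
      (hsColumns k (rankOneOp (W x) (W ((simplexFrame b ν W hW.sum_eq_zero).u j x))))
      (hsColumns k (rankOneOp (W ((simplexFrame b ν W hW.sum_eq_zero).u j x)) (W x)))
    rw [norm_hsColumns_smulRight, norm_hsColumns_smulRight] at h7
    have h8 := mul_le_mul_of_nonneg_right hWx
      (norm_nonneg (W ((simplexFrame b ν W hW.sum_eq_zero).u j x)))
    refine (mul_le_mul_of_nonneg_left ((norm_sub_le _ _).trans (add_le_add h6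
      (h7.trans (?_ : _ ≤ N * (2 * ‖W ((simplexFrame b ν W hW.sum_eq_zero).u j x)‖)))))
      (by positivity)).trans ?_
    · linarith
    · rw [mul_add, ← mul_assoc (1 / N) N, one_div_mul_cancel hN0.ne', one_mul]
  refine (Finset.sum_le_sum fun j _ => h5 j).trans ?_
  rw [Finset.sum_add_distrib, ← Finset.mul_sum, ← Finset.mul_sum, Finset.sum_comm]
  have h9 : ∑ l, ∑ j, b.coord l x / N * (|W (b l) j| + |W x j|) * ‖W (b l)‖ ^ 2
      ≤ 2 * √k * s := by
    rw [hs, Finset.mul_sum]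
    refine Finset.sum_le_sum fun l _ => ?_
    rw [← Finset.sum_mul, ← Finset.mul_sum, Finset.sum_add_distrib]
    have h10 : ∑ j, |W (b l) j| + ∑ j, |W x j| ≤ √k * N + √k * N :=
      add_le_add ((EuclideanSpace.sum_abs_le _).trans
        (mul_le_mul_of_nonneg_left (hr l) (by positivity)))
        ((EuclideanSpace.sum_abs_le _).trans (mul_le_mul_of_nonneg_left hWx (by positivity)))
    calc _ ≤ b.coord l x / N * (√k * N + √k * N) * ‖W (b l)‖ ^ 2 := by
          have := div_nonneg (hl l) hN0.le
          gcongr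
      _ = _ := by field_simp; ring
  calc _ ≤ 1 / N * (2 * √k * s) + 2 * (√k / N * (s + ‖W x‖ ^ 2)) := by gcongr
    _ = _ := by ring

theorem shiftConst_le (hr : ∀ l, ‖W (b l)‖ ≤ Module.finrank ℝ E + 1) :
    (simplexFrame b ν W hW.sum_eq_zero).shiftConst ≤ 202 * (k * √k) := by
  set D := simplexFrame b ν W hW.sum_eq_zero with hD
  set N : ℝ := Module.finrank ℝ E + 1 with hN
  have hN2 : (Module.finrank ℝ E + 2 : ℝ) = N + 1 := by rw [hN]; ring
  have hN1 : 1 ≤ N := by rw [hN]; linarith [(Nat.cast_nonneg (Module.finrank ℝ E) : (0:ℝ) ≤ _)]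
  have hN0 : 0 < N := by linarith
  have hc := fun l => continuous_barycentric_coord b l
  have i1 : Integrable (fun x => ‖W x‖) (simplexUniform b ν) :=
    integrable_simplexUniform b ν (by fun_prop)
  have i2 : Integrable (fun x => ‖W x‖ ^ 2) (simplexUniform b ν) :=
    integrable_simplexUniform b ν (by fun_prop)
  have i0 : ∀ l, Integrable (fun x => b.coord l x * ‖W (b l)‖ ^ 2) (simplexUniform b ν) :=
    fun l => integrable_simplexUniform b ν (by have := hc l; fun_prop)
  have i3 : Integrable (fun x => ∑ l, b.coord l x * ‖W (b l)‖ ^ 2) (simplexUniform b ν) :=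
    integrable_finsetSum _ fun l _ => i0 l
  have e3 : ∫ x, ∑ l, b.coord l x * ‖W (b l)‖ ^ 2 ∂(simplexUniform b ν) = (N + 1) * k := by
    rw [integral_finsetSum _ fun l _ => i0 l]
    simp_rw [integral_mul_const, simplexUniform_coord]
    rw [← Finset.mul_sum, hW.sum_norm_sq, hN2, ← hN]
    field_simp
  have hbd : ∀ᵐ x ∂(simplexUniform b ν), 2 * ‖D.W x‖
      + 20 * ∑ j, ‖hsColumns k (fderiv ℝ D.kernel x (D.u j x))‖
      ≤ 2 * ‖W x‖ + 20 * (√k / N * (4 * ∑ l, b.coord l x * ‖W (b l)‖ ^ 2 + 2 * ‖W x‖ ^ 2)) := by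
    filter_upwards [ae_mem_simplexUniform b ν] with x hx
    have := hW.sum_norm_fderiv_kernel_le ν hr hx
    exact add_le_add le_rfl (mul_le_mul_of_nonneg_left this (by norm_num))
  have i4 : Integrable (fun x => 4 * ∑ l, b.coord l x * ‖W (b l)‖ ^ 2 + 2 * ‖W x‖ ^ 2)
      (simplexUniform b ν) := (i3.const_mul 4).add (i2.const_mul 2)
  unfold SteinFrame.shiftConst
  refine (integral_mono_of_nonneg (ae_of_all _ fun x => add_nonneg (by positivity)
    (mul_nonneg (by norm_num) (Finset.sum_nonneg fun _ _ => norm_nonneg _)))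
    ((i1.const_mul 2).add ((i4.const_mul (√k / N)).const_mul 20)) hbd).trans ?_
  refine (integral_add (i1.const_mul 2) ((i4.const_mul (√k / N)).const_mul 20)).trans_le ?_
  rw [integral_const_mul, integral_const_mul, integral_const_mul,
    integral_add (i3.const_mul 4) (i2.const_mul 2), integral_const_mul, integral_const_mul, e3]
  have h1 := hW.integral_norm_le ν
  have h2 := hW.integral_norm_sq_le ν
  have hk : √(k:ℝ) ≤ k * √k := by
    rcases Nat.eq_zero_or_pos k with h0 | h0
    · rw [h0]; simp
    · exact le_mul_of_one_le_left (Real.sqrt_nonneg _) (by exact_mod_cast h0)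
  have h3 : √k / N * (4 * ((N + 1) * k) + 2 * ∫ x, ‖W x‖ ^ 2 ∂(simplexUniform b ν))
      ≤ 10 * (k * √k) := by
    calc _ ≤ √k / N * (4 * ((N + 1) * k) + 2 * k) := by gcongr
      _ = (k * √k) * ((4 * N + 6) / N) := by ring
      _ ≤ (k * √k) * 10 := by
          refine mul_le_mul_of_nonneg_left ?_ (by positivity)
          rw [div_le_iff₀ hN0]; linarith
      _ = _ := by ring
  linarith

end IsotropicMap

end SimplexEstimates

/-! ### Regular simplices inscribed in the unit sphere -/

section RegularSimplex

variable {n : ℕ} {S : Affine.Simplex ℝ (EuclideanSpace ℝ (Fin n)) n}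

theorem Affine.Simplex.Regular.exists_inner_eq (hS : S.Regular) (h1 : ∀ l, ‖S.points l‖ = 1) :
    ∃ β : ℝ, ∀ l m, l ≠ m → inner ℝ (S.points l) (S.points m) = β := by
  obtain ⟨r, hr⟩ := hS.equilateral
  refine ⟨1 - r ^ 2 / 2, fun l m hlm => ?_⟩
  have h2 := norm_sub_sq_real (S.points l) (S.points m)
  rw [← dist_eq_norm, hr l m hlm, h1, h1] at h2
  linarith

theorem Affine.Simplex.Regular.sum_points_eq_zero (hn : n ≠ 0) (hS : S.Regular)
    (h1 : ∀ l, ‖S.points l‖ = 1) : ∑ l, S.points l = 0 := by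
  obtain ⟨β, hβ⟩ := hS.exists_inner_eq h1
  have hβ1 : β ≠ 1 := by
    intro h
    have h01 : (0 : Fin (n + 1)) ≠ Fin.last n := by
      intro h; exact hn (by simpa using (congrArg Fin.val h).symm)
    have h2 := (inner_eq_one_iff_of_norm_eq_one (𝕜 := ℝ) (h1 0) (h1 (Fin.last n))).1
      ((hβ _ _ h01).trans h)
    exact h01 (S.independent.injective h2)
  have hd : ¬ LinearIndependent ℝ S.points := by
    intro h
    have := h.fintype_card_le_finrank
    simp at this
  obtain ⟨c, hc, i, hi⟩ := Fintype.not_linearIndependent_iff.1 hd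
  have hin : ∀ m, (1 - β) * c m = -(β * ∑ l, c l) := by
    intro m
    have h2 := congrArg (fun x => inner ℝ x (S.points m)) hc
    simp only [sum_inner, inner_smul_left, inner_zero_left, RCLike.conj_to_real] at h2
    have h3 : ∀ l, c l * inner ℝ (S.points l) (S.points m)
        = β * c l + if l = m then (1 - β) * c m else 0 := by
      intro l
      split_ifs with h
      · rw [h, real_inner_self_eq_norm_sq, h1]; ring
      · rw [hβ l m h]; ring
    simp only [h3, Finset.sum_add_distrib, ← Finset.mul_sum, Finset.sum_ite_eq', Finset.mem_univ,
      if_true] at h2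
    linarith
  have hconst : ∀ m, c m = c i := fun m =>
    mul_left_cancel₀ (sub_ne_zero.2 hβ1.symm) ((hin m).trans (hin i).symm)
  simp_rw [hconst, ← Finset.smul_sum] at hc
  exact (smul_eq_zero.1 hc).resolve_left hi

theorem Affine.Simplex.Regular.inner_points (hn : n ≠ 0) (hS : S.Regular)
    (h1 : ∀ l, ‖S.points l‖ = 1) {l m : Fin (n + 1)} (hlm : l ≠ m) :
    inner ℝ (S.points l) (S.points m) = -1 / (n : ℝ) := by
  obtain ⟨β, hβ⟩ := hS.exists_inner_eq h1
  have h2 := congrArg (fun x => inner ℝ x (S.points m)) (hS.sum_points_eq_zero hn h1)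
  simp only [sum_inner, inner_zero_left] at h2
  have h3 : ∀ l, inner ℝ (S.points l) (S.points m) = β + if l = m then 1 - β else 0 := by
    intro l
    split_ifs with h
    · rw [h, real_inner_self_eq_norm_sq, h1]; ring
    · rw [hβ l m h]; ring
  simp only [h3, Finset.sum_add_distrib, Finset.sum_ite_eq', Finset.mem_univ, if_true,
    Finset.sum_const, Finset.card_univ, Fintype.card_fin, nsmul_eq_mul] at h2
  push_cast at h2
  have hn' : (n : ℝ) ≠ 0 := by exact_mod_cast hn
  rw [hβ l m hlm, eq_div_iff hn']
  linarith

variable (S) in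
/-- The affine basis formed by the vertices of a full-dimensional simplex, dilated by `r`. -/
def Affine.Simplex.scaledBasis (r : ℝˣ) :
    AffineBasis (Fin (n + 1)) ℝ (EuclideanSpace ℝ (Fin n)) :=
  r • ⟨S.points, S.independent, S.span_eq_top (by simp)⟩

variable (S) in
theorem Affine.Simplex.scaledBasis_apply (r : ℝˣ) (l : Fin (n + 1)) :
    S.scaledBasis r l = (r : ℝ) • S.points l := rfl

/-- The vertices of a regular simplex inscribed in the unit sphere form a tight frame. -/
theorem Affine.Simplex.Regular.sum_inner_smul (hn : n ≠ 0) (hS : S.Regular)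
    (h1 : ∀ l, ‖S.points l‖ = 1) (x : EuclideanSpace ℝ (Fin n)) :
    ∑ l, inner ℝ (S.points l) x • S.points l = ((n + 1 : ℝ) / n) • x := by
  have hn' : (n : ℝ) ≠ 0 := by exact_mod_cast hn
  have hv : ∀ m, ∑ l, inner ℝ (S.points l) (S.points m) • S.points l
      = ((n + 1 : ℝ) / n) • S.points m := by
    intro m
    have h3 : ∀ l, inner ℝ (S.points l) (S.points m) • S.points l
        = (-1 / (n : ℝ)) • S.points l + if l = m then ((n + 1 : ℝ) / n) • S.points m else 0 := by
      intro l
      split_ifs with h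
      · rw [h, real_inner_self_eq_norm_sq, h1, ← add_smul]
        congr 1
        field_simp
        ring
      · rw [hS.inner_points hn h1 h, add_zero]
    simp only [h3, Finset.sum_add_distrib, ← Finset.smul_sum, hS.sum_points_eq_zero hn h1,
      Finset.sum_ite_eq', Finset.mem_univ, if_true, smul_zero, zero_add]
  have hx := (S.scaledBasis 1).linear_combination_coord_eq_self x
  simp only [Affine.Simplex.scaledBasis_apply, Units.val_one, one_smul] at hx
  set c := fun m => (S.scaledBasis 1).coord m x
  calc ∑ l, inner ℝ (S.points l) x • S.points l
      = ∑ l, ∑ m, c m • inner ℝ (S.points l) (S.points m) • S.points l := by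
        refine Finset.sum_congr rfl fun l _ => ?_
        conv_lhs => rw [← hx]
        simp only [inner_sum, inner_smul_right, Finset.sum_smul, smul_smul, c]
    _ = ∑ m, c m • ((n + 1 : ℝ) / n) • S.points m := by
        rw [Finset.sum_comm]
        exact Finset.sum_congr rfl fun m _ => by rw [← Finset.smul_sum, hv]
    _ = ((n + 1 : ℝ) / n) • x := by
        conv_rhs => rw [← hx, Finset.smul_sum]
        exact Finset.sum_congr rfl fun m _ => smul_comm _ _ _

variable {k : ℕ} (θ : Fin k → EuclideanSpace ℝ (Fin n))

/-- The linear map `x ↦ (⟪θ i, x⟫)ᵢ`. -/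
def innerMap : EuclideanSpace ℝ (Fin n) →L[ℝ] EuclideanSpace ℝ (Fin k) :=
  ((EuclideanSpace.equiv (Fin k) ℝ).symm : (Fin k → ℝ) →L[ℝ] EuclideanSpace ℝ (Fin k)).comp
    (ContinuousLinearMap.pi fun i => innerSL ℝ (θ i))

theorem innerMap_apply (x : EuclideanSpace ℝ (Fin n)) (i : Fin k) :
    innerMap θ x i = inner ℝ (θ i) x := rfl

theorem inner_innerMap (x : EuclideanSpace ℝ (Fin n)) (v : EuclideanSpace ℝ (Fin k)) :
    inner ℝ (innerMap θ x) v = inner ℝ x (∑ i, v i • θ i) := by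
  rw [PiLp.inner_apply, inner_sum]
  refine Finset.sum_congr rfl fun i _ => ?_
  rw [innerMap_apply, inner_smul_right, real_inner_comm x]
  rfl

variable {θ}

theorem Orthonormal.innerMap_sum_smul (hθ : Orthonormal ℝ θ) (v : EuclideanSpace ℝ (Fin k)) :
    innerMap θ (∑ i, v i • θ i) = v := by
  ext i
  rw [innerMap_apply, hθ.inner_right_fintype]

theorem Orthonormal.norm_innerMap_le (hθ : Orthonormal ℝ θ) (x : EuclideanSpace ℝ (Fin n)) :
    ‖innerMap θ x‖ ≤ ‖x‖ := by
  refine le_of_sq_le_sq ?_ (norm_nonneg x)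
  rw [EuclideanSpace.real_norm_sq_eq]
  simpa [innerMap_apply] using hθ.sum_inner_products_le (s := Finset.univ) x

theorem Affine.Simplex.Regular.isotropicMap (hn : n ≠ 0) (hS : S.Regular)
    (h1 : ∀ l, ‖S.points l‖ = 1) (hθ : Orthonormal ℝ θ) {r : ℝˣ}
    (hr : (r : ℝ) ^ 2 = n * (n + 2)) : IsotropicMap (S.scaledBasis r) (innerMap θ) where
  sum_eq_zero := by
    simp only [Affine.Simplex.scaledBasis_apply, map_smul, ← Finset.smul_sum]
    rw [← map_sum, hS.sum_points_eq_zero hn h1, map_zero, smul_zero]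
  tight v := by
    have hn' : (n : ℝ) ≠ 0 := by exact_mod_cast hn
    have h2 := congrArg (innerMap θ) (hS.sum_inner_smul hn h1 (∑ i, v i • θ i))
    rw [map_smul, hθ.innerMap_sum_smul, map_sum] at h2
    simp only [Affine.Simplex.scaledBasis_apply, inner_innerMap, inner_smul_left, map_smul,
      RCLike.conj_to_real, smul_smul] at h2 ⊢
    calc _ = ∑ l, (r : ℝ) ^ 2 •
          (inner ℝ (S.points l) (∑ i, v i • θ i) • innerMap θ (S.points l)) :=
          Finset.sum_congr rfl fun l _ => by rw [smul_smul]; congr 1; ring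
      _ = _ := by
          rw [← Finset.smul_sum, h2, smul_smul, hr, finrank_euclideanSpace_fin]
          congr 1
          field_simp

variable (S) in
theorem Affine.Simplex.convexHull_scaledBasis (r : ℝˣ) :
    convexHull ℝ (Set.range (S.scaledBasis r)) = (r : ℝ) • convexHull ℝ (Set.range S.points) := by
  rw [← convexHull_smul]
  congr 1
  ext x
  simp [Set.mem_smul_set, Affine.Simplex.scaledBasis_apply]

end RegularSimplex

/-! ### Bounds in terms of the fourth moments -/

section FourthMoments

variable {n k : ℕ} {S : Affine.Simplex ℝ (EuclideanSpace ℝ (Fin n)) n}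
  {θ : Fin k → EuclideanSpace ℝ (Fin n)}

theorem fourthMomentSum_nonneg (θ : Fin k → EuclideanSpace ℝ (Fin n))
    (v : Fin (n + 1) → EuclideanSpace ℝ (Fin n)) : 0 ≤ fourthMomentSum θ v :=
  Finset.sum_nonneg fun _ _ => Real.sqrt_nonneg _

/-- Cauchy-Schwarz in `i`, then `∑ αᵢ² ≤ (∑ αᵢ)²`. -/
theorem sum_norm_innerMap_pow_four_le (θ : Fin k → EuclideanSpace ℝ (Fin n))
    (v : Fin (n + 1) → EuclideanSpace ℝ (Fin n)) :
    ∑ l, ‖innerMap θ (v l)‖ ^ 4 ≤ k * fourthMomentSum θ v ^ 2 := by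
  have h1 : ∀ l, ‖innerMap θ (v l)‖ ^ 4 ≤ k * ∑ i, (inner ℝ (θ i) (v l)) ^ 4 := by
    intro l
    have h := sq_sum_le_card_mul_sum_sq (s := Finset.univ) (f := fun i => inner ℝ (θ i) (v l) ^ 2)
    have h2 : ‖innerMap θ (v l)‖ ^ 4 = (∑ i, inner ℝ (θ i) (v l) ^ 2) ^ 2 := by
      rw [show 4 = 2 * 2 from rfl, pow_mul, EuclideanSpace.real_norm_sq_eq]
      rfl
    rw [h2]
    simpa [← pow_mul] using h
  refine (Finset.sum_le_sum fun l _ => h1 l).trans ?_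
  rw [← Finset.mul_sum, Finset.sum_comm]
  refine mul_le_mul_of_nonneg_left ?_ (Nat.cast_nonneg k)
  have h3 : ∀ i, ∑ l, inner ℝ (θ i) (v l) ^ 4 = √(∑ l, inner ℝ (θ i) (v l) ^ 4) ^ 2 :=
    fun i => (Real.sq_sqrt (Finset.sum_nonneg fun l _ => by positivity)).symm
  rw [Finset.sum_congr rfl fun i _ => h3 i]
  exact Finset.sum_sq_le_sq_sum_of_nonneg fun i _ => Real.sqrt_nonneg _

/-- By the tight frame property and the Cauchy-Schwarz inequality, the fourth moments cannot be
small. -/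
theorem Affine.Simplex.Regular.card_sq_div_le (hn : n ≠ 0) (hS : S.Regular)
    (h1 : ∀ l, ‖S.points l‖ = 1) (hθ : Orthonormal ℝ θ) :
    (k : ℝ) ^ 2 / (n + 1) ≤ fourthMomentSum θ S.points ^ 2 := by
  have hn' : (0 : ℝ) < n := by exact_mod_cast Nat.pos_of_ne_zero hn
  have h2 : ∀ i, 1 / √(n + 1 : ℝ) ≤ √(∑ l, inner ℝ (θ i) (S.points l) ^ 4) := by
    intro i
    rw [show 1 / √(n + 1 : ℝ) = √(1 / (n + 1 : ℝ)) by rw [Real.sqrt_div zero_le_one, Real.sqrt_one]]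
    refine Real.sqrt_le_sqrt ?_
    have h3 : ∑ l, inner ℝ (θ i) (S.points l) ^ 2 = (n + 1 : ℝ) / n := by
      have h := congrArg (fun x => inner ℝ (θ i) x) (hS.sum_inner_smul hn h1 (θ i))
      simp only [inner_sum, inner_smul_right, real_inner_self_eq_norm_sq, hθ.1 i, one_pow,
        mul_one] at h
      rw [← h]
      exact Finset.sum_congr rfl fun l _ => by rw [sq, real_inner_comm]
    have h4 := sq_sum_le_card_mul_sum_sq (s := Finset.univ)
      (f := fun l => inner ℝ (θ i) (S.points l) ^ 2)
    simp only [← pow_mul, h3, Finset.card_univ, Fintype.card_fin] at h4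
    rw [div_le_iff₀ (by positivity)]
    have h5 : (1 : ℝ) ≤ (n + 1 : ℝ) / n := by rw [le_div_iff₀ hn']; linarith
    push_cast at h4
    nlinarith
  have h3 : (k : ℝ) * (1 / √(n + 1 : ℝ)) ≤ fourthMomentSum θ S.points := by
    have := Finset.sum_le_sum fun i (_ : i ∈ Finset.univ) => h2 i
    simpa [fourthMomentSum] using this
  have h4 := pow_le_pow_left₀ (by positivity) h3 2
  rwa [mul_pow, div_pow, Real.sq_sqrt (by positivity), one_pow, mul_one_div] at h4

theorem Affine.Simplex.Regular.discrepancy_le (hn : n ≠ 0) (hS : S.Regular)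
    (h1 : ∀ l, ‖S.points l‖ = 1) (hθ : Orthonormal ℝ θ) {r : ℝˣ}
    (hr : (r : ℝ) ^ 2 = n * (n + 2)) (hF : fourthMomentSum θ S.points ≤ 1) :
    (simplexFrame (S.scaledBasis r) volume (innerMap θ)
      (hS.isotropicMap hn h1 hθ hr).sum_eq_zero).discrepancy
      ≤ 3 * (√k * fourthMomentSum θ S.points) := by
  set F := fourthMomentSum θ S.points with hFdef
  have hF0 : 0 ≤ F := fourthMomentSum_nonneg _ _
  have hn' : (0 : ℝ) < n := by exact_mod_cast Nat.pos_of_ne_zero hn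
  refine ((hS.isotropicMap hn h1 hθ hr).discrepancy_le volume).trans ?_
  rw [finrank_euclideanSpace_fin, mul_add]
  have h2 : 1 / (n + 1 : ℝ) * (2 * k) ≤ 2 * (√k * F) := by
    have h3 := hS.card_sq_div_le hn h1 hθ
    rw [← hFdef] at h3
    rcases Nat.eq_zero_or_pos k with h0 | h0
    · rw [h0]; simp
    · have hk : (1 : ℝ) ≤ k := by exact_mod_cast h0
      have hk' : 1 ≤ √(k : ℝ) := by rwa [Real.one_le_sqrt]
      calc 1 / (n + 1 : ℝ) * (2 * k) = 2 * (k / (n + 1)) := by ring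
        _ ≤ 2 * ((k : ℝ) ^ 2 / (n + 1)) := by gcongr; nlinarith
        _ ≤ 2 * F ^ 2 := by gcongr
        _ ≤ 2 * (√k * F) := by nlinarith
  have h4 : 1 / (n + 1 : ℝ) * √((∑ l, ‖innerMap θ (S.scaledBasis r l)‖ ^ 4)
      / ((n + 1 : ℝ) * (n + 2 : ℝ))) ≤ √k * F := by
    have h5 : ∑ l, ‖innerMap θ (S.scaledBasis r l)‖ ^ 4
        ≤ ((n : ℝ) * (n + 2)) ^ 2 * (k * F ^ 2) := by
      refine le_trans (le_of_eq ?_) (mul_le_mul_of_nonneg_left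
        (sum_norm_innerMap_pow_four_le θ S.points) (by positivity))
      rw [Finset.mul_sum]
      refine Finset.sum_congr rfl fun l _ => ?_
      rw [Affine.Simplex.scaledBasis_apply, map_smul, norm_smul, mul_pow, ← hr, ← pow_mul,
        Real.norm_eq_abs, Even.pow_abs ⟨2, rfl⟩]
    rw [one_div_mul_eq_div, div_le_iff₀ (by positivity)]
    refine Real.sqrt_le_iff.2 ⟨by positivity, ?_⟩
    rw [mul_pow, mul_pow, Real.sq_sqrt (by positivity), div_le_iff₀ (by positivity)]
    refine h5.trans ?_
    have h6 : ((n : ℝ) * (n + 2)) ^ 2 ≤ (n + 1) ^ 2 * ((n + 1) * (n + 2)) := by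
      nlinarith [mul_pos hn' hn', mul_pos (mul_pos hn' hn') hn']
    calc _ ≤ (n + 1 : ℝ) ^ 2 * ((n + 1) * (n + 2)) * (k * F ^ 2) := by gcongr
      _ = _ := by ring
  linarith

theorem Affine.Simplex.Regular.shiftConst_le (hn : n ≠ 0) (hS : S.Regular)
    (h1 : ∀ l, ‖S.points l‖ = 1) (hθ : Orthonormal ℝ θ) {r : ℝˣ}
    (hr : (r : ℝ) ^ 2 = n * (n + 2)) :
    (simplexFrame (S.scaledBasis r) volume (innerMap θ)
      (hS.isotropicMap hn h1 hθ hr).sum_eq_zero).shiftConst ≤ 202 * (k * √k) := by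
  refine (hS.isotropicMap hn h1 hθ hr).shiftConst_le volume fun l => ?_
  refine (hθ.norm_innerMap_le _).trans ?_
  rw [Affine.Simplex.scaledBasis_apply, norm_smul, h1, mul_one, finrank_euclideanSpace_fin,
    Real.norm_eq_abs]
  refine abs_le_of_sq_le_sq ?_ (by positivity)
  rw [hr]
  linarith

/-- Wasserstein bound against a fixed Lipschitz test function. -/
theorem Affine.Simplex.Regular.abs_integral_sub_le (hn : n ≠ 0) (hS : S.Regular)
    (h1 : ∀ l, ‖S.points l‖ = 1) (hθ : Orthonormal ℝ θ) {r : ℝˣ}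
    (hr : (r : ℝ) ^ 2 = n * (n + 2)) {f : EuclideanSpace ℝ (Fin k) → ℝ}
    (hf : LipschitzWith 1 f) :
    |(∫ x, f (innerMap θ x) ∂(simplexUniform (S.scaledBasis r) volume))
      - ∫ z, f z ∂(stdGaussian (EuclideanSpace ℝ (Fin k)))|
      ≤ 20 * √(k * fourthMomentSum θ S.points) := by
  set F := fourthMomentSum θ S.points with hF
  have hF0 : 0 ≤ F := fourthMomentSum_nonneg _ _
  have hI := hS.isotropicMap hn h1 hθ hr
  rw [Real.sqrt_mul (Nat.cast_nonneg k)]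
  rcases le_total F 1 with h | h
  · have h2 := (simplexFrame (S.scaledBasis r) volume (innerMap θ)
      hI.sum_eq_zero).abs_integral_sub_le
        (fun g hg => integrable_simplexUniform _ _ hg) hf
    refine h2.trans ((mul_le_mul_of_nonneg_left (hS.discrepancy_le hn h1 hθ hr h)
      (by positivity)).trans ?_)
    rw [← hF]
    have h3 : F ≤ √F := Real.le_sqrt_of_sq_le (by nlinarith)
    have h4 : √(k:ℝ) * F ≤ √k * √F := mul_le_mul_of_nonneg_left h3 (Real.sqrt_nonneg _)
    have h5 := Real.pi_le_four
    have h6 : 0 ≤ √(k:ℝ) * F := by positivity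
    nlinarith
  · have hc := hf.continuous
    have i1 : Integrable (fun x => f (innerMap θ x)) (simplexUniform (S.scaledBasis r) volume) :=
      integrable_simplexUniform _ _ (by fun_prop)
    have i2 : Integrable f (stdGaussian (EuclideanSpace ℝ (Fin k))) :=
      integrable_stdGaussian_of_lipschitz hf
    have i3 : Integrable (fun x => ‖innerMap θ x‖) (simplexUniform (S.scaledBasis r) volume) :=
      integrable_simplexUniform _ _ (by fun_prop)
    have i4 : Integrable (fun z => ‖z‖) (stdGaussian (EuclideanSpace ℝ (Fin k))) :=
      integrable_stdGaussian_of_lipschitz lipschitzWith_one_norm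
    have hb : ∀ z, |f z - f 0| ≤ ‖z‖ := fun z => by
      simpa [Real.dist_eq] using hf.dist_le_mul z 0
    have e1 : |(∫ x, f (innerMap θ x) ∂(simplexUniform (S.scaledBasis r) volume)) - f 0| ≤ √k := by
      have : (∫ x, f (innerMap θ x) ∂(simplexUniform (S.scaledBasis r) volume)) - f 0
          = ∫ x, (f (innerMap θ x) - f 0) ∂(simplexUniform (S.scaledBasis r) volume) := by
        rw [integral_sub i1 (integrable_const _)]; simp
      rw [this]
      exact (abs_integral_le_integral_abs.trans (integral_mono
        (i1.sub (integrable_const _)).abs i3 fun x => hb _)).trans (hI.integral_norm_le volume)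
    have e2 : |(∫ z, f z ∂(stdGaussian (EuclideanSpace ℝ (Fin k)))) - f 0| ≤ √k := by
      have : (∫ z, f z ∂(stdGaussian (EuclideanSpace ℝ (Fin k)))) - f 0
          = ∫ z, (f z - f 0) ∂(stdGaussian (EuclideanSpace ℝ (Fin k))) := by
        rw [integral_sub i2 (integrable_const _)]; simp
      rw [this]
      exact (abs_integral_le_integral_abs.trans (integral_mono
        (i2.sub (integrable_const _)).abs i4 fun x => hb _)).trans stdGaussian_integral_norm_le
    have e3 := abs_sub_le (∫ x, f (innerMap θ x) ∂(simplexUniform (S.scaledBasis r) volume))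
      (f 0) (∫ z, f z ∂(stdGaussian (EuclideanSpace ℝ (Fin k))))
    rw [abs_sub_comm (f 0)] at e3
    have e4 : √(k:ℝ) ≤ √k * √F :=
      le_mul_of_one_le_right (Real.sqrt_nonneg _) (by rwa [Real.one_le_sqrt])
    have e5 := Real.sqrt_nonneg (k:ℝ)
    linarith

/-- Total variation bound against a fixed measurable set. -/
theorem Affine.Simplex.Regular.abs_measureReal_sub_le (hn : n ≠ 0) (hS : S.Regular)
    (h1 : ∀ l, ‖S.points l‖ = 1) (hθ : Orthonormal ℝ θ) {r : ℝˣ}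
    (hr : (r : ℝ) ^ 2 = n * (n + 2)) {A : Set (EuclideanSpace ℝ (Fin k))}
    (hA : MeasurableSet A) :
    |(simplexUniform (S.scaledBasis r) volume).real (innerMap θ ⁻¹' A)
      - (stdGaussian (EuclideanSpace ℝ (Fin k))).real A|
      ≤ 227 * ((k : ℝ) ^ (5 / 6 : ℝ) * fourthMomentSum θ S.points ^ (1 / 3 : ℝ)) := by
  have hI := hS.isotropicMap hn h1 hθ hr
  have hF2 := hS.card_sq_div_le hn h1 hθ
  have hdisc := hS.discrepancy_le hn h1 hθ hr
  set F := fourthMomentSum θ S.points with hFdef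
  have hF0 : 0 ≤ F := fourthMomentSum_nonneg _ _
  rcases Nat.eq_zero_or_pos k with h0 | h0
  · -- in dimension zero the only events are the empty and the sure one
    subst h0
    rcases Subsingleton.set_cases (p := fun A : Set (EuclideanSpace ℝ (Fin 0)) =>
      |(simplexUniform (S.scaledBasis r) volume).real (innerMap θ ⁻¹' A)
        - (stdGaussian (EuclideanSpace ℝ (Fin 0))).real A| ≤ 0) (by simp) (by simp) A with h
    refine h.trans (by positivity)
  have hk : (1 : ℝ) ≤ k := by exact_mod_cast h0
  have hFpos : 0 < F := by
    have : 0 < (k : ℝ) ^ 2 / (n + 1) := by positivity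
    exact lt_of_le_of_ne hF0 fun h => by rw [← h] at hF2; norm_num at hF2; linarith
  set s := √√(k : ℝ) with hs
  set q := √F with hq
  have hs1 : 1 ≤ s := by rw [hs, Real.one_le_sqrt, Real.one_le_sqrt]; exact hk
  have hs2 : s ^ 2 = √k := Real.sq_sqrt (Real.sqrt_nonneg _)
  have hs4 : s ^ 4 = k := by
    rw [show s ^ 4 = (s ^ 2) ^ 2 by ring, hs2, Real.sq_sqrt (Nat.cast_nonneg k)]
  have hq0 : 0 < q := Real.sqrt_pos.2 hFpos
  have hq2 : q ^ 2 = F := Real.sq_sqrt hF0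
  set R := (k : ℝ) ^ (5 / 6 : ℝ) * F ^ (1 / 3 : ℝ) with hR
  have hR0 : 0 < R := by positivity
  set w := s ^ 5 * q with hw
  have hw0 : 0 < w := by positivity
  have hRw : R ^ 3 = w ^ 2 := by
    have e1 : ((k : ℝ) ^ (5 / 6 : ℝ)) ^ 3 = s ^ 10 := by
      rw [← Real.rpow_natCast, ← Real.rpow_mul (by positivity), ← hs4, ← Real.rpow_natCast s 4,
        ← Real.rpow_mul (by positivity), ← Real.rpow_natCast s 10]
      norm_num
    have e2 : (F ^ (1 / 3 : ℝ)) ^ 3 = F := by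
      rw [← Real.rpow_natCast, ← Real.rpow_mul hF0]
      norm_num
    rw [hR, mul_pow, e1, e2, hw, ← hq2]
    ring
  rcases le_total w 1 with hw1 | hw1
  · have hwR : w ≤ R := by
      refine le_of_pow_le_pow_left₀ three_ne_zero hR0.le ?_
      rw [hRw]
      exact pow_le_pow_of_le_one hw0.le hw1 (by norm_num)
    have hs5 : (1:ℝ) ≤ s ^ 5 := one_le_pow₀ hs1
    have hq1 : q ≤ 1 := by nlinarith
    have hF1 : F ≤ 1 := by rw [← hq2]; nlinarith
    have hS1 := hdisc hF1
    -- the smoothing scale that balances the first and the last term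
    have ht : 0 < q / s ^ 3 := by positivity
    have h2 := (simplexFrame (S.scaledBasis r) volume (innerMap θ)
      hI.sum_eq_zero).abs_measureReal_sub_le
        (fun g hg => integrable_simplexUniform _ _ hg) ht hA
    refine h2.trans ?_
    have h3 := hS.shiftConst_le hn h1 hθ hr
    rw [← hs2, ← hq2] at hS1
    rw [← hs2, ← hs4] at h3
    rw [← hs2]
    have hD0 := (simplexFrame (S.scaledBasis r) volume (innerMap θ)
      hI.sum_eq_zero).discrepancy_nonneg
    have t1 : q / s ^ 3 * s ^ 2 * ((simplexFrame (S.scaledBasis r) volume (innerMap θ)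
        hI.sum_eq_zero).shiftConst + 1) ≤ 203 * w := by
      calc _ ≤ q / s ^ 3 * s ^ 2 * (202 * (s ^ 4 * s ^ 2) + s ^ 6) := by
            gcongr
            exact one_le_pow₀ hs1
        _ = 203 * w := by rw [hw]; field_simp; ring
    have t2 : 6 * (simplexFrame (S.scaledBasis r) volume (innerMap θ)
        hI.sum_eq_zero).discrepancy ≤ 18 * w := by
      have : s ^ 2 * q ^ 2 ≤ w := by
        calc s ^ 2 * q ^ 2 = s ^ 2 * q * q := by ring
          _ ≤ s ^ 5 * q * 1 := by
            gcongr
            · norm_num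
          _ = w := by rw [mul_one]
      linarith
    have t3 : Real.pi / 2 * (simplexFrame (S.scaledBasis r) volume (innerMap θ)
        hI.sum_eq_zero).discrepancy / (q / s ^ 3) ≤ 6 * w := by
      calc _ ≤ 4 / 2 * (3 * (s ^ 2 * q ^ 2)) / (q / s ^ 3) := by
            gcongr
            exact Real.pi_le_four
        _ = 6 * w := by rw [hw]; field_simp; ring
    linarith
  · have hR1 : 1 ≤ R := by
      by_contra hlt
      have h3 : R ^ 3 < 1 := pow_lt_one₀ hR0.le (not_le.1 hlt) three_ne_zero
      have h4 : 1 ≤ w ^ 2 := one_le_pow₀ hw1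
      linarith
    have a1 : (simplexUniform (S.scaledBasis r) volume).real (innerMap θ ⁻¹' A) ≤ 1 :=
      measureReal_le_one
    have a2 : (stdGaussian (EuclideanSpace ℝ (Fin k))).real A ≤ 1 := measureReal_le_one
    have a3 : 0 ≤ (simplexUniform (S.scaledBasis r) volume).real (innerMap θ ⁻¹' A) :=
      measureReal_nonneg
    have a4 : 0 ≤ (stdGaussian (EuclideanSpace ℝ (Fin k))).real A := measureReal_nonneg
    rw [abs_le]
    constructor <;> linarith

end FourthMoments

end

theorem theorem2 :
    ∃ C : ℝ, 0 < C ∧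
      ∀ (n k : ℕ), 2 ≤ n →
      -- the vertices `v_ℓ` of a regular simplex, all of norm one
      ∀ (S : Affine.Simplex ℝ (EuclideanSpace ℝ (Fin n)) n), S.Regular →
        (∀ l, ‖S.points l‖ = 1) →
      ∀ (θ : Fin k → EuclideanSpace ℝ (Fin n)), Orthonormal ℝ θ →
      ∀ {Ω Ω' : Type*} [MeasurableSpace Ω] [MeasurableSpace Ω']
        (P : Measure Ω) [IsProbabilityMeasure P] (P' : Measure Ω') [IsProbabilityMeasure P']
        (X : Ω → EuclideanSpace ℝ (Fin n)) (Z : Ω' → EuclideanSpace ℝ (Fin k)),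
        pdf.IsUniform X (scaledSimplex S) P volume →
        HasLaw Z (stdGaussian (EuclideanSpace ℝ (Fin k))) P' →
        wassersteinDist P (marginal θ X) P' Z
            ≤ ENNReal.ofReal (20 * Real.sqrt (k * fourthMomentSum θ S.points)) ∧
        tvDist P (marginal θ X) P' Z
            ≤ ENNReal.ofReal
                (C * (k : ℝ) ^ (5 / 6 : ℝ) * fourthMomentSum θ S.points ^ (1 / 3 : ℝ)) := by
  refine ⟨454, by norm_num, ?_⟩
  intro n k hn S hS h1 θ hθ Ω Ω' _ _ P _ P' _ X Z hX hZ
  have hn0 : n ≠ 0 := by omega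
  have hn' : (0 : ℝ) < n := by exact_mod_cast Nat.pos_of_ne_zero hn0
  have hr0 : √(n * (n + 2) : ℝ) ≠ 0 := (Real.sqrt_pos.2 (by positivity)).ne'
  set r : ℝˣ := Units.mk0 _ hr0 with hrdef
  have hr : (r : ℝ) ^ 2 = n * (n + 2) := Real.sq_sqrt (by positivity)
  have hmap : P.map X = simplexUniform (S.scaledBasis r) volume := by
    rw [simplexUniform, S.convexHull_scaledBasis r]
    exact hX
  have hXm : AEMeasurable X P := by
    by_contra h
    have h2 := isProbabilityMeasure_simplexUniform (S.scaledBasis r) volume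
    rw [← hmap, Measure.map_of_not_aemeasurable h] at h2
    exact IsProbabilityMeasure.ne_zero (0 : Measure (EuclideanSpace ℝ (Fin n))) rfl
  have hmarg : marginal θ X = innerMap θ ∘ X := by
    funext ω
    ext i
    exact real_inner_comm _ _
  constructor
  · refine iSup₂_le fun f hf => ENNReal.ofReal_le_ofReal ?_
    have hc := hf.continuous
    have e1 : ∫ ω, f (marginal θ X ω) ∂P
        = ∫ x, f (innerMap θ x) ∂(simplexUniform (S.scaledBasis r) volume) := by
      rw [← hmap, integral_map hXm (by fun_prop), hmarg]
      rfl
    have e2 : ∫ ω, f (Z ω) ∂P' = ∫ z, f z ∂(stdGaussian (EuclideanSpace ℝ (Fin k))) := by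
      rw [← hZ.map_eq, integral_map hZ.aemeasurable (by fun_prop)]
    rw [e1, e2]
    exact hS.abs_integral_sub_le hn0 h1 hθ hr hf
  · have h2 : (454 * (k : ℝ) ^ (5 / 6 : ℝ) * fourthMomentSum θ S.points ^ (1 / 3 : ℝ))
        = 2 * (227 * ((k : ℝ) ^ (5 / 6 : ℝ) * fourthMomentSum θ S.points ^ (1 / 3 : ℝ))) := by
      ring
    rw [h2, ENNReal.ofReal_mul zero_le_two, ENNReal.ofReal_ofNat]
    refine mul_le_mul_right (iSup₂_le fun A hA => ENNReal.ofReal_le_ofReal ?_) _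
    have e1 : P.real (marginal θ X ⁻¹' A)
        = (simplexUniform (S.scaledBasis r) volume).real (innerMap θ ⁻¹' A) := by
      rw [← hmap, measureReal_def, measureReal_def, Measure.map_apply_of_aemeasurable hXm
        ((innerMap θ).continuous.measurable hA), hmarg]
      rfl
    have e2 : P'.real (Z ⁻¹' A) = (stdGaussian (EuclideanSpace ℝ (Fin k))).real A := by
      rw [← hZ.map_eq, measureReal_def, measureReal_def,
        Measure.map_apply_of_aemeasurable hZ.aemeasurable hA]
    rw [e1, e2]
    exact hS.abs_measureReal_sub_le hn0 h1 hθ hr hA
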